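/- Let $N$ be a natural number. For $i=1,\dots,N$ let $p^{(i)}_n=\sum_{k\ge1}(x^{(i)}_k)^n$ $(n\ge 1)$ be the power sums in a family of variables $x^{(i)}_1,x^{(i)}_2,\dots$, and for a field $K$ of characteristic $0$ let $\Lambda_K=K[p^{(i)}_n : 1\le i\le N,\ n\ge1]$ be the ring of functions symmetric in each of the $N$ families. For an $N$-tuple of partitions $\vec\lambda=(\lambda^{(1)},\dots,\lambda^{(N)})$ let $m_{\vec\lambda}=\prod_i m_{\lambda^{(i)}}(x^{(i)})$ be the product of monomial symmetric functions. Write $\vec\mu\le^{\mathrm L}\vec\lambda$ if $\sum_i|\mu^{(i)}|=\sum_i|\lambda^{(i)}|$ and $$\sum_{l>j}|\mu^{(l)}|+\sum_{k=1}^{r}\mu^{(j)}_k\ \le\ \sum_{l>j}|\lambda^{(l)}|+\sum_{k=1}^{r}\lambda^{(j)}_k\qquad\text{for all } 1\le j\le N,\ r\ge1,$$ and $\vec\mu<^{\mathrm L}\vec\lambda$ if moreover $\vec\mu\ne\vec\lambda$. For parameters $q^{1/4},t^{1/4},u_1,\dots,u_N$ put $$\eta^{(i)}(z)=\exp\Big(\sum_{n\ge1}\tfrac{1-t^{-n}}{n}z^np^{(i)}_n\Big)\exp\Big(-\sum_{n\ge1}(1-q^n)z^{-n}\tfrac{\partial}{\partial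 p^{(i)}_n}\Big),$$ $$\varphi^{(i)}_-(z)=\exp\Big(\sum_{n\ge1}\tfrac{1-t^{-n}}{n}(1-t^nq^{-n})(t/q)^{-n/4}z^np^{(i)}_n\Big),$$ $$\widetilde\Lambda_i(z)=\Big(\prod_{k=1}^{i-1}\varphi^{(k)}_-\big((t/q)^{\frac{2k-1}{4}}z\big)\Big)\,\eta^{(i)}\big((t/q)^{\frac{i-1}{2}}z\big),$$ and let $X_0$ be the coefficient of $z^0$ in $\sum_{i=1}^Nu_i\widetilde\Lambda_i(z)$. For parameters $\beta,u'_1,\dots,u'_N$ put $$\mathcal H_\beta=\sum_{i=1}^N\Big\{\tfrac12\sum_{n,m\ge1}\Big(\beta(n+m)p^{(i)}_np^{(i)}_m\tfrac{\partial}{\partial p^{(i)}_{n+m}}+nm\,p^{(i)}_{n+m}\tfrac{\partial^2}{\partial p^{(i)}_n\partial p^{(i)}_m}\Big)+\sum_{n\ge1}\Big(u'_i+\tfrac{1-\beta}{2}n\Big)n\,p^{(i)}_n\tfrac{\partial}{\partial p^{(i)}_n}\Big\}+(1-\beta)\sum_{i>j}\sum_{n\ge1}n^2p^{(j)}_n\tfrac{\partial}{\partial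 p^{(i)}_n}.$$ Fix an $N$-tuple of partitions $\vec\lambda$. (1) With $q^{1/4},t^{1/4},u_i$ indeterminates and $K=\mathbb Q(q^{1/4},t^{1/4},u_1,\dots,u_N)$, there is a unique $P_{\vec\lambda}\in\Lambda_K$ (the generalized Macdonald function) of the form $P_{\vec\lambda}=m_{\vec\lambda}+\sum_{\vec\mu<^{\mathrm L}\vec\lambda}d_{\vec\lambda\vec\mu}m_{\vec\mu}$ with $d_{\vec\lambda\vec\mu}\in K$ that is an eigenfunction of $X_0$ with an eigenvalue in $K$. (2) With $\beta,u'_i$ indeterminates and $K'=\mathbb Q(\beta,u'_1,\dots,u'_N)$, there is a unique $J_{\vec\lambda}\in\Lambda_{K'}$ (the generalized Jack function) of the form $J_{\vec\lambda}=m_{\vec\lambda}+\sum_{\vec\mu<^{\mathrm L}\vec\lambda}d'_{\vec\lambda\vec\mu}m_{\vec\mu}$ with $d'_{\vec\lambda\vec\mu}\in K'$ that is an eigenfunction of $\mathcal H_\beta$ with an eigenvalue in $K'$. This eigenvalue is $$e'_{\vec\lambda}(\beta,u')=\sum_{i=1}^N\sum_{k\ge1}\lambda^{(i)}_k\Big(u'_i+\tfrac{1}{2}\big(\lambda^{(i)}_k-(2k-1)\beta\big)\Big).$$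 (3) Under the specialization $u_i=q^{u'_i}$, $t=q^\beta$, $q=e^\hbar$, the functions $P_{\vec\lambda}$ converge to $J_{\vec\lambda}$ as $\hbar\to0$. Precisely: let $\beta,u'_1,\dots,u'_N$ be complex numbers that are generic in the sense that $\beta\ne0$ and $e'_{\vec\mu}(\beta,u')\ne e'_{\vec\lambda}(\beta,u')$ for all $\vec\mu<^{\mathrm L}\vec\lambda$. Then for every $\vec\mu<^{\mathrm L}\vec\lambda$ the rational function $d'_{\vec\lambda\vec\mu}$ is regular at $(\beta,u')$, the rational function $d_{\vec\lambda\vec\mu}$ is regular at the point $q^{1/4}=e^{\hbar/4}$, $t^{1/4}=e^{\beta\hbar/4}$, $u_i=e^{u'_i\hbar}$ for all sufficiently small complex $\hbar\neq0$, and its value there tends to $d'_{\vec\lambda\vec\mu}(\beta,u')$ as $\hbar\to0$. -/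

import Mathlib

open Filter Topology

noncomputable section

namespace GenMacdonald

/-! ### Partitions, tuples of partitions and the ordering `≥ᴸ` -/

/-- A partition: a weakly decreasing, finitely supported sequence of natural numbers.
The part usually called `λ_k` (`k ≥ 1`) is the entry with index `k - 1`. -/
abbrev Ptn : Type := {f : ℕ →₀ ℕ // Antitone f}

/-- `|λ|`. -/
def Ptn.size (l : Ptn) : ℕ := l.1.sum fun _ a => a

/-- `N`-tuples of partitions. -/
abbrev PtnTuple (N : ℕ) : Type := Fin N → Ptn

/-- `μ ≤ᴸ λ`. -/
def leL {N : ℕ} (mu lam : PtnTuple N) : Prop :=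
  (∑ i, (mu i).size = ∑ i, (lam i).size) ∧
    ∀ (j : Fin N) (i : ℕ),
      (∑ l ∈ Finset.Ioi j, (mu l).size) + ∑ k ∈ Finset.range (i + 1), (mu j).1 k ≤
        (∑ l ∈ Finset.Ioi j, (lam l).size) + ∑ k ∈ Finset.range (i + 1), (lam j).1 k

/-- `μ <ᴸ λ`. -/
def ltL {N : ℕ} (mu lam : PtnTuple N) : Prop := leL mu lam ∧ mu ≠ lam

/-! ### Symmetric functions in `N` families of variables -/

/-- Symmetric functions in the `N` families of variables `x^{(i)}_k` with coefficients in a field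
of characteristic zero: the polynomial ring in the power sums `p^{(i)}_n`, `n ≥ 1`. -/
abbrev SymN (N : ℕ) (K : Type) [Field K] : Type := MvPolynomial (Fin N × ℕ+) K

section Variables

variable {N : ℕ} {K : Type} [Field K]

/-- The power sum `p^{(i)}_n = ∑_k (x^{(i)}_k)^n` as a formal series in the variables `x^{(i)}_k`. -/
def powerSum (i : Fin N) (n : ℕ+) : MvPowerSeries (Fin N × ℕ) K :=
  open Classical in
  fun d => if ∃ k : ℕ, d = Finsupp.single (i, k) (n : ℕ) then 1 else 0

/-- A symmetric function written out in the variables `x^{(i)}_k`. -/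
def toVariables : SymN N K →ₐ[K] MvPowerSeries (Fin N × ℕ) K :=
  MvPolynomial.aeval fun v => powerSum v.1 v.2

/-- The monomial symmetric function `m_λ` in the variables `x^{(i)}_1, x^{(i)}_2, …`: the sum of
all distinct monomials whose sequence of exponents is a rearrangement of `λ`. -/
def monomialSym (i : Fin N) (l : Ptn) : MvPowerSeries (Fin N × ℕ) K :=
  open Classical in
  fun d =>
    if (∃ σ : Equiv.Perm ℕ, ∀ k, d (i, σ k) = l.1 k) ∧ ∀ j, j ≠ i → ∀ k, d (j, k) = 0 then 1 else 0

/-- The product `m_{λ⃗} = ∏ᵢ m^{(i)}_{λ^{(i)}}`. -/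
def monomialSymTuple (lam : PtnTuple N) : MvPowerSeries (Fin N × ℕ) K :=
  ∏ i, monomialSym i (lam i)

/-- `f = m_λ + ∑_{μ <ᴸ λ} d_μ m_μ`. -/
def IsUnitriangular (lam : PtnTuple N) (f : SymN N K) (d : PtnTuple N →₀ K) : Prop :=
  (∀ mu ∈ d.support, ltL mu lam) ∧
    toVariables f = monomialSymTuple lam + d.sum fun mu c => c • monomialSymTuple mu

end Variables

/-! ### Formal exponentials -/

/-- The series `∑_{n ≥ 1} c_n z^n`. -/
def posSeries {R : Type} [Ring R] (c : ℕ+ → R) : PowerSeries R :=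
  PowerSeries.mk fun n => if h : 0 < n then c ⟨n, h⟩ else 0

/-- `exp f = ∑_k f^k / k!` for a series `f` without constant term; the coefficient of `z^n`
involves only `k ≤ n`. -/
def formalExp (K : Type) [Field K] {R : Type} [Ring R] [Algebra K R] (f : PowerSeries R) :
    PowerSeries R :=
  PowerSeries.mk fun n =>
    ∑ k ∈ Finset.range (n + 1), ((k.factorial : K)⁻¹) • PowerSeries.coeff n (f ^ k)

/-! ### The operator `X₀`

Below `a` and `b` stand for `q^{1/4}` and `t^{1/4}`, so that `(t/q)^{m/4} = (b/a)^m`. -/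

section Operators

variable {N : ℕ} {K : Type} [Field K]

/-- The variable `p^{(i)}_n`. -/
def p (i : Fin N) (n : ℕ+) : SymN N K := MvPolynomial.X (i, n)

/-- The derivation `∂/∂p^{(i)}_n`. -/
def dp (i : Fin N) (n : ℕ+) : Module.End K (SymN N K) :=
  (MvPolynomial.pderiv (i, n) : Derivation K (SymN N K) (SymN N K)).toLinearMap

/-- The left factor of `η^{(i)}(c z)`, a power series in `z`:
`exp (∑_{n ≥ 1} (1 - t^{-n})/n (c z)^n p^{(i)}_n)`. -/
def etaCreation (b c : K) (i : Fin N) : PowerSeries (SymN N K) :=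
  formalExp K (posSeries fun n : ℕ+ =>
    ((1 - ((b ^ 4) ^ (n : ℕ))⁻¹) / ((n : ℕ) : K) * c ^ (n : ℕ)) • p i n)

/-- The right factor of `η^{(i)}(c z)`, a power series in `z⁻¹`:
`exp (-∑_{n ≥ 1} (1 - q^n) (c z)^{-n} ∂/∂p^{(i)}_n)`. -/
def etaAnnihilation (a c : K) (i : Fin N) : PowerSeries (Module.End K (SymN N K)) :=
  formalExp K (posSeries fun n : ℕ+ =>
    (-((1 - (a ^ 4) ^ (n : ℕ)) * (c ^ (n : ℕ))⁻¹)) • dp i n)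

/-- `φ₋^{(i)}(c z) =
exp (∑_{n ≥ 1} (1 - t^{-n})/n (1 - t^n q^{-n}) (t/q)^{-n/4} (c z)^n p^{(i)}_n)`. -/
def phiMinus (a b c : K) (i : Fin N) : PowerSeries (SymN N K) :=
  formalExp K (posSeries fun n : ℕ+ =>
    ((1 - ((b ^ 4) ^ (n : ℕ))⁻¹) / ((n : ℕ) : K) * (1 - (b ^ 4 / a ^ 4) ^ (n : ℕ)) *
      ((b / a) ^ (n : ℕ))⁻¹ * c ^ (n : ℕ)) • p i n)

/-- The coefficient of `z^0` in `A(z) B(z⁻¹)`, applied to `f`, where `A(z)` acts by multiplication.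
For the series used below only finitely many terms of the sum are nonzero. -/
def constantTerm (A : PowerSeries (SymN N K)) (B : PowerSeries (Module.End K (SymN N K)))
    (f : SymN N K) : SymN N K :=
  ∑ᶠ n : ℕ, PowerSeries.coeff n A * (PowerSeries.coeff n B) f

/-- The zero mode of
`Λ̃_i(z) = φ₋^{(1)}((t/q)^{1/4} z) φ₋^{(2)}((t/q)^{3/4} z) ⋯ φ₋^{(i-1)}((t/q)^{(2i-3)/4} z)
  η^{(i)}((t/q)^{(i-1)/2} z)`.
As `Fin N` starts at `0`, the exponents of `(t/q)^{1/4}` read `2k + 1` and `2i`. -/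
def lambdaZero (a b : K) (i : Fin N) (f : SymN N K) : SymN N K :=
  constantTerm
    ((∏ k ∈ Finset.Iio i, phiMinus a b ((b / a) ^ (2 * (k : ℕ) + 1)) k) *
      etaCreation b ((b / a) ^ (2 * (i : ℕ))) i)
    (etaAnnihilation a ((b / a) ^ (2 * (i : ℕ))) i) f

/-- `X₀ = ∮ dz/(2πi z) ∑ᵢ uᵢ Λ̃_i(z)`. -/
def X0 (a b : K) (u : Fin N → K) (f : SymN N K) : SymN N K :=
  ∑ i, u i • lambdaZero a b i f

/-- `P` is the generalized Macdonald function of index `λ`, with `d` its coefficients on the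
`m_μ`, `μ <ᴸ λ`. -/
def IsGenMacdonald (a b : K) (u : Fin N → K) (lam : PtnTuple N) (P : SymN N K)
    (d : PtnTuple N →₀ K) : Prop :=
  IsUnitriangular lam P d ∧ ∃ e : K, X0 a b u P = e • P

/-! ### The operator `H_β`

The infinite sums have only finitely many nonzero terms on a given `f`. -/

/-- `H_β^{(i)}`. -/
def jackDiag (β : K) (u : Fin N → K) (i : Fin N) (f : SymN N K) : SymN N K :=
  (1 / 2 : K) • (∑ᶠ v : ℕ+ × ℕ+,
      ((β * (((v.1 : ℕ) : K) + ((v.2 : ℕ) : K))) • (p i v.1 * p i v.2 * dp i (v.1 + v.2) f) +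
        (((v.1 : ℕ) : K) * ((v.2 : ℕ) : K)) • (p i (v.1 + v.2) * dp i v.1 (dp i v.2 f)))) +
    ∑ᶠ n : ℕ+, ((u i + (1 - β) / 2 * ((n : ℕ) : K)) * ((n : ℕ) : K)) • (p i n * dp i n f)

/-- `H_β^{(i,k)}`. -/
def jackOffDiag (β : K) (i k : Fin N) (f : SymN N K) : SymN N K :=
  (1 - β) • ∑ᶠ n : ℕ+, (((n : ℕ) : K) ^ 2) • (p k n * dp i n f)

/-- `H_β = ∑ᵢ H_β^{(i)} + ∑_{i > j} H_β^{(i,j)}`. -/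
def jackHamiltonian (β : K) (u : Fin N → K) (f : SymN N K) : SymN N K :=
  (∑ i, jackDiag β u i f) + ∑ i, ∑ j ∈ Finset.Iio i, jackOffDiag β i j f

/-- `J` is the generalized Jack function of index `λ`, with `d` its coefficients on the
`m_μ`, `μ <ᴸ λ`. -/
def IsGenJack (β : K) (u : Fin N → K) (lam : PtnTuple N) (J : SymN N K)
    (d : PtnTuple N →₀ K) : Prop :=
  IsUnitriangular lam J d ∧ ∃ e : K, jackHamiltonian β u J = e • J

/-- `e'_λ = ∑ᵢ ∑_{k ≥ 1} λ^{(i)}_k (u'_i + (λ^{(i)}_k - (2k - 1) β) / 2)`. -/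
def jackEigenvalue (β : K) (u : Fin N → K) (lam : PtnTuple N) : K :=
  ∑ i, (lam i).1.sum fun k x => (x : K) * (u i + ((x : K) - (2 * (k : K) + 1) * β) / 2)

end Operators

/-! ### Rational functions and their values -/

/-- Rational functions over `ℚ` in the indeterminates indexed by `σ`. -/
abbrev RatFun (σ : Type) : Type := FractionRing (MvPolynomial σ ℚ)

/-- The indeterminate with index `s`. -/
def RatFun.var {σ : Type} (s : σ) : RatFun σ := algebraMap (MvPolynomial σ ℚ) _ (MvPolynomial.X s)

/-- The reduced denominator of `r` does not vanish at the complex point `v`. -/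
def RatFun.RegularAt {σ : Type} (r : RatFun σ) (v : σ → ℂ) : Prop :=
  MvPolynomial.aeval v (IsFractionRing.den (MvPolynomial σ ℚ) r : MvPolynomial σ ℚ) ≠ 0

/-- The value of `r` at a complex point at which it is regular. -/
def RatFun.value {σ : Type} (r : RatFun σ) (v : σ → ℂ) : ℂ :=
  MvPolynomial.aeval v (IsFractionRing.num (MvPolynomial σ ℚ) r) /
    MvPolynomial.aeval v (IsFractionRing.den (MvPolynomial σ ℚ) r : MvPolynomial σ ℚ)

/-- The indeterminates `q^{1/4}`, `t^{1/4}`, `u_1, …, u_N`. -/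
inductive MacVar (N : ℕ) : Type
  | qRoot : MacVar N
  | tRoot : MacVar N
  | u (i : Fin N) : MacVar N

/-- The indeterminates `β`, `u'_1, …, u'_N`. -/
inductive JackVar (N : ℕ) : Type
  | beta : JackVar N
  | u (i : Fin N) : JackVar N

/-- The point `q^{1/4} = e^{ħ/4}`, `t^{1/4} = e^{βħ/4}`, `u_i = e^{u'_i ħ}`, that is
`q = e^ħ`, `t = q^β`, `u_i = q^{u'_i}`. -/
def macPoint {N : ℕ} (β : ℂ) (u' : Fin N → ℂ) (h : ℂ) : MacVar N → ℂ
  | .qRoot => Complex.exp (h / 4)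
  | .tRoot => Complex.exp (β * h / 4)
  | .u i => Complex.exp (u' i * h)

/-- The point `(β, u'_1, …, u'_N)`. -/
def jackPoint {N : ℕ} (β : ℂ) (u' : Fin N → ℂ) : JackVar N → ℂ
  | .beta => β
  | .u i => u' i

/-- `P` is the generalized Macdonald function of index `λ` over `ℚ(q^{1/4}, t^{1/4}, u_1, …, u_N)`,
with coefficients `d`. -/
def GenericMacdonald {N : ℕ} (lam : PtnTuple N) (P : SymN N (RatFun (MacVar N)))
    (d : PtnTuple N →₀ RatFun (MacVar N)) : Prop :=
  IsGenMacdonald (RatFun.var MacVar.qRoot) (RatFun.var MacVar.tRoot)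
    (fun i => RatFun.var (MacVar.u i)) lam P d

/-- `J` is the generalized Jack function of index `λ` over `ℚ(β, u'_1, …, u'_N)`,
with coefficients `d`. -/
def GenericJack {N : ℕ} (lam : PtnTuple N) (J : SymN N (RatFun (JackVar N)))
    (d : PtnTuple N →₀ RatFun (JackVar N)) : Prop :=
  IsGenJack (RatFun.var JackVar.beta) (fun i => RatFun.var (JackVar.u i)) lam J d

end GenMacdonald

end

/-! The operator `X0` is triangular for `≤ᴸ` in the basis of the `m_λ`, and `H_β` appears in its
expansion along q = e^ħ, t = e^{βħ}, u_i = e^{u'_i ħ}: X₀ = ∑ u_i + ħ²β·(degree) + ħ³β·H_β + O(ħ⁴)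
(`exists_ringX0_expansion`). On functions of a fixed degree the terms other than the last two are
scalars. After subtracting them and dividing by ħ³, the eigenvector problem for X₀ becomes the one
for βH_β up to O(ħ).

Triangularity. Each inequality in the definition of `≤ᴸ` bounds a weight: weight 1 on the families
above j and on the first r variables of the family j, and 0 elsewhere. So it suffices that X₀
preserves the filtrations `fil` by these weights. The zero mode of Λ̃_i is a sum of products of a
creation part in the lower families with a mode of the one-family operator `vertex`. Splitting off
one variable y turns p_n into p_n + yⁿ and multiplies the creation series of `vertex` by (1 -
τyz)/(1 - yz), where τ = 1/t. This yields the commutation relation `lower_vertex_eq`, from which an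
induction on r gives both the triangularity (`vertex_mem_fil`) and the diagonal entries
(`cf_vertex_zero`).

Inheritance. Vanishing entries and diagonal entries of H_β are limits of those of X₀ at complex
points with β ≠ 0. Since the entries of H_β are polynomials in β and u' over ℚ, the resulting
identities hold over every ℚ-algebra (`leL_of_entry_ham_ne_zero`, `entry_ham_self`). The values e'_λ
are distinct on comparable tuples (`eq_of_jackEigenvalue_eq`), hence so are the eigenvalues of X₀,
and triangular linear algebra gives existence and uniqueness.

Limit. The coefficients of an eigenvector satisfy d_μ = (A_λλ - A_μμ)⁻¹ ∑_{ν>μ} A_μν d_ν. For X₀,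
both A_λλ - A_μμ and A_μν with μ ≠ ν are ħ³β times the corresponding quantity for H_β, up to O(ħ⁴).
A descending induction on μ gives regularity and convergence together (`exists_tendsto_coeff`).

All operators are defined over arbitrary commutative ℚ-algebras, because the argument moves the same
matrix between polynomial rings, rational functions, ℂ and a ring of functions of ħ. -/

noncomputable section

namespace GenMacdonald

section

open PowerSeries

/-! ### Formal exponentials and their differential equation. -/

section FormalExp

/-- Division by k! gives the same result over any field of scalars of characteristic zero. With
scalars in ℚ the exponential commutes with every ring homomorphism of ℚ-algebras, as base change
requires. -/
theorem formalExp_eq_rat {K : Type} [Field K] [CharZero K] {S : Type} [Ring S] [Algebra K S]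
    [Algebra ℚ S] (f : PowerSeries S) : formalExp K f = formalExp ℚ f := by
  ext n
  simp only [formalExp, coeff_mk]
  refine Finset.sum_congr rfl fun k _ => ?_
  have hk : (k.factorial : K) ≠ 0 := by exact_mod_cast k.factorial_ne_zero
  have hq : (k.factorial : ℚ) ≠ 0 := by exact_mod_cast k.factorial_ne_zero
  set x := coeff n (f ^ k)
  have h1 : x = k.factorial • ((k.factorial : ℚ)⁻¹ • x) := by
    rw [← Nat.cast_smul_eq_nsmul ℚ, smul_smul, mul_inv_cancel₀ hq, one_smul]
  conv_lhs => rw [h1, ← Nat.cast_smul_eq_nsmul K, smul_smul, inv_mul_cancel₀ hk, one_smul]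

theorem formalExp_map {S S' : Type} [Ring S] [Ring S'] [Algebra ℚ S] [Algebra ℚ S']
    (φ : S →+* S') (f : PowerSeries S) :
    PowerSeries.map φ (formalExp ℚ f) = formalExp ℚ (PowerSeries.map φ f) := by
  ext n
  simp only [formalExp, coeff_mk, coeff_map, map_sum, ← map_pow]
  exact Finset.sum_congr rfl fun k _ => map_rat_smul φ _ _

theorem posSeries_map {S S' : Type} [Ring S] [Ring S'] (φ : S →+* S') (c : ℕ+ → S) :
    PowerSeries.map φ (posSeries c) = posSeries fun n => φ (c n) := by
  ext n
  simp only [posSeries, coeff_map, coeff_mk]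
  split_ifs <;> simp

theorem coeff_posSeries {S : Type} [Ring S] (c : ℕ+ → S) (n : ℕ+) :
    coeff (n : ℕ) (posSeries c) = c n := by
  rw [posSeries, coeff_mk, dif_pos n.pos]
  rfl

theorem constantCoeff_posSeries {S : Type} [Ring S] (c : ℕ+ → S) :
    constantCoeff (posSeries c) = 0 := by
  rw [← coeff_zero_eq_constantCoeff_apply]; simp [posSeries]

theorem posSeries_add {S : Type} [Ring S] (c c' : ℕ+ → S) :
    posSeries c + posSeries c' = posSeries (c + c') := by
  ext n
  simp only [posSeries, map_add, coeff_mk]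
  split_ifs
  · rfl
  · exact add_zero 0

theorem posSeries_sum {S ι : Type} [Ring S] (s : Finset ι) (c : ι → ℕ+ → S) :
    ∑ i ∈ s, posSeries (c i) = posSeries (∑ i ∈ s, c i) := by
  classical
  induction s using Finset.induction_on with
  | empty =>
    ext n
    simp only [posSeries, Finset.sum_empty, coeff_mk, map_zero]
    split_ifs <;> rfl
  | insert a s ha ih => rw [Finset.sum_insert ha, Finset.sum_insert ha, ih, posSeries_add]

variable {S : Type} [CommRing S]

theorem coeff_pow_eq_zero_of_lt {f : PowerSeries S} (hf : constantCoeff f = 0) {n k : ℕ}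
    (h : n < k) : coeff n (f ^ k) = 0 := by
  have : X ^ k ∣ f ^ k := pow_dvd_pow_of_dvd (X_dvd_iff.2 hf) k
  exact (X_pow_dvd_iff.1 this) n h

variable [Algebra ℚ S]

theorem coeff_formalExp {f : PowerSeries S} (hf : constantCoeff f = 0) {n M : ℕ} (h : n < M) :
    coeff n (formalExp ℚ f) =
      ∑ k ∈ Finset.range M, ((k.factorial : ℚ)⁻¹) • coeff n (f ^ k) := by
  simp only [formalExp, coeff_mk]
  refine Finset.sum_subset (by simpa using h) fun k _ hk => ?_
  rw [coeff_pow_eq_zero_of_lt hf (by simpa using hk), smul_zero]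

theorem constantCoeff_formalExp (f : PowerSeries S) : constantCoeff (formalExp ℚ f) = 1 := by
  rw [← coeff_zero_eq_constantCoeff_apply]; simp [formalExp]

theorem derivative_formalExp {f : PowerSeries S} (hf : constantCoeff f = 0) :
    derivative S (formalExp ℚ f) = derivative S f * formalExp ℚ f := by
  ext n
  rw [coeff_derivative, coeff_formalExp hf (Nat.lt_succ_self (n + 1)), Finset.sum_range_succ',
    coeff_mul]
  have h0 : coeff (n + 1) (f ^ 0) = 0 := by simp [coeff_one]
  rw [h0, smul_zero, add_zero, Finset.sum_mul]
  have : ∀ x ∈ Finset.HasAntidiagonal.antidiagonal n, coeff x.1 (derivative S f) * coeff x.2 (formalExp ℚ f) =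
      ∑ k ∈ Finset.range (n + 1), ((k.factorial : ℚ)⁻¹) •
        (coeff x.1 (derivative S f) * coeff x.2 (f ^ k)) := by
    intro x hx
    have := Finset.HasAntidiagonal.mem_antidiagonal.1 hx
    rw [coeff_formalExp hf (show x.2 < n + 1 by omega), Finset.mul_sum]
    exact Finset.sum_congr rfl fun k _ => mul_smul_comm _ _ _
  rw [Finset.sum_congr rfl this, Finset.sum_comm]
  refine Finset.sum_congr rfl fun k _ => ?_
  rw [← Finset.smul_sum, ← coeff_mul, smul_mul_assoc]
  have h2 := coeff_derivative (f ^ (k + 1)) n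
  rw [← h2, derivative_pow]
  have : ((k + 1 : ℕ) : PowerSeries S) * f ^ (k + 1 - 1) * derivative S f =
      ((k + 1 : ℕ) : ℚ) • (derivative S f * f ^ k) := by
    rw [Nat.cast_smul_eq_nsmul, nsmul_eq_mul]; simp; ring
  rw [this, coeff_smul, smul_smul, Nat.factorial_succ]
  congr 1
  have hq : ((k + 1 : ℕ) : ℚ) ≠ 0 := by positivity
  push_cast at *
  field_simp

/-- A' = LA determines the coefficients of A recursively, since every n + 1 is invertible. The
identities between exponentials below are reduced to this uniqueness. -/
theorem eq_of_derivative_eq_mul {L A B : PowerSeries S} (hA : derivative S A = L * A)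
    (hB : derivative S B = L * B) (h0 : constantCoeff A = constantCoeff B) : A = B := by
  ext n
  induction n using Nat.strong_induction_on with
  | _ n ih =>
    rcases n with _ | n
    · simpa using h0
    have h1 := congrArg (coeff n) hA
    have h2 := congrArg (coeff n) hB
    rw [coeff_derivative, coeff_mul] at h1 h2
    have : coeff (n + 1) A * ((n : S) + 1) = coeff (n + 1) B * ((n : S) + 1) := by
      rw [h1, h2]
      refine Finset.sum_congr rfl fun x hx => ?_
      have := Finset.HasAntidiagonal.mem_antidiagonal.1 hx
      rw [ih x.2 (by omega)]
    have hu : IsUnit ((n : S) + 1) := by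
      have : ((n : S) + 1) = algebraMap ℚ S ((n : ℚ) + 1) := by simp
      rw [this]
      exact (IsUnit.mk0 _ (by positivity)).map _
    exact hu.mul_right_cancel this

theorem formalExp_add {f g : PowerSeries S} (hf : constantCoeff f = 0) (hg : constantCoeff g = 0) :
    formalExp ℚ (f + g) = formalExp ℚ f * formalExp ℚ g := by
  refine eq_of_derivative_eq_mul (L := derivative S (f + g)) (derivative_formalExp (by simp [hf, hg])) ?_ ?_
  · rw [Derivation.leibniz, derivative_formalExp hf, derivative_formalExp hg, map_add]
    simp only [smul_eq_mul]; ring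
  · simp [constantCoeff_formalExp]

theorem formalExp_zero : formalExp ℚ (0 : PowerSeries S) = 1 := by
  refine eq_of_derivative_eq_mul (L := derivative S 0) (derivative_formalExp (by simp)) ?_ ?_
  · simp
  · simp [constantCoeff_formalExp]

theorem formalExp_sum {ι : Type} (s : Finset ι) (f : ι → PowerSeries S)
    (hf : ∀ i ∈ s, constantCoeff (f i) = 0) :
    formalExp ℚ (∑ i ∈ s, f i) = ∏ i ∈ s, formalExp ℚ (f i) := by
  classical
  induction s using Finset.induction_on with
  | empty => simp [formalExp_zero]
  | insert a s ha ih =>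
    rw [Finset.sum_insert ha, Finset.prod_insert ha, formalExp_add, ih]
    · exact fun i hi => hf i (Finset.mem_insert_of_mem hi)
    · exact hf a (Finset.mem_insert_self _ _)
    · rw [map_sum]
      exact Finset.sum_eq_zero fun i hi => hf i (Finset.mem_insert_of_mem hi)

/-- The recursion for the coefficients of an exponential. -/
theorem coeff_succ_formalExp (c : ℕ+ → S) (n : ℕ) :
    ((n : S) + 1) * coeff (n + 1) (formalExp ℚ (posSeries c)) =
      ∑ k ∈ Finset.range (n + 1), ((k : S) + 1) * c k.succPNat *
        coeff (n - k) (formalExp ℚ (posSeries c)) := by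
  have h := congrArg (coeff n) (derivative_formalExp (constantCoeff_posSeries c))
  rw [coeff_derivative, coeff_mul, Finset.Nat.sum_antidiagonal_eq_sum_range_succ_mk] at h
  rw [mul_comm, h]
  refine Finset.sum_congr rfl fun k _ => ?_
  rw [coeff_derivative, mul_comm _ ((k : S) + 1)]
  congr 2
  exact coeff_posSeries c k.succPNat

end FormalExp

end

/-! ### Shifts of the power sums and their Taylor coefficients. -/

section Shift

variable {N : ℕ} {R : Type} [CommRing R]

/-- The substitution `p^{(i)}_n ↦ p^{(i)}_n + γ_n y^n`. -/
def shift (i : Fin N) (γ : ℕ+ → R) :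
    MvPolynomial (Fin N × ℕ+) R →ₐ[R] Polynomial (MvPolynomial (Fin N × ℕ+) R) :=
  MvPolynomial.aeval fun v => Polynomial.C (MvPolynomial.X v) +
    if v.1 = i then Polynomial.C (MvPolynomial.C (γ v.2)) * Polynomial.X ^ (v.2 : ℕ) else 0

/-- The coefficient of `y^n` in `shift`. -/
def lower (i : Fin N) (γ : ℕ+ → R) (n : ℕ) :
    MvPolynomial (Fin N × ℕ+) R →ₗ[R] MvPolynomial (Fin N × ℕ+) R :=
  ((Polynomial.lcoeff (MvPolynomial (Fin N × ℕ+) R) n).restrictScalars R).comp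
    (shift i γ).toLinearMap

theorem lower_apply (i : Fin N) (γ : ℕ+ → R) (n : ℕ) (f : MvPolynomial (Fin N × ℕ+) R) :
    lower i γ n f = (shift i γ f).coeff n := rfl

theorem lower_C (i : Fin N) (γ : ℕ+ → R) (n : ℕ) (c : R) :
    lower i γ n (MvPolynomial.C c) = if n = 0 then MvPolynomial.C c else 0 := by
  rw [lower_apply, ← MvPolynomial.algebraMap_eq, AlgHom.commutes,
    IsScalarTower.algebraMap_apply R (MvPolynomial (Fin N × ℕ+) R), Polynomial.algebraMap_eq,
    Polynomial.coeff_C]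

theorem lower_mul (i : Fin N) (γ : ℕ+ → R) (n : ℕ) (f g : MvPolynomial (Fin N × ℕ+) R) :
    lower i γ n (f * g) = ∑ x ∈ Finset.HasAntidiagonal.antidiagonal n,
      lower i γ x.1 f * lower i γ x.2 g := by
  simp only [lower_apply, map_mul, Polynomial.coeff_mul]

theorem lower_mul_X (i : Fin N) (γ : ℕ+ → R) (n : ℕ) (f : MvPolynomial (Fin N × ℕ+) R)
    (v : Fin N × ℕ+) :
    lower i γ n (f * MvPolynomial.X v) = lower i γ n f * MvPolynomial.X v +
      if v.1 = i ∧ (v.2 : ℕ) ≤ n then MvPolynomial.C (γ v.2) * lower i γ (n - v.2) f else 0 := by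
  simp only [lower_apply, map_mul]
  have : shift i γ (MvPolynomial.X v) = Polynomial.C (MvPolynomial.X v) +
      if v.1 = i then Polynomial.C (MvPolynomial.C (γ v.2)) * Polynomial.X ^ (v.2 : ℕ) else 0 := by
    simp [shift]
  rw [this, mul_add, Polynomial.coeff_add, Polynomial.coeff_mul_C]
  congr 1
  by_cases h : v.1 = i
  · simp only [h, if_true, true_and]
    rw [mul_left_comm, Polynomial.coeff_C_mul, Polynomial.coeff_mul_X_pow']
    split_ifs <;> simp
  · simp [h]

theorem lower_zero (i : Fin N) (γ : ℕ+ → R) (f : MvPolynomial (Fin N × ℕ+) R) :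
    lower i γ 0 f = f := by
  induction f using MvPolynomial.induction_on with
  | C c => simp [lower_C]
  | add f g hf hg => rw [map_add, hf, hg]
  | mul_X f v hf =>
    rw [lower_mul_X, hf, if_neg, add_zero]
    have := v.2.pos
    omega

theorem lower_X (i : Fin N) (γ : ℕ+ → R) (n : ℕ) (v : Fin N × ℕ+) :
    lower i γ n (MvPolynomial.X v) = (if n = 0 then MvPolynomial.X v else 0) +
      if v.1 = i ∧ (v.2 : ℕ) = n then MvPolynomial.C (γ v.2) else 0 := by
  have h := lower_mul_X i γ n 1 v
  rw [one_mul] at h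
  rw [h, ← MvPolynomial.C_1, lower_C, lower_C]
  by_cases hv : v.1 = i
  · by_cases hn : (v.2 : ℕ) = n
    · simp [hv, hn]
    · by_cases hn' : (v.2 : ℕ) ≤ n
      · have : n - v.2 ≠ 0 := by omega
        simp [hv, hn, this]
      · simp [hv, hn, hn']
  · simp [hv]

theorem pderiv_lower (i : Fin N) (γ : ℕ+ → R) (n : ℕ) (w : Fin N × ℕ+)
    (f : MvPolynomial (Fin N × ℕ+) R) :
    MvPolynomial.pderiv w (lower i γ n f) = lower i γ n (MvPolynomial.pderiv w f) := by
  induction f using MvPolynomial.induction_on generalizing n with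
  | C c =>
    rw [lower_C]
    split_ifs <;> simp
  | add f g hf hg => simp only [map_add, hf, hg]
  | mul_X f v hf =>
    rw [lower_mul_X, map_add, Derivation.leibniz, Derivation.leibniz, map_add, hf]
    simp only [smul_eq_mul]
    rw [mul_comm (MvPolynomial.X v) (lower i γ n _),
      mul_comm (MvPolynomial.X v) (MvPolynomial.pderiv w f), lower_mul_X]
    have h1 : lower i γ n (f * MvPolynomial.pderiv w (MvPolynomial.X v)) =
        lower i γ n f * MvPolynomial.pderiv w (MvPolynomial.X v) := by
      rw [MvPolynomial.pderiv_X]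
      by_cases h : v = w
      · subst h; simp
      · simp [h]
    rw [h1]
    have h2 : MvPolynomial.pderiv w (if v.1 = i ∧ (v.2 : ℕ) ≤ n then
        MvPolynomial.C (γ v.2) * lower i γ (n - v.2) f else 0) =
        if v.1 = i ∧ (v.2 : ℕ) ≤ n then
          MvPolynomial.C (γ v.2) * lower i γ (n - v.2) (MvPolynomial.pderiv w f) else 0 := by
      split_ifs
      · rw [MvPolynomial.pderiv_C_mul, hf, MvPolynomial.C_mul']
      · simp
    rw [h2]
    ring

/-- This is the chain rule for d/dy applied to f(p_n + γ_n yⁿ), read off at one power of y. It is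
the recursion satisfied by the coefficients of exp(∑ γ_n yⁿ ∂/∂p_n). -/
theorem succ_smul_lower (i : Fin N) (γ : ℕ+ → R) (n : ℕ) (f : MvPolynomial (Fin N × ℕ+) R) :
    ((n : R) + 1) • lower i γ (n + 1) f = ∑ k ∈ Finset.range (n + 1),
      (((k : R) + 1) * γ k.succPNat) •
        lower i γ (n - k) (MvPolynomial.pderiv (i, k.succPNat) f) := by
  induction f using MvPolynomial.induction_on generalizing n with
  | C c => simp [lower_C]
  | add f g hf hg => simp only [map_add, smul_add, hf, hg, Finset.sum_add_distrib]
  | mul_X f v hf =>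
    have key : ∀ k, lower i γ (n - k) (MvPolynomial.pderiv (i, k.succPNat) (f * MvPolynomial.X v)) =
        lower i γ (n - k) (MvPolynomial.pderiv (i, k.succPNat) f) * MvPolynomial.X v +
        (if v.1 = i ∧ (v.2 : ℕ) ≤ n - k then MvPolynomial.C (γ v.2) *
          lower i γ (n - k - v.2) (MvPolynomial.pderiv (i, k.succPNat) f) else 0) +
        (if v = (i, k.succPNat) then lower i γ (n - k) f else 0) := by
      intro k
      rw [Derivation.leibniz, map_add, smul_eq_mul, smul_eq_mul, mul_comm (MvPolynomial.X v),
        lower_mul_X, MvPolynomial.pderiv_X, add_comm]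
      congr 1
      by_cases h : v = (i, k.succPNat)
      · subst h; simp
      · simp [h]
    rw [lower_mul_X, smul_add, ← smul_mul_assoc, hf]
    simp only [key, smul_add, Finset.sum_add_distrib]
    rw [Finset.sum_mul, add_assoc]
    simp only [smul_mul_assoc]
    congr 1
    obtain ⟨j, m⟩ := v
    by_cases hj : j = i
    swap
    · simp [hj]
    subst hj
    simp only [true_and, Prod.mk.injEq]
    have e2 : ∑ k ∈ Finset.range (n + 1), (((k : R) + 1) * γ k.succPNat) •
        (if m = k.succPNat then lower j γ (n - k) f else 0) =
        if (m : ℕ) ≤ n + 1 then ((m : ℕ) : R) • (MvPolynomial.C (γ m) * lower j γ (n + 1 - m) f)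
        else 0 := by
      obtain ⟨m', rfl⟩ : ∃ m' : ℕ, m = m'.succPNat := ⟨m.natPred, by simp⟩
      have hm : ((m'.succPNat : ℕ+) : ℕ) = m' + 1 := rfl
      simp only [Nat.succPNat_inj, smul_ite, smul_zero, Finset.sum_ite_eq, Finset.mem_range]
      by_cases h : m' < n + 1
      · rw [if_pos h, if_pos (by omega), MvPolynomial.C_mul', smul_smul, hm]
        congr 2
        · push_cast; ring
        · congr 1; omega
      · rw [if_neg h, if_neg (by omega)]
    have e1 : ∑ k ∈ Finset.range (n + 1), (((k : R) + 1) * γ k.succPNat) •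
        (if (m : ℕ) ≤ n - k then MvPolynomial.C (γ m) *
          lower j γ (n - k - m) (MvPolynomial.pderiv (j, k.succPNat) f) else 0) =
        if (m : ℕ) ≤ n then ((n - m : ℕ) + 1 : R) •
          (MvPolynomial.C (γ m) * lower j γ (n + 1 - m) f) else 0 := by
      by_cases h : (m : ℕ) ≤ n
      · rw [if_pos h]
        have h3 := hf (n - m)
        rw [show n + 1 - (m : ℕ) = n - m + 1 by omega, MvPolynomial.C_mul', smul_comm, h3,
          Finset.smul_sum]
        symm
        refine Finset.sum_subset_zero_on_sdiff
          (Finset.range_mono (show n - m + 1 ≤ n + 1 by omega)) ?_ ?_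
        · intro k hk
          simp only [Finset.mem_sdiff, Finset.mem_range] at hk
          rw [if_neg (by omega), smul_zero]
        · intro k hk
          simp only [Finset.mem_range] at hk
          rw [if_pos (by omega), MvPolynomial.C_mul', smul_comm]
          congr 4
          omega
      · rw [if_neg h]
        refine Finset.sum_eq_zero fun k _ => ?_
        rw [if_neg (by omega), smul_zero]
    -- The two contributions carry the factors n + 1 - m and m, which add up to n + 1.
    rw [e1, e2]
    by_cases h : (m : ℕ) ≤ n
    · rw [if_pos (by omega), if_pos h, if_pos (by omega), ← add_smul]
      congr 1
      rw [Nat.cast_sub h]; ring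
    · by_cases h' : (m : ℕ) ≤ n + 1
      · have : (m : ℕ) = n + 1 := by omega
        rw [if_pos h', if_neg h, if_pos h', this]
        simp
      · simp [h, h']

/-- Shifting by γ' and then shifting the coefficients by γ, with the same y, adds the shifts. -/
theorem lower_add (i : Fin N) (γ γ' : ℕ+ → R) (n : ℕ) (f : MvPolynomial (Fin N × ℕ+) R) :
    lower i (γ + γ') n f = ∑ x ∈ Finset.HasAntidiagonal.antidiagonal n,
      lower i γ x.1 (lower i γ' x.2 f) := by
  have key : (shift i (γ + γ') : MvPolynomial (Fin N × ℕ+) R →+* _) =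
      (Polynomial.eval₂RingHom (shift i γ : MvPolynomial (Fin N × ℕ+) R →+*
        Polynomial (MvPolynomial (Fin N × ℕ+) R))
        Polynomial.X).comp (shift i γ' : MvPolynomial (Fin N × ℕ+) R →+*
          Polynomial (MvPolynomial (Fin N × ℕ+) R)) := by
    apply MvPolynomial.ringHom_ext
    · intro r
      have h : ∀ γ : ℕ+ → R, shift i γ (MvPolynomial.C r) = Polynomial.C (MvPolynomial.C r) :=
        fun γ => (shift i γ).commutes r
      simp [h]
    -- On a variable of the family i both sides are p_n + (γ_n + γ'_n)yⁿ.
    · intro v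
      by_cases h : v.1 = i
      · simp [shift, h, Polynomial.eval₂_add, Polynomial.eval₂_mul, Polynomial.eval₂_C,
          Polynomial.eval₂_X_pow]
        ring
      · simp [shift, h]
  have h2 : shift i (γ + γ') f = (shift i γ' f).eval₂
      (shift i γ : MvPolynomial (Fin N × ℕ+) R →+*
        Polynomial (MvPolynomial (Fin N × ℕ+) R)) Polynomial.X :=
    RingHom.congr_fun key f
  rw [lower_apply, h2, Polynomial.eval₂_def, Polynomial.sum_def, Polynomial.finsetSum_coeff]
  simp only [Polynomial.coeff_mul_X_pow']
  rw [Finset.Nat.sum_antidiagonal_eq_sum_range_succ_mk, ← Finset.sum_range_reflect]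
  have h3 : ∀ k ∈ Finset.range (n + 1), lower i γ (n + 1 - 1 - k)
      (lower i γ' (n - (n + 1 - 1 - k)) f) =
      if k ≤ n then (shift i γ ((shift i γ' f).coeff k)).coeff (n - k) else 0 := by
    intro k hk
    simp only [Finset.mem_range] at hk
    rw [if_pos (by omega)]
    simp only [lower_apply]
    congr 3; omega
  rw [Finset.sum_congr rfl h3]
  simp only [RingHom.coe_coe]
  set F : ℕ → MvPolynomial (Fin N × ℕ+) R := fun k =>
    if k ≤ n then (shift i γ ((shift i γ' f).coeff k)).coeff (n - k) else 0
  have hF0 : ∀ k, k ∉ (shift i γ' f).support → F k = 0 := by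
    intro k hk
    simp [F, Polynomial.notMem_support_iff.1 hk]
  have hF1 : ∀ k, k ∉ Finset.range (n + 1) → F k = 0 := by
    intro k hk
    simp only [Finset.mem_range] at hk
    simp only [F]; rw [if_neg (by omega)]
  calc ∑ k ∈ (shift i γ' f).support, F k
      = ∑ k ∈ (shift i γ' f).support ∪ Finset.range (n + 1), F k :=
        Finset.sum_subset Finset.subset_union_left fun k _ hk => hF0 k hk
    _ = ∑ k ∈ Finset.range (n + 1), F k :=
        (Finset.sum_subset Finset.subset_union_right fun k _ hk => hF1 k hk).symm

theorem lower_scale (i : Fin N) (γ : ℕ+ → R) (c : R) (n : ℕ) (f : MvPolynomial (Fin N × ℕ+) R) :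
    lower i (fun m => c ^ (m : ℕ) * γ m) n f = c ^ n • lower i γ n f := by
  induction f using MvPolynomial.induction_on generalizing n with
  | C c => simp only [lower_C]; split_ifs with h <;> simp [h]
  | add f g hf hg => simp only [map_add, smul_add, hf, hg]
  | mul_X f v hf =>
    rw [lower_mul_X, lower_mul_X, hf, smul_add, smul_mul_assoc]
    congr 1
    split_ifs with h
    · rw [hf, MvPolynomial.C_mul', MvPolynomial.C_mul', smul_smul, smul_smul]
      congr 1
      rw [mul_right_comm, ← pow_add, Nat.add_sub_cancel' h.2]
    · simp

theorem lower_eq_zero_of_natDegree_lt (i : Fin N) (γ : ℕ+ → R) (f : MvPolynomial (Fin N × ℕ+) R)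
    {n : ℕ} (h : (shift i γ f).natDegree < n) : lower i γ n f = 0 :=
  Polynomial.coeff_eq_zero_of_natDegree_lt h

theorem lower_map {R' : Type} [CommRing R'] (φ : R →+* R') (i : Fin N) (γ : ℕ+ → R) (n : ℕ)
    (f : MvPolynomial (Fin N × ℕ+) R) :
    MvPolynomial.map φ (lower i γ n f) =
      lower i (fun m => φ (γ m)) n (MvPolynomial.map φ f) := by
  induction f using MvPolynomial.induction_on generalizing n with
  | C c => simp only [lower_C, MvPolynomial.map_C]; split_ifs with h <;> simp
  | add f g hf hg => simp only [map_add, hf, hg]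
  | mul_X f v hf =>
    rw [lower_mul_X, map_add, map_mul, map_mul, MvPolynomial.map_X, lower_mul_X, hf]
    congr 1
    split_ifs with h
    · simp [hf]
    · simp

variable [Algebra ℚ R]

theorem succ_smul_cancel {M : Type} [AddCommGroup M] [Module R M] {n : ℕ} {x y : M}
    (h : ((n : R) + 1) • x = ((n : R) + 1) • y) : x = y := by
  have hu : IsUnit ((n : R) + 1) := by
    have : ((n : R) + 1) = algebraMap ℚ R ((n : ℚ) + 1) := by simp
    rw [this]
    exact (IsUnit.mk0 _ (by positivity)).map _
  exact hu.smul_left_cancel.1 h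

/-- Both operators are polynomials with constant coefficients in the commuting derivations ∂/∂p_n.
-/
theorem lower_comm (i j : Fin N) (γ γ' : ℕ+ → R) (a b : ℕ) (f : MvPolynomial (Fin N × ℕ+) R) :
    lower i γ a (lower j γ' b f) = lower j γ' b (lower i γ a f) := by
  induction b using Nat.strong_induction_on generalizing f with
  | _ b ih =>
    rcases b with _ | b
    · simp [lower_zero]
    apply succ_smul_cancel (R := R) (n := b)
    rw [← map_smul, succ_smul_lower, succ_smul_lower, map_sum]
    refine Finset.sum_congr rfl fun k _ => ?_
    rw [map_smul, ih (b - k) (by omega), pderiv_lower]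

end Shift

/-! ### The annihilation exponential acts as a shift. -/

section Annihilation

variable {N : ℕ} {K : Type} [Field K]

theorem dp_apply (i : Fin N) (n : ℕ+) (f : SymN N K) :
    dp i n f = MvPolynomial.pderiv (i, n) f := rfl

theorem pderiv_comm {R σ : Type} [CommRing R] (v w : σ) (f : MvPolynomial σ R) :
    MvPolynomial.pderiv v (MvPolynomial.pderiv w f) =
      MvPolynomial.pderiv w (MvPolynomial.pderiv v f) := by
  classical
  have : ⁅(MvPolynomial.pderiv v : Derivation R (MvPolynomial σ R) (MvPolynomial σ R)),
      (MvPolynomial.pderiv w : Derivation R (MvPolynomial σ R) (MvPolynomial σ R))⁆ = 0 := by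
    apply MvPolynomial.derivation_ext
    intro u
    rw [Derivation.commutator_apply, MvPolynomial.pderiv_X, MvPolynomial.pderiv_X]
    simp only [Pi.single_apply]
    split_ifs <;> simp
  have h := congrArg (fun D : Derivation R (MvPolynomial σ R) (MvPolynomial σ R) => D f) this
  simp only [Derivation.commutator_apply, Derivation.coe_zero, Pi.zero_apply] at h
  exact sub_eq_zero.1 h

/-- The exponential of `∑ γ_n z^n ∂/∂p_n` acts as a shift of the variables. -/
theorem coeff_formalExp_dp [CharZero K] (i : Fin N) (γ : ℕ+ → K) (n : ℕ) (f : SymN N K) :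
    PowerSeries.coeff n (formalExp K (posSeries fun n : ℕ+ => γ n • dp i n)) f =
      lower i γ n f := by
  let s : Set (Module.End K (SymN N K)) := Set.range (dp i)
  -- The recursion for exponentials was proved over commutative rings. The derivations commute, so
  -- it is applied in the subalgebra they generate.
  have hcomm : ∀ a ∈ s, ∀ b ∈ s, a * b = b * a := by
    rintro _ ⟨k, rfl⟩ _ ⟨l, rfl⟩
    ext1 f
    exact LinearMap.ext fun g => pderiv_comm _ _ _
  have hA := Algebra.isMulCommutative_adjoin K hcomm
  let A : Subalgebra K (Module.End K (SymN N K)) := Algebra.adjoin K s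
  let instA : CommRing A := { (inferInstance : Ring A) with mul_comm := hA.is_comm.comm }
  let c : ℕ+ → A := fun n => γ n • ⟨dp i n, Algebra.subset_adjoin ⟨n, rfl⟩⟩
  have hmap : formalExp K (posSeries fun n : ℕ+ => γ n • dp i n) =
      PowerSeries.map (A.val : A →+* Module.End K (SymN N K)) (formalExp ℚ (posSeries c)) := by
    rw [formalExp_map, posSeries_map, formalExp_eq_rat]
    rfl
  have hrec : ∀ (n : ℕ) (f : SymN N K), ((n : K) + 1) •
      PowerSeries.coeff (n + 1) (formalExp K (posSeries fun n : ℕ+ => γ n • dp i n)) f =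
      ∑ k ∈ Finset.range (n + 1), (((k : K) + 1) * γ k.succPNat) • dp i k.succPNat
        (PowerSeries.coeff (n - k) (formalExp K (posSeries fun n : ℕ+ => γ n • dp i n)) f) := by
    intro n f
    have h := congrArg A.val (coeff_succ_formalExp c n)
    have h' := LinearMap.congr_fun h f
    simp only [map_mul, map_sum, map_add, map_natCast, map_one] at h'
    rw [hmap]
    simp only [PowerSeries.coeff_map]
    rw [LinearMap.sum_apply] at h'
    convert h' using 1
    · simp [add_smul, Nat.cast_smul_eq_nsmul, nsmul_eq_mul]
    · refine Finset.sum_congr rfl fun k _ => ?_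
      simp [c, add_smul, add_mul, mul_smul, Nat.cast_smul_eq_nsmul, nsmul_eq_mul]
  induction n using Nat.strong_induction_on generalizing f with
  | _ n ih =>
    rcases n with _ | n
    · rw [lower_zero]
      simp [formalExp]
    apply succ_smul_cancel (R := K) (n := n)
    rw [hrec, succ_smul_lower]
    refine Finset.sum_congr rfl fun k _ => ?_
    rw [ih (n - k) (by omega), dp_apply, pderiv_lower]

end Annihilation

/-! ### Exponent vectors with one variable split off. -/

section Exponents

variable {N : ℕ}

/-- The map `x^{(i)}_k ↦ x^{(i)}_{k+1}` on the variables of the family `i`. -/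
def bump (i : Fin N) (x : Fin N × ℕ) : Fin N × ℕ := if x.1 = i then (x.1, x.2 + 1) else x

theorem bump_injective (i : Fin N) : Function.Injective (bump i) := by
  rintro ⟨a, b⟩ ⟨c, d⟩ h
  simp only [bump] at h
  split_ifs at h <;> simp_all

/-- Prepend the exponent `k` to the exponents of the family `i`. -/
def consExp (i : Fin N) (k : ℕ) (d : Fin N × ℕ →₀ ℕ) : Fin N × ℕ →₀ ℕ :=
  d.mapDomain (bump i) + Finsupp.single (i, 0) k

/-- Drop the first exponent of the family `i`. -/
def tailExp (i : Fin N) (e : Fin N × ℕ →₀ ℕ) : Fin N × ℕ →₀ ℕ :=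
  e.comapDomain (bump i) (bump_injective i).injOn

theorem consExp_zero (i : Fin N) (k : ℕ) (d : Fin N × ℕ →₀ ℕ) : consExp i k d (i, 0) = k := by
  rw [consExp, Finsupp.add_apply, Finsupp.mapDomain_of_notMem_range, Finsupp.single_eq_same, zero_add]
  rintro ⟨⟨a, b⟩, h⟩
  simp only [bump] at h
  split_ifs at h <;> simp_all

theorem consExp_bump (i : Fin N) (k : ℕ) (d : Fin N × ℕ →₀ ℕ) (x : Fin N × ℕ) :
    consExp i k d (bump i x) = d x := by
  rw [consExp, Finsupp.add_apply, Finsupp.mapDomain_apply (bump_injective i),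
    Finsupp.single_eq_of_ne, add_zero]
  rintro h
  simp only [bump] at h
  split_ifs at h <;> simp_all

theorem consExp_succ (i : Fin N) (k : ℕ) (d : Fin N × ℕ →₀ ℕ) (m : ℕ) :
    consExp i k d (i, m + 1) = d (i, m) := by
  have := consExp_bump i k d (i, m)
  simpa [bump] using this

theorem consExp_of_ne {i j : Fin N} (h : j ≠ i) (k : ℕ) (d : Fin N × ℕ →₀ ℕ) (m : ℕ) :
    consExp i k d (j, m) = d (j, m) := by
  have := consExp_bump i k d (j, m)
  simpa [bump, h] using this

theorem tailExp_apply (i : Fin N) (e : Fin N × ℕ →₀ ℕ) (x : Fin N × ℕ) :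
    tailExp i e x = e (bump i x) := rfl

theorem tailExp_self (i : Fin N) (e : Fin N × ℕ →₀ ℕ) (m : ℕ) :
    tailExp i e (i, m) = e (i, m + 1) := by simp [tailExp_apply, bump]

theorem tailExp_of_ne {i j : Fin N} (h : j ≠ i) (e : Fin N × ℕ →₀ ℕ) (m : ℕ) :
    tailExp i e (j, m) = e (j, m) := by simp [tailExp_apply, bump, h]

theorem tailExp_consExp (i : Fin N) (k : ℕ) (d : Fin N × ℕ →₀ ℕ) : tailExp i (consExp i k d) = d := by
  ext x
  rw [tailExp_apply, consExp_bump]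

theorem consExp_tailExp (i : Fin N) (e : Fin N × ℕ →₀ ℕ) :
    consExp i (e (i, 0)) (tailExp i e) = e := by
  ext ⟨j, m⟩
  by_cases h : j = i
  · subst h
    rcases m with _ | m
    · rw [consExp_zero]
    · rw [consExp_succ, tailExp_self]
  · rw [consExp_of_ne h, tailExp_of_ne h]

theorem consExp_add (i : Fin N) (k l : ℕ) (d e : Fin N × ℕ →₀ ℕ) :
    consExp i (k + l) (d + e) = consExp i k d + consExp i l e := by
  simp only [consExp, Finsupp.mapDomain_add, Finsupp.single_add]
  abel

theorem tailExp_add (i : Fin N) (d e : Fin N × ℕ →₀ ℕ) :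
    tailExp i (d + e) = tailExp i d + tailExp i e := by
  ext x; simp [tailExp_apply]

theorem consExp_eq_zero {i : Fin N} {k : ℕ} {d : Fin N × ℕ →₀ ℕ} :
    consExp i k d = 0 ↔ k = 0 ∧ d = 0 := by
  constructor
  · intro h
    refine ⟨by rw [← consExp_zero i k d, h]; rfl, ?_⟩
    rw [← tailExp_consExp i k d, h]
    ext x; rfl
  · rintro ⟨rfl, rfl⟩; simp [consExp]

theorem sum_antidiagonal_consExp {M : Type} [AddCommMonoid M] (i : Fin N) (k : ℕ)
    (d : Fin N × ℕ →₀ ℕ) (F : (Fin N × ℕ →₀ ℕ) → (Fin N × ℕ →₀ ℕ) → M) :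
    ∑ x ∈ Finset.HasAntidiagonal.antidiagonal (consExp i k d), F x.1 x.2 =
      ∑ y ∈ Finset.HasAntidiagonal.antidiagonal k, ∑ z ∈ Finset.HasAntidiagonal.antidiagonal d,
        F (consExp i y.1 z.1) (consExp i y.2 z.2) := by
  rw [← Finset.sum_product']
  refine Finset.sum_nbij' (fun x => ((x.1 (i, 0), x.2 (i, 0)), (tailExp i x.1, tailExp i x.2)))
    (fun y => (consExp i y.1.1 y.2.1, consExp i y.1.2 y.2.2)) ?_ ?_ ?_ ?_ ?_
  · intro x hx
    rw [Finset.HasAntidiagonal.mem_antidiagonal] at hx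
    simp only [Finset.mem_product, Finset.HasAntidiagonal.mem_antidiagonal]
    constructor
    · rw [← Finsupp.add_apply, hx, consExp_zero]
    · rw [← tailExp_add, hx, tailExp_consExp]
  · intro y hy
    simp only [Finset.mem_product, Finset.HasAntidiagonal.mem_antidiagonal] at hy ⊢
    rw [← consExp_add, hy.1, hy.2]
  · intro x _
    simp [consExp_tailExp]
  · intro y _
    simp [consExp_zero, tailExp_consExp]
  · intro x _
    simp [consExp_tailExp]

end Exponents

/-! ### Coefficients in the variables, and independence of the power sums. -/

section Coefficients

variable {N : ℕ} {R : Type} [CommRing R]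

/-- The power sum `p^{(i)}_n` over a commutative ring. -/
def varPowerSum (R : Type) [CommRing R] (i : Fin N) (n : ℕ+) : MvPowerSeries (Fin N × ℕ) R :=
  open Classical in
  fun d => if ∃ k : ℕ, d = Finsupp.single (i, k) (n : ℕ) then 1 else 0

/-- `toVariables` over a commutative ring. -/
def expand : MvPolynomial (Fin N × ℕ+) R →ₐ[R] MvPowerSeries (Fin N × ℕ) R :=
  MvPolynomial.aeval fun v => varPowerSum R v.1 v.2

theorem toVariables_eq_expand {K : Type} [Field K] (f : SymN N K) :
    toVariables f = expand f := rfl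

/-- The coefficient of the monomial `x^d` in a symmetric function. -/
def cf (d : Fin N × ℕ →₀ ℕ) : MvPolynomial (Fin N × ℕ+) R →ₗ[R] R :=
  (MvPowerSeries.coeff d).comp (expand (N := N) (R := R)).toLinearMap

theorem cf_apply (d : Fin N × ℕ →₀ ℕ) (f : MvPolynomial (Fin N × ℕ+) R) :
    cf d f = MvPowerSeries.coeff d (expand f) := rfl

theorem cf_C (d : Fin N × ℕ →₀ ℕ) (c : R) :
    cf d (MvPolynomial.C c : MvPolynomial (Fin N × ℕ+) R) = if d = 0 then c else 0 := by
  classical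
  rw [cf_apply, expand, MvPolynomial.aeval_C, MvPowerSeries.algebraMap_apply,
    MvPowerSeries.coeff_C]
  rfl

theorem cf_mul (d : Fin N × ℕ →₀ ℕ) (f g : MvPolynomial (Fin N × ℕ+) R) :
    cf d (f * g) = ∑ x ∈ Finset.HasAntidiagonal.antidiagonal d, cf x.1 f * cf x.2 g := by
  simp only [cf_apply, map_mul, MvPowerSeries.coeff_mul]

open Classical in
theorem cf_X (d : Fin N × ℕ →₀ ℕ) (v : Fin N × ℕ+) :
    cf d (MvPolynomial.X v : MvPolynomial (Fin N × ℕ+) R) =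
      if ∃ k : ℕ, d = Finsupp.single (v.1, k) (v.2 : ℕ) then 1 else 0 := by
  rw [cf_apply, expand, MvPolynomial.aeval_X]
  rfl

theorem single_eq_consExp (i j : Fin N) (k n m : ℕ) (d : Fin N × ℕ →₀ ℕ) :
    consExp i k d = Finsupp.single (j, m) n ↔
      (∃ m', (j, m) = bump i (j, m') ∧ k = 0 ∧ d = Finsupp.single (j, m') n) ∨
        (j = i ∧ m = 0 ∧ n = k ∧ d = 0) := by
  constructor
  · intro h
    have h0 : k = Finsupp.single (j, m) n (i, 0) := by rw [← h, consExp_zero]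
    have ht : d = tailExp i (Finsupp.single (j, m) n) := by rw [← h, tailExp_consExp]
    by_cases hji : j = i ∧ m = 0
    · right
      obtain ⟨rfl, rfl⟩ := hji
      refine ⟨rfl, rfl, by simpa using h0.symm, ?_⟩
      rw [ht]
      ext ⟨a, b⟩
      rw [tailExp_apply, Finsupp.single_eq_of_ne]
      · rfl
      · intro h
        simp only [bump] at h
        split_ifs at h <;> simp_all
    · left
      obtain ⟨m', hm'⟩ : ∃ m', (j, m) = bump i (j, m') := by
        by_cases hj : j = i
        · obtain ⟨m', rfl⟩ := Nat.exists_eq_succ_of_ne_zero (fun hm => hji ⟨hj, hm⟩)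
          exact ⟨m', by simp [bump, hj]⟩
        · exact ⟨m, by simp [bump, hj]⟩
      refine ⟨m', hm', ?_, ?_⟩
      · rw [h0, Finsupp.single_eq_of_ne]
        rintro ⟨rfl, rfl⟩
        exact hji ⟨rfl, rfl⟩
      · rw [ht]
        ext x
        rw [tailExp_apply, hm']
        simp only [Finsupp.single_apply, (bump_injective i).eq_iff]
  · rintro (⟨m', hm', rfl, rfl⟩ | ⟨rfl, rfl, rfl, rfl⟩)
    · rw [consExp, Finsupp.mapDomain_single, hm']; simp
    · simp [consExp]

/-- Splitting off the first variable of the family `i`. -/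
theorem cf_consExp (i : Fin N) (k : ℕ) (d : Fin N × ℕ →₀ ℕ) (f : MvPolynomial (Fin N × ℕ+) R) :
    cf (consExp i k d) f = cf d (lower i 1 k f) := by
  classical
  induction f using MvPolynomial.induction_on generalizing k d with
  | C c =>
    rw [cf_C, lower_C]
    simp only [consExp_eq_zero]
    by_cases hk : k = 0
    · simp [hk, cf_C]
    · simp [hk]
  | add f g hf hg => simp only [map_add, hf, hg]
  | mul_X f v hf =>
    -- Setting the new first variable apart turns p_n into p_n + yⁿ. This is checked on generators;
    -- products follow because both sides are convolutions.
    have hX : ∀ k d, cf (consExp i k d) (MvPolynomial.X v : MvPolynomial (Fin N × ℕ+) R) =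
        cf d (lower i 1 k (MvPolynomial.X v)) := by
      intro k d
      obtain ⟨j, n⟩ := v
      rw [cf_X, lower_X, map_add]
      simp only [single_eq_consExp]
      have hn := n.pos
      by_cases hk : k = 0
      · subst hk
        have hn' : (n : ℕ) ≠ 0 := n.ne_zero
        simp only [true_and, hn', false_and, and_false, or_false, if_true, if_false, map_zero,
          add_zero, cf_X]
        congr 1
        apply propext
        constructor
        · rintro ⟨m, m', _, h⟩; exact ⟨m', h⟩
        · rintro ⟨m', h⟩
          exact ⟨(bump i (j, m')).2, m', by simp only [bump]; split_ifs <;> rfl, h⟩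
      · simp only [hk, false_and, and_false, exists_false, false_or, if_false, map_zero, zero_add]
        by_cases hj : j = i ∧ (n : ℕ) = k
        · rw [if_pos hj, Pi.one_apply, cf_C]
          congr 1
          simp [hj]
        · rw [if_neg hj, map_zero, if_neg]
          rintro ⟨m, h1, h2, h3, h4⟩
          exact hj ⟨h1, h3⟩
    rw [cf_mul, lower_mul, sum_antidiagonal_consExp (F := fun a b => cf a f * cf b (MvPolynomial.X v)),
      map_sum]
    refine Finset.sum_congr rfl fun y _ => ?_
    rw [cf_mul]
    refine Finset.sum_congr rfl fun z _ => ?_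
    rw [hf, hX]

/-- Power sums are unchanged when the variables are permuted within each family. -/
theorem cf_embDomain (e : (Fin N × ℕ) ≃ (Fin N × ℕ)) (he : ∀ x, (e x).1 = x.1)
    (d : Fin N × ℕ →₀ ℕ) (f : MvPolynomial (Fin N × ℕ+) R) :
    cf (d.embDomain e.toEmbedding) f = cf d f := by
  classical
  have key : (MvPowerSeries.rename e.toEmbedding).comp (expand (N := N) (R := R)) = expand := by
    apply MvPolynomial.algHom_ext
    intro v
    simp only [AlgHom.comp_apply, expand, MvPolynomial.aeval_X]
    ext x
    obtain ⟨y, rfl⟩ : ∃ y : Fin N × ℕ →₀ ℕ, x = y.embDomain e.toEmbedding := by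
      refine ⟨x.embDomain e.symm.toEmbedding, ?_⟩
      ext z
      obtain ⟨z, rfl⟩ := e.surjective z
      have h1 : e z = e.toEmbedding z := rfl
      rw [h1, Finsupp.embDomain_apply_self]
      have h2 : z = e.symm.toEmbedding (e z) := by simp
      conv_rhs => rw [h2]
      rw [Finsupp.embDomain_apply_self]
      rfl
    rw [MvPowerSeries.coeff_embDomain_rename]
    change (if _ then _ else _) = (if _ then _ else _)
    congr 1
    apply propext
    constructor
    · rintro ⟨k, rfl⟩
      refine ⟨(e (v.1, k)).2, ?_⟩
      rw [Finsupp.embDomain_single]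
      congr 1
      exact Prod.ext (he _) rfl
    · rintro ⟨k, h⟩
      refine ⟨(e.symm (v.1, k)).2, ?_⟩
      apply Finsupp.embDomain_injective e.toEmbedding
      rw [h, Finsupp.embDomain_single]
      congr 1
      have h1 : (e.symm (v.1, k)).1 = v.1 := by
        have := he (e.symm (v.1, k))
        simpa using this.symm
      have : (v.1, (e.symm (v.1, k)).2) = e.symm (v.1, k) := Prod.ext h1.symm rfl
      rw [this]
      simp
  have h2 : MvPowerSeries.rename e.toEmbedding (expand f) = expand f := AlgHom.congr_fun key f
  rw [cf_apply, ← h2, MvPowerSeries.coeff_embDomain_rename, cf_apply]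

theorem cf_map {R' : Type} [CommRing R'] (φ : R →+* R') (d : Fin N × ℕ →₀ ℕ)
    (f : MvPolynomial (Fin N × ℕ+) R) : cf d (MvPolynomial.map φ f) = φ (cf d f) := by
  classical
  induction f using MvPolynomial.induction_on generalizing d with
  | C c => rw [MvPolynomial.map_C, cf_C, cf_C]; split_ifs <;> simp
  | add f g hf hg => simp only [map_add, hf, hg]
  | mul_X f v hf =>
    rw [map_mul, MvPolynomial.map_X, cf_mul, cf_mul, map_sum]
    refine Finset.sum_congr rfl fun x _ => ?_
    rw [hf, map_mul, cf_X, cf_X]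
    split_ifs <;> simp

/-- The Euler derivation, `p^{(i)}_n ↦ n p^{(i)}_n`. -/
def euler (N : ℕ) (R : Type) [CommRing R] :
    Derivation R (MvPolynomial (Fin N × ℕ+) R) (MvPolynomial (Fin N × ℕ+) R) :=
  MvPolynomial.mkDerivation R fun v => (((v.2 : ℕ) : R)) • MvPolynomial.X v

/-- p_n is homogeneous of degree n in the variables and the degree is additive. The Euler operator
therefore makes the degree visible in either description. -/
theorem cf_euler (d : Fin N × ℕ →₀ ℕ) (f : MvPolynomial (Fin N × ℕ+) R) :
    cf d (euler N R f) = (d.degree : R) * cf d f := by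
  classical
  induction f using MvPolynomial.induction_on generalizing d with
  | C c =>
    rw [MvPolynomial.derivation_C, map_zero, cf_C]
    split_ifs with h <;> simp [h]
  | add f g hf hg => simp only [map_add, hf, hg, mul_add]
  | mul_X f v hf =>
    rw [Derivation.leibniz, map_add, smul_eq_mul, smul_eq_mul, mul_comm (MvPolynomial.X v),
      cf_mul, cf_mul, cf_mul, ← Finset.sum_add_distrib, Finset.mul_sum]
    refine Finset.sum_congr rfl fun x hx => ?_
    rw [Finset.HasAntidiagonal.mem_antidiagonal] at hx
    rw [hf, euler, MvPolynomial.mkDerivation_X, map_smul, cf_X, ← hx, map_add]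
    split_ifs with h
    · obtain ⟨k, hk⟩ := h
      rw [hk, Finsupp.degree_single]
      push_cast
      simp only [smul_eq_mul]; ring
    · simp

theorem cf_zero (f : MvPolynomial (Fin N × ℕ+) R) : cf 0 f = MvPolynomial.coeff 0 f := by
  classical
  induction f using MvPolynomial.induction_on with
  | C c => simp [cf_C]
  | add f g hf hg => simp only [map_add, hf, hg, MvPolynomial.coeff_add]
  | mul_X f v hf =>
    rw [cf_mul, MvPolynomial.coeff_mul_X']
    simp only [Finsupp.support_zero, Finset.notMem_empty, if_false]
    refine Finset.sum_eq_zero fun x hx => ?_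
    rw [Finset.HasAntidiagonal.mem_antidiagonal] at hx
    have : x.2 = 0 := (add_eq_zero.1 hx).2
    rw [this, cf_X, if_neg, mul_zero]
    rintro ⟨k, hk⟩
    have := congrArg (fun d : Fin N × ℕ →₀ ℕ => d (v.1, k)) hk
    simp only [Finsupp.coe_zero, Pi.zero_apply, Finsupp.single_eq_same] at this
    exact v.2.ne_zero this.symm

/-- A symmetric function is determined by its expansion in the variables. -/
theorem eq_zero_of_cf_eq_zero [Algebra ℚ R] (f : MvPolynomial (Fin N × ℕ+) R)
    (h : ∀ d, cf d f = 0) : f = 0 := by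
  have hU : ∀ g : MvPolynomial (Fin N × ℕ+) R, (∀ d, cf d g = 0) →
      ∀ i k d, cf d (lower i 1 k g) = 0 := fun g hg i k d => by rw [← cf_consExp, hg]
  -- The functions with zero expansion are stable under `lower i 1 k`. In `succ_smul_lower` the last
  -- summand is a multiple of the derivative wanted, and the others are `lower` of derivatives of
  -- smaller index, so stability under ∂/∂p_n follows by induction.
  have hD : ∀ (i : Fin N) (n : ℕ) (g : MvPolynomial (Fin N × ℕ+) R), (∀ d, cf d g = 0) →
      ∀ d, cf d (MvPolynomial.pderiv (i, n.succPNat) g) = 0 := by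
    intro i n
    induction n using Nat.strong_induction_on with
    | _ n ih =>
      intro g hg d
      have h1 := congrArg (cf d) (succ_smul_lower i (1 : ℕ+ → R) n g)
      rw [map_smul, hU g hg, smul_zero, map_sum, Finset.sum_range_succ, Finset.sum_eq_zero,
        zero_add, Nat.sub_self, lower_zero, map_smul, Pi.one_apply, mul_one] at h1
      · refine (succ_smul_cancel (R := R) (n := n) ?_).symm
        rw [smul_zero]; exact h1
      · intro k hk
        rw [map_smul, hU _ (ih k (Finset.mem_range.1 hk) g hg), smul_zero]
  -- Derivatives lower the degree in the power sums, and at degree zero the coefficient is the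
  -- constant term of the expansion.
  have key : ∀ (n : ℕ) (m : Fin N × ℕ+ →₀ ℕ), m.degree = n → ∀ g : MvPolynomial (Fin N × ℕ+) R,
      (∀ d, cf d g = 0) → MvPolynomial.coeff m g = 0 := by
    intro n
    induction n with
    | zero =>
      intro m hm g hg
      rw [(Finsupp.degree_eq_zero_iff _).1 hm, ← cf_zero, hg]
    | succ n ih =>
      intro m hm g hg
      obtain ⟨w, hw⟩ : ∃ w, m w ≠ 0 := by
        by_contra! hc
        have : m = 0 := Finsupp.ext hc
        simp [this] at hm
      have hle : Finsupp.single w 1 ≤ m := by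
        rw [Finsupp.single_le_iff]; omega
      obtain ⟨m', rfl⟩ := exists_add_of_le hle
      rw [add_comm] at hm ⊢
      have hm' : m'.degree = n := by
        rw [map_add, Finsupp.degree_single] at hm; omega
      have h1 := MvPolynomial.coeff_pderiv (i := w) g m'
      have h2 : MvPolynomial.coeff m' (MvPolynomial.pderiv w g) = 0 := by
        refine ih m' hm' _ fun d => ?_
        have := hD w.1 w.2.natPred g hg d
        simpa using this
      rw [h2] at h1
      refine succ_smul_cancel (R := R) (n := m' w) ?_
      rw [smul_zero, smul_eq_mul, mul_comm, ← h1]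
  ext m
  rw [key _ m rfl f h, MvPolynomial.coeff_zero]

theorem eq_of_cf_eq [Algebra ℚ R] {f g : MvPolynomial (Fin N × ℕ+) R}
    (h : ∀ d, cf d f = cf d g) : f = g :=
  sub_eq_zero.1 (eq_zero_of_cf_eq_zero _ fun d => by rw [map_sub, h, sub_self])

end Coefficients

/-! ### Sorting finitely supported sequences. -/

section Rearrangements

theorem exists_perm_antitone (g : ℕ →₀ ℕ) : ∃ σ : Equiv.Perm ℕ, Antitone fun k => g (σ k) := by
  obtain ⟨n, hn⟩ : ∃ n, ∀ k, n ≤ k → g k = 0 := by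
    refine ⟨g.support.sup id + 1, fun k hk => ?_⟩
    by_contra hc
    have : k ≤ g.support.sup id := Finset.le_sup (f := id) (Finsupp.mem_support_iff.2 hc)
    omega
  -- `Tuple.sort` sorts increasingly; the order dual makes the result decreasing.
  let F : Fin n → ℕᵒᵈ := fun i => OrderDual.toDual (g i)
  let τ := Tuple.sort F
  have hτ : Monotone (F ∘ τ) := Tuple.monotone_sort F
  let σ : Equiv.Perm ℕ := τ.extendDomain Fin.equivSubtype
  have h1 : ∀ i : Fin n, σ i = τ i := fun i => τ.extendDomain_apply_image Fin.equivSubtype i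
  have h2 : ∀ k, n ≤ k → σ k = k := fun k hk =>
    τ.extendDomain_apply_not_subtype Fin.equivSubtype (by omega)
  refine ⟨σ, fun a b hab => ?_⟩
  dsimp only
  by_cases hb : b < n
  · have := hτ (show (⟨a, by omega⟩ : Fin n) ≤ ⟨b, hb⟩ from hab)
    have ha' := h1 ⟨a, by omega⟩
    have hb' := h1 ⟨b, hb⟩
    simp only at ha' hb'
    rw [ha', hb']
    exact this
  · rw [h2 b (by omega), hn b (by omega)]
    exact Nat.zero_le _

theorem exists_lt_iff_of_antitone {l : ℕ → ℕ} (hl : Antitone l) {x : ℕ}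
    (hx : ∃ k, l k < x) : ∃ n, ∀ k, x ≤ l k ↔ k < n := by
  classical
  refine ⟨Nat.find hx, fun k => ⟨fun h => ?_, fun h => ?_⟩⟩
  · by_contra hc
    have := hl (not_lt.1 hc)
    have := Nat.find_spec hx
    omega
  · exact not_lt.1 (Nat.find_min hx h)

/-- A finitely supported antitone sequence is determined by its positive fibre sizes. -/
theorem eq_of_ncard_fiber_eq {l m : ℕ →₀ ℕ} (hl : Antitone l) (hm : Antitone m)
    (h : ∀ n, 0 < n → {k | l k = n}.ncard = {k | m k = n}.ncard) : l = m := by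
  have hfin : ∀ g : ℕ →₀ ℕ, ∀ x, 0 < x → {k | x ≤ g k}.Finite := fun g x hx =>
    g.support.finite_toSet.subset fun k hk => by
      have : x ≤ g k := hk
      simp only [Finset.mem_coe, Finsupp.mem_support_iff]; omega
  have hstep : ∀ g : ℕ →₀ ℕ, ∀ x, 0 < x →
      {k | x ≤ g k}.ncard = {k | g k = x}.ncard + {k | x + 1 ≤ g k}.ncard := by
    intro g x hx
    have h1 : {k | g k = x}.Finite := (hfin g x hx).subset fun k hk => le_of_eq (Eq.symm hk)
    have h2 : Disjoint {k | g k = x} {k | x + 1 ≤ g k} := by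
      rw [Set.disjoint_left]; intro k hk hk'
      simp only [Set.mem_ofPred_eq] at hk hk'; omega
    rw [← Set.ncard_union_eq h2 h1 (hfin g (x + 1) (by omega))]
    congr 1; ext k; simp only [Set.mem_ofPred_eq, Set.mem_union]; omega
  obtain ⟨B, hB⟩ : ∃ B, ∀ k, l k < B ∧ m k < B := by
    refine ⟨l 0 + m 0 + 1, fun k => ?_⟩
    have := hl (Nat.zero_le k)
    have := hm (Nat.zero_le k)
    omega
  -- Induction on the distance of x from the upper bound B: the set of indices with value at least x
  -- grows by one fibre when x decreases by one.
  have hcard : ∀ y x, 0 < x → B ≤ x + y → {k | x ≤ l k}.ncard = {k | x ≤ m k}.ncard := by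
    intro y
    induction y with
    | zero =>
      intro x hx hB'
      have e1 : {k | x ≤ l k} = ∅ := by
        refine Set.eq_empty_iff_forall_notMem.2 fun k hk => ?_
        have := hB k
        simp only [Set.mem_ofPred_eq] at hk
        omega
      have e2 : {k | x ≤ m k} = ∅ := by
        refine Set.eq_empty_iff_forall_notMem.2 fun k hk => ?_
        have := hB k
        simp only [Set.mem_ofPred_eq] at hk
        omega
      rw [e1, e2]
    | succ y ih =>
      intro x hx hB'
      rw [hstep l x hx, hstep m x hx, h x hx, ih (x + 1) (by omega) (by omega)]
  have hzero : ∀ g : ℕ →₀ ℕ, ∀ x, 0 < x → ∃ k, g k < x := fun g x hx => by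
    obtain ⟨k, hk⟩ := Infinite.exists_notMem_finset g.support
    exact ⟨k, by rw [Finsupp.notMem_support_iff.1 hk]; exact hx⟩
  have hiff : ∀ x, 0 < x → ∀ k, x ≤ l k ↔ x ≤ m k := by
    intro x hx k
    obtain ⟨a, ha⟩ := exists_lt_iff_of_antitone hl (hzero l x hx)
    obtain ⟨b, hb⟩ := exists_lt_iff_of_antitone hm (hzero m x hx)
    have e1 : {k | x ≤ l k} = Set.Iio a := Set.ext ha
    have e2 : {k | x ≤ m k} = Set.Iio b := Set.ext hb
    have := hcard B x hx (by omega)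
    rw [e1, e2, ← Finset.coe_Iio, ← Finset.coe_Iio, Set.ncard_coe_finset, Set.ncard_coe_finset,
      Nat.card_Iio, Nat.card_Iio] at this
    rw [ha, hb, this]
  ext k
  apply le_antisymm
  · rcases Nat.eq_zero_or_pos (l k) with h0 | h0
    · omega
    · exact (hiff _ h0 k).1 le_rfl
  · rcases Nat.eq_zero_or_pos (m k) with h0 | h0
    · omega
    · exact (hiff _ h0 k).2 le_rfl

theorem sum_le_sum_range_card {l : ℕ → ℕ} (hl : Antitone l) (s : Finset ℕ) :
    ∑ k ∈ s, l k ≤ ∑ k ∈ Finset.range s.card, l k := by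
  induction hn : s.card generalizing s with
  | zero => rw [Finset.card_eq_zero.1 hn]; simp
  | succ n ih =>
    have hne : s.Nonempty := Finset.card_pos.1 (by omega)
    set a := s.max' hne
    have ha : a ∈ s := s.max'_mem hne
    have hle : n ≤ a := by
      have : s ⊆ Finset.range (a + 1) := fun k hk =>
        Finset.mem_range.2 (Nat.lt_succ_of_le (s.le_max' k hk))
      have := Finset.card_le_card this
      simp only [Finset.card_range] at this
      omega
    rw [Finset.sum_range_succ, ← Finset.sum_erase_add _ _ ha]
    exact add_le_add (ih (s.erase a) (by rw [Finset.card_erase_of_mem ha, hn]; rfl)) (hl hle)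

end Rearrangements

/-! ### Tuples of partitions and the monomials of `m_λ`. -/

section Tuples

variable {N : ℕ}

theorem Ptn.size_eq_sum_range (l : Ptn) {M : ℕ} (hM : ∀ k, M ≤ k → l.1 k = 0) :
    l.size = ∑ k ∈ Finset.range M, l.1 k := by
  rw [Ptn.size]
  refine Finsupp.sum_of_support_subset _ (fun k hk => ?_) _ (fun _ _ => rfl)
  rw [Finset.mem_range]
  by_contra hc
  exact Finsupp.mem_support_iff.1 hk (hM k (not_lt.1 hc))

theorem Ptn.exists_bound (l : Ptn) : ∃ M, ∀ k, M ≤ k → l.1 k = 0 := by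
  refine ⟨l.1.support.sup id + 1, fun k hk => ?_⟩
  by_contra hc
  have : k ≤ l.1.support.sup id := Finset.le_sup (f := id) (Finsupp.mem_support_iff.2 hc)
  omega

theorem Ptn.sum_range_le_size (l : Ptn) (r : ℕ) : ∑ k ∈ Finset.range r, l.1 k ≤ l.size := by
  obtain ⟨M, hM⟩ := l.exists_bound
  rw [l.size_eq_sum_range (M := max M r) (fun k hk => hM k (le_trans (le_max_left _ _) hk))]
  exact Finset.sum_le_sum_of_subset (Finset.range_mono (le_max_right _ _))

theorem Ptn.eq_zero_of_size_le (l : Ptn) {k : ℕ} (hk : l.size ≤ k) : l.1 k = 0 := by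
  by_contra hc
  have h1 := l.sum_range_le_size (k + 1)
  have h2 : ∑ j ∈ Finset.range (k + 1), 1 ≤ ∑ j ∈ Finset.range (k + 1), l.1 j := by
    refine Finset.sum_le_sum fun j hj => ?_
    have := l.2 (Nat.lt_succ_iff.1 (Finset.mem_range.1 hj))
    omega
  simp only [Finset.sum_const, Finset.card_range, smul_eq_mul, mul_one] at h2
  omega

theorem Ptn.size_eq_sum_range_of_le (l : Ptn) {M : ℕ} (hM : l.size ≤ M) :
    l.size = ∑ k ∈ Finset.range M, l.1 k :=
  l.size_eq_sum_range fun _ hk => l.eq_zero_of_size_le (hM.trans hk)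

/-- The exponents of the leading monomial of `m_λ`. -/
def expOf (lam : PtnTuple N) : Fin N × ℕ →₀ ℕ :=
  Finsupp.ofSupportFinite (fun x => (lam x.1).1 x.2) <| by
    refine (Set.Finite.prod (s := (Set.univ : Set (Fin N)))
      (t := ((Finset.univ.biUnion fun i => (lam i).1.support : Finset ℕ) : Set ℕ))
      Set.finite_univ (Finset.finite_toSet _)).subset fun x hx => ?_
    simp only [Set.mem_prod, Set.mem_univ, true_and, Finset.mem_coe, Finset.mem_biUnion,
      Finset.mem_univ]
    exact ⟨x.1, Finsupp.mem_support_iff.2 hx⟩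

theorem expOf_apply (lam : PtnTuple N) (x : Fin N × ℕ) : expOf lam x = (lam x.1).1 x.2 := rfl

/-- The monomial `x^d` occurs in `m_λ`. -/
def Rearranges (d : Fin N × ℕ →₀ ℕ) (lam : PtnTuple N) : Prop :=
  ∀ i, ∃ σ : Equiv.Perm ℕ, ∀ k, d (i, σ k) = (lam i).1 k

theorem rearranges_expOf (lam : PtnTuple N) : Rearranges (expOf lam) lam :=
  fun _ => ⟨Equiv.refl ℕ, fun _ => rfl⟩

/-- The exponents of the variables of the family `i`. -/
def family (d : Fin N × ℕ →₀ ℕ) (i : Fin N) : ℕ →₀ ℕ :=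
  d.comapDomain (fun k => (i, k)) (Prod.mk_right_injective i).injOn

theorem family_apply (d : Fin N × ℕ →₀ ℕ) (i : Fin N) (k : ℕ) : family d i k = d (i, k) := rfl

theorem exists_rearranges (d : Fin N × ℕ →₀ ℕ) : ∃ lam : PtnTuple N, Rearranges d lam := by
  choose σ hσ using fun i => exists_perm_antitone (family d i)
  exact ⟨fun i => ⟨(family d i).equivMapDomain (σ i).symm, fun a b hab => hσ i hab⟩,
    fun i => ⟨σ i, fun k => rfl⟩⟩

theorem Rearranges.eq {d : Fin N × ℕ →₀ ℕ} {lam mu : PtnTuple N} (h1 : Rearranges d lam)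
    (h2 : Rearranges d mu) : lam = mu := by
  funext i
  apply Subtype.ext
  obtain ⟨σ, hσ⟩ := h1 i
  obtain ⟨τ, hτ⟩ := h2 i
  refine eq_of_ncard_fiber_eq (lam i).2 (mu i).2 fun n _ => ?_
  have e1 : {k | (lam i).1 k = n} = σ ⁻¹' {k | d (i, k) = n} := by ext k; simp [hσ]
  have e2 : {k | (mu i).1 k = n} = τ ⁻¹' {k | d (i, k) = n} := by ext k; simp [hτ]
  have hp : ∀ (σ : Equiv.Perm ℕ) (s : Set ℕ), (σ ⁻¹' s).ncard = s.ncard := fun σ s => by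
    rw [← Equiv.image_symm_eq_preimage, Set.ncard_image_of_injective _ σ.symm.injective]
  rw [e1, e2, hp, hp]

theorem Rearranges.expOf_iff {lam mu : PtnTuple N} : Rearranges (expOf mu) lam ↔ mu = lam :=
  ⟨fun h => (rearranges_expOf mu).eq h, fun h => h ▸ rearranges_expOf mu⟩

/-- This is where dominance comes from: no r exponents of a rearrangement exceed in total the r
largest parts. -/
theorem Rearranges.sum_range_le {d : Fin N × ℕ →₀ ℕ} {lam : PtnTuple N} (h : Rearranges d lam)
    (i : Fin N) (r : ℕ) : ∑ k ∈ Finset.range r, d (i, k) ≤ ∑ k ∈ Finset.range r, (lam i).1 k := by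
  obtain ⟨σ, hσ⟩ := h i
  have h1 : ∑ k ∈ Finset.range r, d (i, k) =
      ∑ k ∈ (Finset.range r).map σ.symm.toEmbedding, (lam i).1 k := by
    rw [Finset.sum_map]
    refine Finset.sum_congr rfl fun k _ => ?_
    rw [← hσ]; simp
  rw [h1]
  refine (sum_le_sum_range_card (lam i).2 _).trans ?_
  rw [Finset.card_map, Finset.card_range]

theorem Rearranges.degree_family {d : Fin N × ℕ →₀ ℕ} {lam : PtnTuple N} (h : Rearranges d lam)
    (i : Fin N) : (family d i).degree = (lam i).size := by
  obtain ⟨σ, hσ⟩ := h i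
  have : family d i = (lam i).1.mapDomain σ := by
    ext k
    obtain ⟨k, rfl⟩ := σ.surjective k
    rw [Finsupp.mapDomain_apply σ.injective, ← hσ, family_apply]
  rw [this, Finsupp.degree_mapDomain]
  rfl

theorem degree_eq_sum_family (d : Fin N × ℕ →₀ ℕ) : d.degree = ∑ i, (family d i).degree := by
  classical
  simp only [Finsupp.degree_apply]
  have : d.support = Finset.univ.biUnion fun i => (family d i).support.map
      ⟨fun k => (i, k), Prod.mk_right_injective i⟩ := by
    ext ⟨i, k⟩
    simp [family_apply]
  rw [this, Finset.sum_biUnion]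
  · refine Finset.sum_congr rfl fun i _ => ?_
    rw [Finset.sum_map]; rfl
  · intro i _ j _ hij
    simp only [Function.onFun, Finset.disjoint_left, Finset.mem_map]
    rintro _ ⟨a, _, rfl⟩ ⟨b, _, hb⟩
    exact hij (by simpa using (congrArg Prod.fst hb).symm)

theorem Rearranges.degree_eq {d : Fin N × ℕ →₀ ℕ} {lam : PtnTuple N} (h : Rearranges d lam) :
    d.degree = ∑ i, (lam i).size := by
  rw [degree_eq_sum_family]
  exact Finset.sum_congr rfl fun i _ => h.degree_family i

/-- By symmetry within each family, the coefficients at the sorted exponents determine all of them.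
-/
theorem Rearranges.cf_eq {R : Type} [CommRing R] {d : Fin N × ℕ →₀ ℕ} {lam : PtnTuple N}
    (h : Rearranges d lam) (f : MvPolynomial (Fin N × ℕ+) R) : cf d f = cf (expOf lam) f := by
  choose σ hσ using h
  let e : (Fin N × ℕ) ≃ (Fin N × ℕ) :=
    { toFun := fun x => (x.1, σ x.1 x.2)
      invFun := fun x => (x.1, (σ x.1).symm x.2)
      left_inv := fun x => by simp
      right_inv := fun x => by simp }
  have : d = (expOf lam).embDomain e.toEmbedding := by
    ext x
    obtain ⟨x, rfl⟩ := e.surjective x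
    have h1 : e x = e.toEmbedding x := rfl
    rw [h1, Finsupp.embDomain_apply_self, expOf_apply, ← hσ]
    rfl
  rw [this]
  exact cf_embDomain e (fun _ => rfl) _ _

open Classical in
-- The families have disjoint variables, so the only splitting of d that contributes separates the
-- exponents of the family a from the others.
theorem coeff_prod_monomialSym {K : Type} [Field K] (lam : PtnTuple N) (s : Finset (Fin N))
    (d : Fin N × ℕ →₀ ℕ) :
    MvPowerSeries.coeff d (∏ i ∈ s, (monomialSym i (lam i) : MvPowerSeries (Fin N × ℕ) K)) =
      if (∀ i ∈ s, ∃ σ : Equiv.Perm ℕ, ∀ k, d (i, σ k) = (lam i).1 k) ∧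
        ∀ j ∉ s, ∀ k, d (j, k) = 0 then 1 else 0 := by
  induction s using Finset.induction_on generalizing d with
  | empty =>
    rw [Finset.prod_empty, MvPowerSeries.coeff_one]
    congr 1
    apply propext
    constructor
    · rintro rfl; simp
    · rintro ⟨_, h⟩; ext x; exact h x.1 (by simp) x.2
  | insert a s ha ih =>
    rw [Finset.prod_insert ha, MvPowerSeries.coeff_mul]
    have hm : ∀ e : Fin N × ℕ →₀ ℕ, MvPowerSeries.coeff e
        (monomialSym a (lam a) : MvPowerSeries (Fin N × ℕ) K) =
        if (∃ σ : Equiv.Perm ℕ, ∀ k, e (a, σ k) = (lam a).1 k) ∧ ∀ j, j ≠ a → ∀ k, e (j, k) = 0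
        then 1 else 0 := fun e => rfl
    simp only [hm, ih]
    let d1 := d.filter fun x => x.1 = a
    let d2 := d.filter fun x => ¬ x.1 = a
    have hd : d1 + d2 = d := Finsupp.filter_add_filter_not d _
    have hd1 : ∀ x, d1 x = if x.1 = a then d x else 0 := fun x => Finsupp.filter_apply _ _ _
    have hd2 : ∀ x, d2 x = if x.1 = a then 0 else d x := fun x => by
      rw [Finsupp.filter_apply, ite_not]
    rw [Finset.sum_eq_single (d1, d2)]
    · rw [ite_zero_mul_ite_zero, mul_one]
      congr 1
      apply propext
      constructor
      · rintro ⟨⟨⟨σ, hσ⟩, h2⟩, h3, h4⟩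
        refine ⟨fun i hi => ?_, fun j hj k => ?_⟩
        · rcases Finset.mem_insert.1 hi with rfl | hi'
          · exact ⟨σ, fun k => by rw [← hσ, hd1]; simp⟩
          · obtain ⟨τ, hτ⟩ := h3 i hi'
            refine ⟨τ, fun k => ?_⟩
            rw [← hτ, hd2, if_neg]
            rintro rfl; exact ha hi'
        · rw [Finset.mem_insert, not_or] at hj
          have := h4 j hj.2 k
          rwa [hd2, if_neg hj.1] at this
      · rintro ⟨h1, h2⟩
        refine ⟨⟨?_, fun j hj k => ?_⟩, fun i hi => ?_, fun j hj k => ?_⟩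
        · obtain ⟨σ, hσ⟩ := h1 a (Finset.mem_insert_self _ _)
          exact ⟨σ, fun k => by rw [hd1, if_pos rfl, hσ]⟩
        · rw [hd1, if_neg hj]
        · obtain ⟨σ, hσ⟩ := h1 i (Finset.mem_insert_of_mem hi)
          refine ⟨σ, fun k => ?_⟩
          rw [hd2, if_neg, hσ]
          rintro rfl; exact ha hi
        · rw [hd2]
          split_ifs with hja
          · rfl
          · exact h2 j (by rw [Finset.mem_insert, not_or]; exact ⟨hja, hj⟩) k
    · rintro ⟨e1, e2⟩ he hne
      rw [Finset.HasAntidiagonal.mem_antidiagonal] at he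
      rw [ite_zero_mul_ite_zero, if_neg]
      rintro ⟨⟨_, h2⟩, _, h4⟩
      apply hne
      have he' : ∀ x, e1 x + e2 x = d x := fun x => by rw [← he]; rfl
      have h5 : e1 = d1 := by
        ext x
        rw [hd1]
        split_ifs with hx
        · have h6 : e2 x = 0 := h4 x.1 (hx ▸ ha) x.2
          have := he' x
          omega
        · exact h2 x.1 hx x.2
      have h6 : e2 = d2 := by
        ext x
        rw [hd2]
        split_ifs with hx
        · exact h4 x.1 (hx ▸ ha) x.2
        · have h6 : e1 x = 0 := h2 x.1 hx x.2
          have := he' x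
          omega
      rw [h5, h6]
    · intro h
      exact absurd (Finset.HasAntidiagonal.mem_antidiagonal.2 hd) h

open Classical in
theorem coeff_monomialSymTuple {K : Type} [Field K] (lam : PtnTuple N) (d : Fin N × ℕ →₀ ℕ) :
    MvPowerSeries.coeff d (monomialSymTuple lam : MvPowerSeries (Fin N × ℕ) K) =
      if Rearranges d lam then 1 else 0 := by
  rw [monomialSymTuple, coeff_prod_monomialSym]
  congr 1
  simp [Rearranges]

/-- Tuples of partitions of total size `s`. -/
@[ext]
structure TupleOfSize (N s : ℕ) : Type where
  /-- The tuple of partitions. -/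
  val : PtnTuple N
  size_eq : ∑ i, (val i).size = s

instance (s : ℕ) : Finite (TupleOfSize N s) := by
  have hle : ∀ (lam : TupleOfSize N s) i, (lam.1 i).size ≤ s := fun lam i => by
    refine le_of_le_of_eq ?_ lam.2
    exact Finset.single_le_sum (f := fun i => (lam.1 i).size) (fun _ _ => Nat.zero_le _)
      (Finset.mem_univ i)
  let F : TupleOfSize N s → (Fin N → Fin s → Fin (s + 1)) := fun lam i k =>
    ⟨(lam.1 i).1 k, by
      have h1 := (lam.1 i).sum_range_le_size 1
      have h2 := (lam.1 i).2 (Nat.zero_le (k : ℕ))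
      have := hle lam i
      simp only [Finset.sum_range_one] at h1
      omega⟩
  refine Finite.of_injective F fun lam mu h => ?_
  apply TupleOfSize.ext
  funext i
  apply Subtype.ext
  ext k
  by_cases hk : k < s
  · have := congrFun (congrFun h i) ⟨k, hk⟩
    exact congrArg Fin.val this
  · rw [(lam.1 i).eq_zero_of_size_le ((hle lam i).trans (not_lt.1 hk)),
      (mu.1 i).eq_zero_of_size_le ((hle mu i).trans (not_lt.1 hk))]

end Tuples

/-! ### The monomial functions as polynomials in the power sums. -/

section MonomialBasis

variable {N : ℕ}

/-- The exponents of the product of power sums `∏ p^{(i)}_{λ^{(i)}_k}`. -/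
def powerSumExp (lam : PtnTuple N) : Fin N × ℕ+ →₀ ℕ :=
  (expOf lam).sum fun x a => Finsupp.single (x.1, a.toPNat') 1

/-- The degree of a monomial in the power sums. -/
def psWeight : (Fin N × ℕ+ →₀ ℕ) →+ ℕ := Finsupp.weight fun v : Fin N × ℕ+ => (v.2 : ℕ)

theorem psWeight_powerSumExp (lam : PtnTuple N) :
    psWeight (powerSumExp lam) = ∑ i, (lam i).size := by
  rw [powerSumExp, map_finsuppSum, ← (rearranges_expOf lam).degree_eq, Finsupp.degree_apply]
  refine Finset.sum_congr rfl fun x hx => ?_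
  have : 0 < expOf lam x := Nat.pos_of_ne_zero (Finsupp.mem_support_iff.1 hx)
  dsimp only
  rw [psWeight, Finsupp.weight_single, one_smul, Nat.toPNat'_coe, if_pos this]

theorem powerSumExp_apply (lam : PtnTuple N) (i : Fin N) (n : ℕ+) :
    powerSumExp lam (i, n) = {k | (lam i).1 k = n}.ncard := by
  classical
  have hinj : Function.Injective fun k : ℕ => (i, k) := Prod.mk_right_injective i
  rw [← Set.ncard_image_of_injective _ hinj]
  have : (fun k : ℕ => (i, k)) '' {k | (lam i).1 k = n} =
      ((expOf lam).support.filter fun x => (x.1, (expOf lam x).toPNat') = (i, n) :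
        Finset (Fin N × ℕ)) := by
    ext ⟨j, k⟩
    simp only [Set.mem_image, Set.mem_ofPred_eq, Prod.mk.injEq, Finset.coe_filter,
      Finsupp.mem_support_iff, expOf_apply]
    constructor
    · rintro ⟨k', h, rfl, rfl⟩
      exact ⟨by rw [h]; exact n.ne_zero, rfl, by rw [h]; exact PNat.coe_toPNat' n⟩
    · rintro ⟨h1, rfl, h3⟩
      refine ⟨k, ?_, rfl, rfl⟩
      rw [← h3, Nat.toPNat'_coe, if_pos (Nat.pos_of_ne_zero h1)]
  rw [this, Set.ncard_coe_finset, powerSumExp, Finsupp.sum_apply, Finsupp.sum, Finset.card_filter]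
  refine Finset.sum_congr rfl fun x _ => ?_
  rw [Finsupp.single_apply]

theorem powerSumExp_injective : Function.Injective (powerSumExp (N := N)) := by
  intro lam mu h
  funext i
  apply Subtype.ext
  refine eq_of_ncard_fiber_eq (lam i).2 (mu i).2 fun n hn => ?_
  obtain ⟨n, rfl⟩ : ∃ n' : ℕ+, n = n' := ⟨⟨n, hn⟩, rfl⟩
  rw [← powerSumExp_apply, ← powerSumExp_apply, h]

theorem euler_monomial {R : Type} [CommRing R] (m : Fin N × ℕ+ →₀ ℕ) :
    euler N R (MvPolynomial.monomial m 1) = (psWeight m : R) • MvPolynomial.monomial m 1 := by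
  rw [euler, MvPolynomial.mkDerivation_monomial, one_smul, psWeight, Finsupp.weight_apply,
    Finsupp.sum, Finsupp.sum, Nat.cast_sum, Finset.sum_smul]
  refine Finset.sum_congr rfl fun v hv => ?_
  have hle : Finsupp.single v 1 ≤ m := by
    rw [Finsupp.single_le_iff]
    exact Nat.pos_of_ne_zero (Finsupp.mem_support_iff.1 hv)
  rw [smul_eq_mul, mul_smul_comm, MvPolynomial.X, MvPolynomial.monomial_mul,
    tsub_add_cancel_of_le hle, MvPolynomial.smul_monomial, MvPolynomial.smul_monomial]
  simp [mul_comm]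

theorem cf_monomial_eq_zero {m : Fin N × ℕ+ →₀ ℕ} {d : Fin N × ℕ →₀ ℕ}
    (h : d.degree ≠ psWeight m) : cf d (MvPolynomial.monomial m (1 : ℚ)) = 0 := by
  have h1 := cf_euler d (MvPolynomial.monomial m (1 : ℚ))
  rw [euler_monomial, map_smul, smul_eq_mul, ← sub_eq_zero, ← sub_mul] at h1
  refine (mul_eq_zero.1 h1).resolve_left ?_
  rw [← ne_eq, sub_ne_zero]
  exact_mod_cast h.symm

open Classical in
/-- Every `m_λ` is a polynomial in the power sums. -/
theorem exists_monomialSym (lam : PtnTuple N) : ∃ f : MvPolynomial (Fin N × ℕ+) ℚ,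
    ∀ d, cf d f = if Rearranges d lam then 1 else 0 := by
  obtain ⟨s, hs⟩ : ∃ s, ∑ i, (lam i).size = s := ⟨_, rfl⟩
  let M : Type := {m : Fin N × ℕ+ →₀ ℕ // psWeight m = s}
  have hT : Fintype (TupleOfSize N s) := Fintype.ofFinite _
  let L : (M →₀ ℚ) →ₗ[ℚ] MvPolynomial (Fin N × ℕ+) ℚ :=
    Finsupp.linearCombination ℚ fun m : M => MvPolynomial.monomial m.1 (1 : ℚ)
  have hL : Function.Injective L := by
    have h1 : LinearIndependent ℚ fun m : M => MvPolynomial.monomial m.1 (1 : ℚ) := by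
      have := (MvPolynomial.basisMonomials (Fin N × ℕ+) ℚ).linearIndependent
      have h2 := this.comp (fun m : M => m.1) Subtype.val_injective
      simpa [Function.comp_def] using h2
    exact h1
  have hLcf : ∀ c d, d.degree ≠ s → cf d (L c) = 0 := by
    intro c d hd
    rw [Finsupp.linearCombination_apply, Finsupp.sum, map_sum]
    refine Finset.sum_eq_zero fun m _ => ?_
    rw [map_smul, cf_monomial_eq_zero (by rw [m.2]; exact hd), smul_zero]
  -- The map sends a combination of power-sum monomials of degree s to its coefficients at sorted
  -- exponents. It is injective because power sums are independent; counting dimensions makes it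
  -- bijective, and `m_λ` is the preimage of a basis vector.
  let ev : (M →₀ ℚ) →ₗ[ℚ] (TupleOfSize N s → ℚ) :=
    LinearMap.pi fun mu => (cf (expOf mu.1)).comp L
  have hev : Function.Injective ev := by
    rw [injective_iff_map_eq_zero]
    intro c hc
    apply hL
    rw [map_zero]
    refine eq_zero_of_cf_eq_zero _ fun d => ?_
    by_cases hd : d.degree = s
    · obtain ⟨mu, hmu⟩ := exists_rearranges d
      rw [hmu.cf_eq]
      exact congrFun hc ⟨mu, hmu.degree_eq ▸ hd⟩
    · exact hLcf c d hd
  have hfin : Module.Finite ℚ (M →₀ ℚ) := Module.Finite.of_injective ev hev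
  have hMfin : Finite M := Module.Finite.finite_basis (Finsupp.basisSingleOne (R := ℚ) (ι := M))
  have hMft : Fintype M := Fintype.ofFinite M
  -- Each tuple gives the product of power sums indexed by its parts, and distinct tuples give
  -- distinct products.
  have hcard : Fintype.card (TupleOfSize N s) ≤ Fintype.card M :=
    Fintype.card_le_of_injective
      (fun mu => (⟨powerSumExp mu.1, by rw [psWeight_powerSumExp, mu.2]⟩ : M))
      fun a b h => TupleOfSize.ext (powerSumExp_injective (congrArg Subtype.val h))
  have hrank : Module.finrank ℚ (M →₀ ℚ) = Module.finrank ℚ (TupleOfSize N s → ℚ) := by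
    apply le_antisymm
    · exact LinearMap.finrank_le_finrank_of_injective hev
    · rw [Module.finrank_fintype_fun_eq_card, Module.finrank_finsupp_self]
      exact hcard
  have hsurj : Function.Surjective ev :=
    (LinearMap.injective_iff_surjective_of_finrank_eq_finrank hrank).1 hev
  obtain ⟨c, hc⟩ := hsurj (Pi.single ⟨lam, hs⟩ 1)
  refine ⟨L c, fun d => ?_⟩
  obtain ⟨mu, hmu⟩ := exists_rearranges d
  by_cases hd : d.degree = s
  · rw [hmu.cf_eq]
    have h1 := congrFun hc ⟨mu, hmu.degree_eq ▸ hd⟩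
    refine h1.trans ?_
    rw [Pi.single_apply]
    congr 1
    apply propext
    constructor
    · intro h
      have : mu = lam := congrArg TupleOfSize.val h
      exact this ▸ hmu
    · intro h
      exact TupleOfSize.ext (hmu.eq h)
  · rw [hLcf c d hd, if_neg]
    intro h
    exact hd (h.degree_eq.trans hs)

/-- The function `m_λ` as a polynomial in the power sums, over a `ℚ`-algebra. -/
def mono (R : Type) [CommRing R] [Algebra ℚ R] (lam : PtnTuple N) :
    MvPolynomial (Fin N × ℕ+) R :=
  MvPolynomial.map (algebraMap ℚ R) (exists_monomialSym lam).choose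

variable {R : Type} [CommRing R] [Algebra ℚ R]

open Classical in
theorem cf_mono (lam : PtnTuple N) (d : Fin N × ℕ →₀ ℕ) :
    cf d (mono R lam) = if Rearranges d lam then 1 else 0 := by
  rw [mono, cf_map, (exists_monomialSym lam).choose_spec]
  split_ifs <;> simp

open Classical in
theorem cf_expOf_mono (lam mu : PtnTuple N) :
    cf (expOf mu) (mono R lam) = if mu = lam then 1 else 0 := by
  rw [cf_mono]
  congr 1
  exact propext Rearranges.expOf_iff

theorem map_mono {R' : Type} [CommRing R'] [Algebra ℚ R'] (φ : R →+* R') (lam : PtnTuple N) :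
    MvPolynomial.map φ (mono R lam) = mono R' lam := by
  rw [mono, mono, MvPolynomial.map_map]
  congr 1
  exact congrArg _ (RingHom.ext_rat _ _)

theorem eq_of_cf_expOf_eq {f g : MvPolynomial (Fin N × ℕ+) R}
    (h : ∀ mu, cf (expOf mu) f = cf (expOf mu) g) : f = g := by
  refine eq_of_cf_eq fun d => ?_
  obtain ⟨mu, hmu⟩ := exists_rearranges d
  rw [hmu.cf_eq, hmu.cf_eq, h]

theorem toVariables_mono {K : Type} [Field K] [CharZero K] (lam : PtnTuple N) :
    toVariables (mono K lam) = monomialSymTuple lam := by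
  ext d
  rw [coeff_monomialSymTuple, toVariables_eq_expand, ← cf_apply, cf_mono]

theorem toVariables_injective {K : Type} [Field K] [CharZero K] :
    Function.Injective (toVariables (N := N) (K := K)) := fun f g h => by
  refine eq_of_cf_eq fun d => ?_
  rw [cf_apply, cf_apply, ← toVariables_eq_expand, ← toVariables_eq_expand, h]

end MonomialBasis

/-! ### Splitting off a variable from a vertex operator. -/

section Kernel

open PowerSeries

/-- The exponential is (1 - τyz)/(1 - yz). In this form the proof only compares logarithmic
derivatives. -/
theorem formalExp_geometric {S : Type} [CommRing S] [Algebra ℚ S] (τ y : S) :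
    formalExp ℚ (posSeries fun n : ℕ+ => ((n : ℕ) : ℚ)⁻¹ • ((1 - τ ^ (n : ℕ)) * y ^ (n : ℕ))) =
      PowerSeries.mk fun m => if m = 0 then 1 else (1 - τ) * y ^ m := by
  refine eq_of_derivative_eq_mul (derivative_formalExp (constantCoeff_posSeries _)) ?_ ?_
  · ext n
    rw [coeff_derivative, coeff_mk, if_neg n.succ_ne_zero, coeff_mul,
      Finset.Nat.sum_antidiagonal_eq_sum_range_succ_mk, Finset.sum_range_succ]
    have h1 : ∀ k : ℕ, coeff k (derivative S (posSeries fun n : ℕ+ =>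
        ((n : ℕ) : ℚ)⁻¹ • ((1 - τ ^ (n : ℕ)) * y ^ (n : ℕ)))) =
        (1 - τ ^ (k + 1)) * y ^ (k + 1) := by
      intro k
      rw [coeff_derivative]
      have := coeff_posSeries (fun n : ℕ+ =>
        ((n : ℕ) : ℚ)⁻¹ • ((1 - τ ^ (n : ℕ)) * y ^ (n : ℕ))) k.succPNat
      rw [show ((k.succPNat : ℕ+) : ℕ) = k + 1 from rfl] at this
      rw [this]
      have h2 : ((k : S) + 1) = algebraMap ℚ S ((k + 1 : ℕ) : ℚ) := by simp
      rw [h2, mul_comm, ← Algebra.smul_def, smul_smul, mul_inv_cancel₀, one_smul]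
      positivity
    have h3 : ∀ k ∈ Finset.range n, coeff k (derivative S (posSeries fun n : ℕ+ =>
        ((n : ℕ) : ℚ)⁻¹ • ((1 - τ ^ (n : ℕ)) * y ^ (n : ℕ)))) *
        coeff (n - k) (PowerSeries.mk fun m => if m = 0 then 1 else (1 - τ) * y ^ m) =
        ((1 - τ) - (1 - τ) * τ * τ ^ k) * y ^ (n + 1) := by
      intro k hk
      rw [Finset.mem_range] at hk
      rw [h1, coeff_mk, if_neg (by omega), show n + 1 = (k + 1) + (n - k) by omega, pow_add y]
      ring
    rw [Finset.sum_congr rfl h3, h1, ← Finset.sum_mul, Finset.sum_sub_distrib, ← Finset.mul_sum]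
    have hg : (1 - τ) * ∑ k ∈ Finset.range n, τ ^ k = 1 - τ ^ n := mul_neg_geom_sum τ n
    have : (1 - τ) * τ * ∑ k ∈ Finset.range n, τ ^ k = τ * (1 - τ ^ n) := by rw [← hg]; ring
    rw [this]
    simp
    ring
  · rw [constantCoeff_formalExp, ← coeff_zero_eq_constantCoeff_apply, coeff_mk, if_pos rfl]

variable {N : ℕ} {R : Type} [CommRing R]

theorem shift_X_self (i : Fin N) (γ : ℕ+ → R) (n : ℕ+) :
    shift i γ (MvPolynomial.X (i, n)) = Polynomial.C (MvPolynomial.X (i, n)) +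
      Polynomial.C (MvPolynomial.C (γ n)) * Polynomial.X ^ (n : ℕ) := by
  simp [shift]

/-- The coefficient of `y^n` in `f[X^{(i)} + (q - 1) y]`. -/
abbrev remove (i : Fin N) (q : R) (n : ℕ) :
    MvPolynomial (Fin N × ℕ+) R →ₗ[R] MvPolynomial (Fin N × ℕ+) R :=
  lower i (fun m => q ^ (m : ℕ) - 1) n

/-- Adding y to X + (q - 1)y gives X + qy. -/
theorem sum_lower_remove (i : Fin N) (q : R) (n : ℕ) (f : MvPolynomial (Fin N × ℕ+) R) :
    ∑ x ∈ Finset.HasAntidiagonal.antidiagonal n, lower i 1 x.1 (remove i q x.2 f) =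
      q ^ n • lower i 1 n f := by
  simp only [remove]
  rw [← lower_scale, ← lower_add]
  congr 2
  funext m
  simp

/-- Solving `sum_lower_remove` for its first term expresses `remove` through `lower i 1`, whose
effect on monomials is known. -/
theorem remove_succ (i : Fin N) (q : R) (n : ℕ) (f : MvPolynomial (Fin N × ℕ+) R) :
    remove i q n f = q ^ n • lower i 1 n f -
      ∑ k ∈ Finset.range n, lower i 1 (k + 1) (remove i q (n - (k + 1)) f) := by
  rw [← sum_lower_remove, Finset.Nat.sum_antidiagonal_eq_sum_range_succ_mk,
    Finset.sum_range_succ', lower_zero]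
  simp

theorem exists_bound_lower (i : Fin N) (q : R) (f : MvPolynomial (Fin N × ℕ+) R) (k : ℕ) :
    ∃ M, k < M ∧ (∀ j, M ≤ j → remove i q j f = 0) ∧ ∀ j, M ≤ j → lower i 1 j f = 0 := by
  refine ⟨(shift i (fun m : ℕ+ => q ^ (m : ℕ) - 1) f).natDegree + 1 +
    ((shift i (1 : ℕ+ → R) f).natDegree + 1) + k, by omega, fun j hj => ?_, fun j hj => ?_⟩
  · exact lower_eq_zero_of_natDegree_lt i _ f (by omega)
  · exact lower_eq_zero_of_natDegree_lt i _ f (by omega)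

variable [Algebra ℚ R]

/-- `exp (∑ (1 - τ^n)/n z^n p^{(i)}_n)`. -/
def kernelSeries (i : Fin N) (τ : R) : PowerSeries (MvPolynomial (Fin N × ℕ+) R) :=
  formalExp ℚ (posSeries fun n : ℕ+ =>
    ((n : ℕ) : ℚ)⁻¹ • (MvPolynomial.C (1 - τ ^ (n : ℕ)) * MvPolynomial.X (i, n)))

/-- The coefficients of `kernelSeries`, extended by zero to negative indices. -/
def kernel (i : Fin N) (τ : R) (m : ℤ) : MvPolynomial (Fin N × ℕ+) R :=
  if m < 0 then 0 else coeff m.toNat (kernelSeries i τ)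

theorem kernel_natCast (i : Fin N) (τ : R) (m : ℕ) :
    kernel i τ m = coeff m (kernelSeries i τ) := by
  rw [kernel, if_neg (by omega), Int.toNat_natCast]

theorem kernel_of_neg (i : Fin N) (τ : R) {m : ℤ} (h : m < 0) : kernel i τ m = 0 := if_pos h

theorem kernel_zero (i : Fin N) (τ : R) : kernel i τ 0 = 1 := by
  have := kernel_natCast i τ 0
  rw [Nat.cast_zero] at this
  rw [this, coeff_zero_eq_constantCoeff_apply, kernelSeries, constantCoeff_formalExp]

/-- Under p_n ↦ p_n + yⁿ the kernel series is multiplied by (1 - τyz)/(1 - yz), all of whose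
nonconstant coefficients are (1 - τ)y^m. -/
theorem lower_kernel (i : Fin N) (τ : R) (j : ℕ) (m : ℤ) :
    lower i 1 j (kernel i τ m) =
      if j = 0 then kernel i τ m else MvPolynomial.C (1 - τ) * kernel i τ (m - j) := by
  rcases lt_or_ge m 0 with hm | hm
  · rw [kernel_of_neg i τ hm, map_zero, kernel_of_neg i τ (show m - j < 0 by omega)]
    simp
  lift m to ℕ using hm
  let σ : MvPolynomial (Fin N × ℕ+) R →+* Polynomial (MvPolynomial (Fin N × ℕ+) R) :=
    (shift i (1 : ℕ+ → R)).toRingHom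
  have h1 : PowerSeries.map σ (kernelSeries i τ) =
      PowerSeries.map (Polynomial.C : MvPolynomial (Fin N × ℕ+) R →+* _) (kernelSeries i τ) *
      PowerSeries.mk fun m => if m = 0 then 1 else
        (1 - Polynomial.C (MvPolynomial.C τ)) * Polynomial.X ^ m := by
    rw [← formalExp_geometric, kernelSeries, formalExp_map, formalExp_map, posSeries_map,
      posSeries_map, ← formalExp_add (constantCoeff_posSeries _) (constantCoeff_posSeries _),
      posSeries_add]
    congr 2
    funext n
    rw [Pi.add_apply, map_rat_smul, map_rat_smul, ← smul_add]
    congr 1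
    rw [map_mul, map_mul]
    have h2 : σ (MvPolynomial.C (1 - τ ^ (n : ℕ))) =
        Polynomial.C (MvPolynomial.C (1 - τ ^ (n : ℕ))) := (shift i (1 : ℕ+ → R)).commutes _
    have h3 : σ (MvPolynomial.X (i, n)) = _ := shift_X_self i (1 : ℕ+ → R) n
    rw [h2, h3]
    simp only [Pi.one_apply, map_sub, map_one, map_pow]
    ring
  have h2 := congrArg (coeff m) h1
  rw [coeff_map, coeff_mul] at h2
  have h3 : lower i 1 j (kernel i τ m) = (σ (coeff m (kernelSeries i τ))).coeff j := by rw [kernel_natCast]; rfl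
  rw [h3, h2, Polynomial.finsetSum_coeff]
  have h4 : ∀ x ∈ Finset.HasAntidiagonal.antidiagonal m, (coeff x.1 (PowerSeries.map
      (Polynomial.C : MvPolynomial (Fin N × ℕ+) R →+* _) (kernelSeries i τ)) *
      coeff x.2 (PowerSeries.mk fun m => if m = 0 then 1 else
        (1 - Polynomial.C (MvPolynomial.C τ)) * Polynomial.X ^ m)).coeff j =
      if x.2 = j then (if j = 0 then kernel i τ m else
        MvPolynomial.C (1 - τ) * kernel i τ ((m : ℤ) - j)) else 0 := by
    intro x hx
    rw [Finset.HasAntidiagonal.mem_antidiagonal] at hx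
    have h5 : kernel i τ ((m : ℤ) - x.2) = coeff x.1 (kernelSeries i τ) := by
      rw [← kernel_natCast]; congr 1; omega
    rw [coeff_map, coeff_mk, Polynomial.coeff_C_mul, ← h5]
    rcases Nat.eq_zero_or_pos x.2 with h0 | h0
    · rw [if_pos h0, Polynomial.coeff_one, h0]
      by_cases hj : j = 0
      · simp [hj]
      · simp [hj, Ne.symm hj]
    · rw [if_neg (by omega)]
      have : (1 - Polynomial.C (MvPolynomial.C τ)) * Polynomial.X ^ x.2 =
          Polynomial.C (MvPolynomial.C (1 - τ) : MvPolynomial (Fin N × ℕ+) R) *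
            Polynomial.X ^ x.2 := by simp
      rw [this, Polynomial.coeff_C_mul, Polynomial.coeff_X_pow]
      by_cases hj : x.2 = j
      · rw [if_pos hj.symm, if_pos hj, if_neg (by omega), hj]; ring
      · rw [if_neg (Ne.symm hj), if_neg hj]; simp
  rw [Finset.sum_congr rfl h4]
  by_cases hjm : j ≤ m
  · rw [Finset.sum_eq_single (m - j, j)]
    · rw [if_pos rfl]
    · rintro ⟨a, b⟩ hx hne
      rw [Finset.HasAntidiagonal.mem_antidiagonal] at hx
      rw [if_neg]
      rintro rfl
      apply hne
      simp only at hx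
      rw [← hx]; simp
    · intro h
      exact absurd (Finset.HasAntidiagonal.mem_antidiagonal.2 (by simp; omega)) h
  · rw [Finset.sum_eq_zero, if_neg (by omega), kernel_of_neg i τ (by omega), mul_zero]
    intro x hx
    rw [Finset.HasAntidiagonal.mem_antidiagonal] at hx
    rw [if_neg (by omega)]

/-- The operator `[z^{-n}] exp (∑ (1 - τ^m)/m z^m p_m) exp (∑ (q^m - 1) z^{-m} ∂/∂p_m)`. -/
def vertex (i : Fin N) (q τ : R) (n : ℤ) (f : MvPolynomial (Fin N × ℕ+) R) :
    MvPolynomial (Fin N × ℕ+) R :=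
  ∑ j ∈ Finset.range ((shift i (fun m : ℕ+ => q ^ (m : ℕ) - 1) f).natDegree + 1),
    kernel i τ (j - n) * remove i q j f

theorem vertex_eq (i : Fin N) (q τ : R) (n : ℤ) {f : MvPolynomial (Fin N × ℕ+) R} {M : ℕ}
    (hM : ∀ j, M ≤ j → remove i q j f = 0) :
    vertex i q τ n f = ∑ j ∈ Finset.range M, kernel i τ (j - n) * remove i q j f := by
  rw [vertex]
  set D := (shift i (fun m : ℕ+ => q ^ (m : ℕ) - 1) f).natDegree + 1
  have hD : ∀ j, D ≤ j → remove i q j f = 0 := fun j hj =>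
    lower_eq_zero_of_natDegree_lt i _ f (by omega)
  rcases le_total D M with h | h
  · refine Finset.sum_subset (Finset.range_mono h) fun j _ hj => ?_
    rw [hD j (by simpa using hj), mul_zero]
  · refine (Finset.sum_subset (Finset.range_mono h) fun j _ hj => ?_).symm
    rw [hM j (by simpa using hj), mul_zero]

theorem remove_lower_eq_zero {i : Fin N} {q : R} {f : MvPolynomial (Fin N × ℕ+) R} {M : ℕ}
    (hM : ∀ j, M ≤ j → remove i q j f = 0) (b : ℕ) :
    ∀ j, M ≤ j → remove i q j (lower i 1 b f) = 0 := fun j hj => by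
  rw [remove, lower_comm, ← remove, hM j hj, map_zero]

/-- The shift is multiplicative and commutes with `remove`, so only the kernel produces extra terms,
and `lower_kernel` gives them. -/
theorem lower_vertex (i : Fin N) (q τ : R) (n : ℤ) (k : ℕ) (f : MvPolynomial (Fin N × ℕ+) R) :
    lower i 1 k (vertex i q τ n f) = vertex i q τ n (lower i 1 k f) +
      (1 - τ) • ∑ b ∈ Finset.range k, vertex i q τ (n + k - b) (lower i 1 b f) := by
  obtain ⟨M, -, hB, -⟩ := exists_bound_lower i q f 0
  have hBU := fun b => remove_lower_eq_zero hB b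
  rw [vertex_eq i q τ n hB, vertex_eq i q τ n (hBU k), map_sum]
  have h1 : ∀ b : ℕ, vertex i q τ (n + k - b) (lower i 1 b f) =
      ∑ j ∈ Finset.range M, kernel i τ (j - (n + k - b)) * remove i q j (lower i 1 b f) :=
    fun b => vertex_eq i q τ _ (hBU b)
  simp only [h1]
  rw [Finset.sum_comm, Finset.smul_sum, ← Finset.sum_add_distrib]
  refine Finset.sum_congr rfl fun j _ => ?_
  rw [lower_mul, Finset.Nat.sum_antidiagonal_eq_sum_range_succ_mk, ← Finset.sum_range_reflect,
    Finset.sum_range_succ, add_comm]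
  have h2 : ∀ b, lower i 1 b (remove i q j f) = remove i q j (lower i 1 b f) := fun b =>
    lower_comm i i _ _ _ _ _
  simp only [h2, lower_kernel]
  congr 1
  · simp
  · rw [Finset.smul_sum]
    refine Finset.sum_congr rfl fun b hb => ?_
    rw [Finset.mem_range] at hb
    rw [if_neg (by omega), MvPolynomial.C_mul', smul_mul_assoc]
    rw [show k - (k.succ - 1 - b) = b by omega,
      show (j : ℤ) - n - (k.succ - 1 - b : ℕ) = j - (n + k - b) by omega]

/-- Summed over all b, adding y meets the annihilation part, which subtracts it and adds qy; by
`sum_lower_remove` only the shift by qy remains. -/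
theorem sum_vertex_lower (i : Fin N) (q τ : R) (m : ℤ) {f : MvPolynomial (Fin N × ℕ+) R} {M : ℕ}
    (hB : ∀ j, M ≤ j → remove i q j f = 0) (hU : ∀ j, M ≤ j → lower i 1 j f = 0) :
    ∑ b ∈ Finset.range M, vertex i q τ (m - b) (lower i 1 b f) =
      ∑ s ∈ Finset.range (2 * M), q ^ s • (kernel i τ (s - m) * lower i 1 s f) := by
  have hBU := fun b => remove_lower_eq_zero hB b
  have h1 : ∀ b : ℕ, vertex i q τ (m - b) (lower i 1 b f) =
      ∑ j ∈ Finset.range M, kernel i τ (j - (m - b)) * remove i q j (lower i 1 b f) :=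
    fun b => vertex_eq i q τ _ (hBU b)
  simp only [h1]
  -- Terms are grouped by the total power s of y. It is below 2M since both indices are below M.
  rw [← Finset.sum_product', ← Finset.sum_fiberwise_of_maps_to (t := Finset.range (2 * M))
    (g := fun x : ℕ × ℕ => x.1 + x.2)]
  · refine Finset.sum_congr rfl fun s _ => ?_
    rw [← mul_smul_comm, ← sum_lower_remove, Finset.mul_sum]
    have h2 : ∀ x ∈ (Finset.range M ×ˢ Finset.range M).filter (fun x => x.1 + x.2 = s),
        kernel i τ (x.2 - (m - x.1)) * remove i q x.2 (lower i 1 x.1 f) =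
        kernel i τ (s - m) * lower i 1 x.1 (remove i q x.2 f) := by
      intro x hx
      have := (Finset.mem_filter.1 hx).2
      rw [remove, lower_comm]
      congr 2
      omega
    rw [Finset.sum_congr rfl h2]
    refine Finset.sum_subset (fun x hx => ?_) fun x hx hx' => ?_
    · rw [Finset.HasAntidiagonal.mem_antidiagonal]
      exact (Finset.mem_filter.1 hx).2
    · rw [Finset.HasAntidiagonal.mem_antidiagonal] at hx
      simp only [Finset.mem_filter, Finset.mem_product, Finset.mem_range, hx, and_true] at hx'
      rcases not_and_or.1 hx' with h | h
      · rw [lower_comm, hU _ (not_lt.1 h), map_zero, mul_zero]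
      · rw [hB _ (not_lt.1 h), map_zero, mul_zero]
  · intro x hx
    simp only [Finset.mem_product, Finset.mem_range] at hx ⊢
    omega

/-- The commutation relation between splitting off a variable and `vertex`. -/
theorem lower_vertex_eq (i : Fin N) (q τ : R) (n : ℤ) (k : ℕ) {f : MvPolynomial (Fin N × ℕ+) R}
    {M : ℕ} (hk : k ≤ M) (hB : ∀ j, M ≤ j → remove i q j f = 0)
    (hU : ∀ j, M ≤ j → lower i 1 j f = 0) :
    lower i 1 k (vertex i q τ n f) = vertex i q τ n (lower i 1 k f) +
      (1 - τ) • (∑ s ∈ Finset.range (2 * M), q ^ s •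
          (kernel i τ (s - (n + k)) * lower i 1 s f) -
        ∑ b ∈ Finset.Ico k M, vertex i q τ (n + k - b) (lower i 1 b f)) := by
  -- The sum over b < k in `lower_vertex` is replaced by the full sum minus the sum over b ≥ k. The
  -- terms b < k involve components of f of too large a weight, whereas the full sum has a closed
  -- form and the terms b ≥ k are harmless.
  rw [lower_vertex, ← sum_vertex_lower i q τ (n + k) hB hU,
    ← Finset.sum_range_add_sum_Ico _ hk, add_sub_cancel_right]

end Kernel

/-! ### Weight filtrations, dominance and leading coefficients. -/

section Filtration

variable {N : ℕ} {R : Type} [CommRing R]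

/-- The weight of a monomial `x^d`. -/
def wt (w : Fin N × ℕ → ℤ) : (Fin N × ℕ →₀ ℕ) →+ ℤ := Finsupp.weight w

theorem wt_single (w : Fin N × ℕ → ℤ) (x : Fin N × ℕ) (n : ℕ) :
    wt w (Finsupp.single x n) = n * w x := by
  rw [wt, Finsupp.weight_single, nsmul_eq_mul]

theorem wt_consExp (w : Fin N × ℕ → ℤ) (i : Fin N) (k : ℕ) (d : Fin N × ℕ →₀ ℕ) :
    wt w (consExp i k d) = wt (w ∘ bump i) d + k * w (i, 0) := by
  rw [consExp, map_add, wt_single]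
  congr 1
  simp only [wt, Finsupp.weight_apply]
  rw [Finsupp.sum_mapDomain_index (by simp) (by intros; rw [add_smul])]
  rfl

/-- The symmetric functions all of whose monomials have weight at most `D`. -/
def fil (R : Type) [CommRing R] (w : Fin N × ℕ → ℤ) (D : ℤ) :
    Submodule R (MvPolynomial (Fin N × ℕ+) R) where
  carrier := {f | ∀ d, D < wt w d → cf d f = 0}
  add_mem' := fun hf hg d hd => by rw [map_add, hf d hd, hg d hd, add_zero]
  zero_mem' := fun d _ => map_zero _
  smul_mem' := fun c f hf d hd => by rw [map_smul, hf d hd, smul_zero]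

theorem fil_mono {w : Fin N × ℕ → ℤ} {D D' : ℤ} (h : D ≤ D') : fil R w D ≤ fil R w D' :=
  fun _ hf d hd => hf d (h.trans_lt hd)

theorem mul_mem_fil {w : Fin N × ℕ → ℤ} {D D' : ℤ} {f g : MvPolynomial (Fin N × ℕ+) R}
    (hf : f ∈ fil R w D) (hg : g ∈ fil R w D') : f * g ∈ fil R w (D + D') := by
  intro d hd
  rw [cf_mul]
  refine Finset.sum_eq_zero fun x hx => ?_
  rw [Finset.HasAntidiagonal.mem_antidiagonal] at hx
  rw [← hx, map_add] at hd
  rcases lt_or_ge D (wt w x.1) with h | h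
  · rw [hf _ h, zero_mul]
  · rw [hg _ (by omega), mul_zero]

theorem one_mem_fil (w : Fin N × ℕ → ℤ) : (1 : MvPolynomial (Fin N × ℕ+) R) ∈ fil R w 0 := by
  intro d hd
  rw [← MvPolynomial.C_1, cf_C, if_neg]
  rintro rfl
  simp at hd

theorem X_mem_fil {w : Fin N × ℕ → ℤ} {D : ℤ} {v : Fin N × ℕ+}
    (h : ∀ k, ((v.2 : ℕ) : ℤ) * w (v.1, k) ≤ D) :
    (MvPolynomial.X v : MvPolynomial (Fin N × ℕ+) R) ∈ fil R w D := by
  classical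
  intro d hd
  rw [cf_X, if_neg]
  rintro ⟨k, rfl⟩
  rw [wt_single] at hd
  exact absurd (h k) (not_le.2 hd)

/-- A monomial whose first variable has exponent k is a monomial of `lower i 1 k f`, with the
weights moved by one place. This is what drives the inductions on the number of weighted variables.
-/
theorem mem_fil_iff_lower {w : Fin N × ℕ → ℤ} {D : ℤ} (i : Fin N)
    {f : MvPolynomial (Fin N × ℕ+) R} :
    f ∈ fil R w D ↔ ∀ k : ℕ, lower i 1 k f ∈ fil R (w ∘ bump i) (D - k * w (i, 0)) := by
  constructor
  · intro hf k d hd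
    rw [← cf_consExp]
    refine hf _ ?_
    rw [wt_consExp]; linarith
  · intro h d hd
    rw [← consExp_tailExp i d, cf_consExp]
    refine h _ _ ?_
    rw [← consExp_tailExp i d, wt_consExp] at hd
    linarith

section Constant

variable {w : Fin N × ℕ → ℤ} {i : Fin N} {ω : ℤ}

theorem comp_bump_of_const (h : ∀ k, w (i, k) = ω) : w ∘ bump i = w := by
  funext ⟨j, k⟩
  simp only [Function.comp, bump]
  split_ifs with hj
  · subst hj; rw [h, h]
  · rfl

theorem lower_mem_fil (h : ∀ k, w (i, k) = ω) {D : ℤ} {f : MvPolynomial (Fin N × ℕ+) R}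
    (hf : f ∈ fil R w D) (k : ℕ) : lower i 1 k f ∈ fil R w (D - ω * k) := by
  have := (mem_fil_iff_lower i).1 hf k
  rwa [comp_bump_of_const h, h, mul_comm] at this

/-- Induction through `remove_succ`: each y taken from a family of constant weight ω costs ω,
whichever way it is taken. -/
theorem remove_mem_fil (h : ∀ k, w (i, k) = ω) (q : R) {D : ℤ}
    {f : MvPolynomial (Fin N × ℕ+) R} (hf : f ∈ fil R w D) (n : ℕ) :
    remove i q n f ∈ fil R w (D - ω * n) := by
  induction n using Nat.strong_induction_on with
  | _ n ih =>
    rw [remove_succ]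
    refine Submodule.sub_mem _ (Submodule.smul_mem _ _ (lower_mem_fil h hf n))
      (Submodule.sum_mem _ fun k hk => ?_)
    rw [Finset.mem_range] at hk
    have := lower_mem_fil h (ih (n - (k + 1)) (by omega)) (k + 1)
    rw [Nat.cast_sub hk] at this
    refine fil_mono (le_of_eq ?_) this
    push_cast; ring

end Constant

variable [Algebra ℚ R]

/-- Each summand of the recursion for the exponential has the weight claimed, and n + 1 can be
cancelled. -/
theorem coeff_formalExp_mem_fil {w : Fin N × ℕ → ℤ} {ω : ℤ}
    {c : ℕ+ → MvPolynomial (Fin N × ℕ+) R} (hc : ∀ n : ℕ+, c n ∈ fil R w (ω * (n : ℕ))) (m : ℕ) :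
    PowerSeries.coeff m (formalExp ℚ (posSeries c)) ∈ fil R w (ω * m) := by
  induction m using Nat.strong_induction_on with
  | _ m ih =>
    rcases m with _ | m
    · rw [PowerSeries.coeff_zero_eq_constantCoeff_apply, constantCoeff_formalExp]
      simpa using one_mem_fil w
    intro d hd
    have h1 := congrArg (cf d) (coeff_succ_formalExp c m)
    have h2 : ∀ x : MvPolynomial (Fin N × ℕ+) R,
        cf d (((m : MvPolynomial (Fin N × ℕ+) R) + 1) * x) = ((m : R) + 1) • cf d x := by
      intro x
      rw [← map_smul]
      congr 1
      rw [MvPolynomial.smul_eq_C_mul]; simp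
    rw [h2] at h1
    refine succ_smul_cancel (R := R) (n := m) ?_
    rw [h1, smul_zero, map_sum]
    refine Finset.sum_eq_zero fun k hk => ?_
    rw [Finset.mem_range] at hk
    rw [mul_assoc]
    have h3 := mul_mem_fil (hc k.succPNat) (ih (m - k) (by omega))
    have h4 : ((k : MvPolynomial (Fin N × ℕ+) R) + 1) *
        (c k.succPNat * PowerSeries.coeff (m - k) (formalExp ℚ (posSeries c))) =
        ((k : R) + 1) •
        (c k.succPNat * PowerSeries.coeff (m - k) (formalExp ℚ (posSeries c))) := by
      rw [MvPolynomial.smul_eq_C_mul]; simp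
    rw [h4, map_smul, h3 d, smul_zero]
    refine lt_of_le_of_lt (le_of_eq ?_) hd
    rw [show ((k.succPNat : ℕ+) : ℕ) = k + 1 from rfl, Nat.cast_sub (by omega)]
    push_cast; ring

theorem kernel_mem_fil {w : Fin N × ℕ → ℤ} {i : Fin N} {ω : ℤ} (h : ∀ k, w (i, k) ≤ ω) (τ : R)
    (m : ℤ) : kernel i τ m ∈ fil R w (ω * m) := by
  rcases lt_or_ge m 0 with hm | hm
  · rw [kernel_of_neg i τ hm]; exact Submodule.zero_mem _
  lift m to ℕ using hm
  rw [kernel_natCast]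
  refine coeff_formalExp_mem_fil (fun n => ?_) m
  have h1 : ((n : ℕ) : ℚ)⁻¹ • (MvPolynomial.C (1 - τ ^ (n : ℕ)) *
      (MvPolynomial.X (i, n) : MvPolynomial (Fin N × ℕ+) R)) =
      (((n : ℕ) : ℚ)⁻¹ • (1 - τ ^ (n : ℕ))) • MvPolynomial.X (i, n) := by
    rw [MvPolynomial.C_mul', smul_assoc]
  rw [h1]
  refine Submodule.smul_mem _ _ (X_mem_fil fun k => ?_)
  rw [mul_comm]
  exact mul_le_mul_of_nonneg_right (h k) (by positivity)

theorem vertex_mem_fil_of_const {w : Fin N × ℕ → ℤ} {i : Fin N} {ω : ℤ} (h : ∀ k, w (i, k) = ω)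
    (q τ : R) (n : ℤ) {D : ℤ} {f : MvPolynomial (Fin N × ℕ+) R} (hf : f ∈ fil R w D) :
    vertex i q τ n f ∈ fil R w (D - ω * n) := by
  refine Submodule.sum_mem _ fun j _ => ?_
  refine fil_mono (le_of_eq ?_) (mul_mem_fil (kernel_mem_fil (fun k => (h k).le) τ (j - n))
    (remove_mem_fil h q hf j))
  ring

/-- Weight one on the first `r` variables of the family `i`, weight `w₀ j` on the other families. -/
def prefixWeight (w₀ : Fin N → ℤ) (i : Fin N) (r : ℕ) (x : Fin N × ℕ) : ℤ :=
  if x.1 = i then (if x.2 < r then 1 else 0) else w₀ x.1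

theorem prefixWeight_bump (w₀ : Fin N → ℤ) (i : Fin N) (r : ℕ) :
    prefixWeight w₀ i (r + 1) ∘ bump i = prefixWeight w₀ i r := by
  funext ⟨j, k⟩
  simp only [Function.comp, bump, prefixWeight]
  by_cases h : j = i <;> simp [h]

/-- Induction on r by splitting off the first variable. In `lower_vertex_eq` the kernel terms have
weight at most D - n - k, and the terms b ≥ k have weight at most D - b + max(0, b - n - k); both
are at most D - k + max(0, -n). With r = 0 the family has weight zero and only the creation part
could matter. -/
theorem vertex_mem_fil (w₀ : Fin N → ℤ) (i : Fin N) (r : ℕ) (q τ : R) (n D : ℤ)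
    {f : MvPolynomial (Fin N × ℕ+) R} (hf : f ∈ fil R (prefixWeight w₀ i r) D) :
    vertex i q τ n f ∈ fil R (prefixWeight w₀ i r) (D + max 0 (-n)) := by
  induction r generalizing n D f with
  | zero =>
    have h := vertex_mem_fil_of_const (i := i) (ω := 0)
      (fun k => by simp [prefixWeight]) q τ n hf
    refine fil_mono ?_ h
    have := le_max_left 0 (-n)
    linarith
  | succ r ih =>
    have hw0 : prefixWeight w₀ i (r + 1) (i, 0) = 1 := by simp [prefixWeight]
    have hU : ∀ k : ℕ, lower i 1 k f ∈ fil R (prefixWeight w₀ i r) (D - k) := fun k => by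
      have := (mem_fil_iff_lower i).1 hf k
      rwa [prefixWeight_bump, hw0, mul_one] at this
    rw [mem_fil_iff_lower i]
    intro k
    rw [prefixWeight_bump, hw0, mul_one]
    obtain ⟨M, hM, hB, hUz⟩ := exists_bound_lower i q f k
    rw [lower_vertex_eq i q τ n k hM.le hB hUz]
    refine Submodule.add_mem _ ?_ (Submodule.smul_mem _ _ (Submodule.sub_mem _
      (Submodule.sum_mem _ fun s _ => Submodule.smul_mem _ _ ?_)
      (Submodule.sum_mem _ fun b hb => ?_)))
    · exact fil_mono (by linarith) (ih n (D - k) (hU k))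
    · have h1 : kernel i τ ((s : ℤ) - (n + k)) ∈
          fil R (prefixWeight w₀ i r) (1 * ((s : ℤ) - (n + k))) :=
        kernel_mem_fil (fun k => by simp only [prefixWeight]; simp; split_ifs <;> simp) τ _
      refine fil_mono ?_ (mul_mem_fil h1 (hU s))
      have := le_max_right 0 (-n)
      linarith
    · rw [Finset.mem_Ico] at hb
      have h1 := ih (n + k - b) (D - b) (hU b)
      refine fil_mono ?_ h1
      have h2 : max 0 (-(n + k - (b : ℤ))) ≤ max 0 (-n) + (b - k) := by
        have h3 : (k : ℤ) ≤ b := by exact_mod_cast hb.1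
        have := le_max_left 0 (-n)
        have := le_max_right 0 (-n)
        apply max_le <;> linarith
      linarith

/-- The action of `vertex` with `n = 0` on leading monomials. -/
theorem cf_vertex_zero (i : Fin N) (q τ : R) (n : ℕ) (d : Fin N × ℕ →₀ ℕ)
    (hd : ∀ k, n ≤ k → d (i, k) = 0) (f : MvPolynomial (Fin N × ℕ+) R)
    (hf : ∀ e, cf e f ≠ 0 →
      ∀ r, ∑ k ∈ Finset.range r, e (i, k) ≤ ∑ k ∈ Finset.range r, d (i, k)) :
    cf d (vertex i q τ 0 f) =
      (τ ^ n + (1 - τ) * ∑ k ∈ Finset.range n, τ ^ k * q ^ d (i, k)) * cf d f := by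
  -- No monomial of f has a first exponent beyond that of d, by the dominance hypothesis for r = 1.
  have hvan : ∀ j, d (i, 0) < j → lower i 1 j f = 0 := by
    intro j hj
    refine eq_zero_of_cf_eq_zero _ fun e => ?_
    rw [← cf_consExp]
    by_contra hc
    have := hf _ hc 1
    simp only [Finset.sum_range_one, consExp_zero] at this
    omega
  induction n generalizing d f with
  | zero =>
    have hB : ∀ j, 0 < j → remove i q j f = 0 := by
      intro j
      induction j using Nat.strong_induction_on with
      | _ j ih =>
        intro hj
        rw [remove_succ, hvan j (by rw [hd 0 le_rfl]; exact hj), smul_zero, zero_sub, neg_eq_zero]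
        refine Finset.sum_eq_zero fun k _ => ?_
        rw [remove, lower_comm, hvan (k + 1) (by rw [hd 0 le_rfl]; omega), map_zero]
    rw [vertex_eq i q τ 0 (M := 1) (fun j hj => hB j (by omega))]
    simp [kernel_zero, remove, lower_zero]
  | succ n ih =>
    set k := d (i, 0) with hk
    obtain ⟨M, hM, hB, hUz⟩ := exists_bound_lower i q f k
    have hd' : d = consExp i k (tailExp i d) := (consExp_tailExp i d).symm
    have h1 : cf d (vertex i q τ 0 f) = cf (tailExp i d) (lower i 1 k (vertex i q τ 0 f)) := by
      rw [← cf_consExp, ← hd']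
    have h2 : cf d f = cf (tailExp i d) (lower i 1 k f) := by rw [← cf_consExp, ← hd']
    -- For s < k the kernel has negative index, and for s > k nothing can be split off.
    have e1 : ∑ s ∈ Finset.range (2 * M), q ^ s • (kernel i τ (s - (0 + k)) * lower i 1 s f) =
        q ^ k • lower i 1 k f := by
      rw [Finset.sum_eq_single k]
      · rw [zero_add, sub_self, kernel_zero, one_mul]
      · intro s _ hs
        rcases lt_or_gt_of_ne hs with h | h
        · rw [kernel_of_neg i τ (by omega), zero_mul, smul_zero]
        · rw [hvan s h, mul_zero, smul_zero]
      · intro h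
        rw [Finset.mem_range] at h
        omega
    -- Again only b = k survives. With T the zero mode and f_k what is left of f, the relation
    -- reads: T f yields τ·T f_k + (1 - τ)q^k f_k. Iteration gives the geometric weights τ^k of the
    -- eigenvalue.
    have e2 : ∑ b ∈ Finset.Ico k M, vertex i q τ (0 + k - b) (lower i 1 b f) =
        vertex i q τ 0 (lower i 1 k f) := by
      rw [Finset.sum_eq_single k]
      · simp
      · intro b hb hne
        rw [Finset.mem_Ico] at hb
        rw [hvan b (by omega)]
        simp [vertex]
      · intro h
        rw [Finset.mem_Ico] at h
        omega
    have hf' : ∀ e, cf e (lower i 1 k f) ≠ 0 → ∀ r, ∑ k ∈ Finset.range r, e (i, k) ≤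
        ∑ k ∈ Finset.range r, tailExp i d (i, k) := by
      intro e he r
      rw [← cf_consExp] at he
      have := hf _ he (r + 1)
      rw [Finset.sum_range_succ', Finset.sum_range_succ'] at this
      simp only [consExp_succ, consExp_zero] at this
      simp only [tailExp_self]
      omega
    have h3 := ih (tailExp i d) (fun k hk => by rw [tailExp_self]; exact hd _ (by omega))
      (lower i 1 k f) hf' (fun j hj => by
        refine eq_zero_of_cf_eq_zero _ fun e => ?_
        rw [← cf_consExp]
        by_contra hc
        have := hf' _ hc 1
        simp only [Finset.sum_range_one, consExp_zero] at this
        omega)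
    rw [h1, lower_vertex_eq i q τ 0 k hM.le hB hUz, e1, e2, map_add, map_smul, map_sub, map_smul,
      h3, h2, Finset.sum_range_succ']
    simp only [tailExp_self, smul_eq_mul, pow_succ, pow_zero, one_mul]
    have h4 : ∑ k ∈ Finset.range n, τ ^ k * τ * q ^ d (i, k + 1) =
        τ * ∑ k ∈ Finset.range n, τ ^ k * q ^ d (i, k + 1) := by
      rw [Finset.mul_sum]
      exact Finset.sum_congr rfl fun _ _ => by ring
    rw [h4]
    ring

end Filtration

/-! ### The operator X₀ over a commutative ℚ-algebra. -/

section ZeroMode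

open PowerSeries

variable {N : ℕ} {R : Type} [CommRing R]

/-- The coefficient of `z^0` in `A(z) exp (∑ γ_n z^{-n} ∂/∂p^{(i)}_n)`. -/
def zeroMode (i : Fin N) (A : PowerSeries (MvPolynomial (Fin N × ℕ+) R)) (γ : ℕ+ → R)
    (f : MvPolynomial (Fin N × ℕ+) R) : MvPolynomial (Fin N × ℕ+) R :=
  ∑ n ∈ Finset.range ((shift i γ f).natDegree + 1), coeff n A * lower i γ n f

theorem zeroMode_eq (i : Fin N) (A : PowerSeries (MvPolynomial (Fin N × ℕ+) R)) (γ : ℕ+ → R)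
    {f : MvPolynomial (Fin N × ℕ+) R} {M : ℕ} (hM : ∀ j, M ≤ j → lower i γ j f = 0) :
    zeroMode i A γ f = ∑ n ∈ Finset.range M, coeff n A * lower i γ n f := by
  rw [zeroMode]
  set D := (shift i γ f).natDegree + 1
  have hD : ∀ j, D ≤ j → lower i γ j f = 0 := fun j hj =>
    lower_eq_zero_of_natDegree_lt i _ f (by omega)
  rcases le_total D M with h | h
  · refine Finset.sum_subset (Finset.range_mono h) fun j _ hj => ?_
    rw [hD j (by simpa using hj), mul_zero]
  · refine (Finset.sum_subset (Finset.range_mono h) fun j _ hj => ?_).symm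
    rw [hM j (by simpa using hj), mul_zero]

theorem zeroMode_map {R' : Type} [CommRing R'] (φ : R →+* R') (i : Fin N)
    (A : PowerSeries (MvPolynomial (Fin N × ℕ+) R)) (γ : ℕ+ → R)
    (f : MvPolynomial (Fin N × ℕ+) R) :
    MvPolynomial.map φ (zeroMode i A γ f) =
      zeroMode i (PowerSeries.map (MvPolynomial.map φ) A) (fun n => φ (γ n))
        (MvPolynomial.map φ f) := by
  rw [zeroMode_eq i _ (fun n => φ (γ n)) (M := (shift i γ f).natDegree + 1), zeroMode, map_sum]
  · refine Finset.sum_congr rfl fun n _ => ?_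
    rw [map_mul, lower_map, coeff_map]
  · intro j hj
    rw [← lower_map, lower_eq_zero_of_natDegree_lt i _ f (by omega), map_zero]

variable [Algebra ℚ R]

/-- The coefficient of `z^n p^{(k)}_n` in the exponent of the creation part of `Λ̃_i(z)`, where
`τ = 1/t` and `s = (t/q)^{1/4}`. -/
def creationCoeff (τ s : R) (i k : Fin N) (n : ℕ+) : R :=
  ((n : ℕ) : ℚ)⁻¹ • ((1 - τ ^ (n : ℕ)) *
    if k < i then (1 - s ^ (4 * (n : ℕ))) * s ^ (2 * (k : ℕ) * n)
    else if k = i then s ^ (2 * (i : ℕ) * n) else 0)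

/-- The creation part of `Λ̃_i(z)`. -/
def creation (τ s : R) (i : Fin N) : PowerSeries (MvPolynomial (Fin N × ℕ+) R) :=
  formalExp ℚ (posSeries fun n : ℕ+ =>
    ∑ k, MvPolynomial.C (creationCoeff τ s i k n) * MvPolynomial.X (k, n))

/-- The coefficients in the exponent of the annihilation part of `Λ̃_i(z)`, where
`s' = (q/t)^{1/4}`. -/
def annihilationCoeff (q s' : R) (i : Fin N) (n : ℕ+) : R :=
  (q ^ (n : ℕ) - 1) * s' ^ (2 * (i : ℕ) * n)

/-- `X₀` over a commutative `ℚ`-algebra. -/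
def ringX0 (q τ s s' : R) (u : Fin N → R) (f : MvPolynomial (Fin N × ℕ+) R) :
    MvPolynomial (Fin N × ℕ+) R :=
  ∑ i, u i • zeroMode i (creation τ s i) (annihilationCoeff q s' i) f

theorem map_creationCoeff {R' : Type} [CommRing R'] [Algebra ℚ R'] (φ : R →+* R') (τ s : R)
    (i k : Fin N) (n : ℕ+) :
    φ (creationCoeff τ s i k n) = creationCoeff (φ τ) (φ s) i k n := by
  rw [creationCoeff, creationCoeff, map_rat_smul, map_mul]
  congr 2
  · simp
  · split_ifs <;> simp

/-- Here s and s' are separate arguments, with no division, so that the operator is compatible with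
every ring homomorphism. This is what makes specialization of matrix entries possible. -/
theorem ringX0_map {R' : Type} [CommRing R'] [Algebra ℚ R'] (φ : R →+* R') (q τ s s' : R)
    (u : Fin N → R) (f : MvPolynomial (Fin N × ℕ+) R) :
    MvPolynomial.map φ (ringX0 q τ s s' u f) =
      ringX0 (φ q) (φ τ) (φ s) (φ s') (fun i => φ (u i)) (MvPolynomial.map φ f) := by
  rw [ringX0, ringX0, map_sum]
  refine Finset.sum_congr rfl fun i _ => ?_
  rw [MvPolynomial.smul_eq_C_mul, map_mul, MvPolynomial.map_C, MvPolynomial.smul_eq_C_mul,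
    zeroMode_map]
  congr 2
  · rw [creation, creation, formalExp_map, posSeries_map]
    congr 2
    funext n
    rw [map_sum]
    refine Finset.sum_congr rfl fun k _ => ?_
    rw [map_mul, MvPolynomial.map_C, MvPolynomial.map_X, map_creationCoeff]
  · funext n
    simp [annihilationCoeff]

end ZeroMode

/-! ### Comparison with the field version of X₀. -/

section FieldX0

open PowerSeries

variable {N : ℕ} {K : Type} [Field K] [CharZero K]

theorem constantTerm_eq_zeroMode (i : Fin N) (A : PowerSeries (SymN N K)) (γ : ℕ+ → K)
    (f : SymN N K) :
    constantTerm A (formalExp K (posSeries fun n : ℕ+ => γ n • dp i n)) f = zeroMode i A γ f := by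
  rw [constantTerm, zeroMode]
  simp only [coeff_formalExp_dp]
  refine finsum_eq_finsetSum_of_support_subset _ fun n hn => ?_
  rw [Finset.mem_coe, Finset.mem_range]
  by_contra hc
  exact hn (by
    dsimp only
    rw [lower_eq_zero_of_natDegree_lt i γ f (by omega), mul_zero])

/-- The factor (t/q)^{-n/4} in φ₋ cancels the odd quarter power in its argument, leaving s^{2kn}
with s = (t/q)^{1/4}. All factors then merge into one exponential. -/
theorem prod_phiMinus_mul_etaCreation {a b : K} (ha : a ≠ 0) (hb : b ≠ 0) (i : Fin N) :
    (∏ k ∈ Finset.Iio i, phiMinus a b ((b / a) ^ (2 * (k : ℕ) + 1)) k) *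
      etaCreation b ((b / a) ^ (2 * (i : ℕ))) i = creation (b ^ 4)⁻¹ (b / a) i := by
  have hs : b / a ≠ 0 := div_ne_zero hb ha
  have h1 : ∀ k ∈ Finset.Iio i, phiMinus a b ((b / a) ^ (2 * (k : ℕ) + 1)) k =
      formalExp ℚ (posSeries fun n : ℕ+ =>
        MvPolynomial.C (creationCoeff (b ^ 4)⁻¹ (b / a) i k n) * MvPolynomial.X (k, n)) := by
    intro k hk
    rw [Finset.mem_Iio] at hk
    rw [phiMinus, formalExp_eq_rat]
    congr 2
    funext n
    rw [p, MvPolynomial.smul_eq_C_mul]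
    congr 2
    rw [creationCoeff, if_pos hk, Algebra.smul_def]
    have hsn : (b / a) ^ (n : ℕ) ≠ 0 := pow_ne_zero _ hs
    have hpow : ((b / a) ^ (2 * (k : ℕ) + 1)) ^ (n : ℕ) =
        (b / a) ^ (2 * (k : ℕ) * n) * (b / a) ^ (n : ℕ) := by
      rw [← pow_mul, add_mul, one_mul, pow_add]
    rw [← div_pow, ← pow_mul (b / a) 4, hpow, inv_pow, ← mul_assoc, mul_right_comm _ _
      ((b / a) ^ (2 * (k : ℕ) * n)), inv_mul_cancel_right₀ hsn]
    simp only [map_inv₀, map_natCast]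
    ring
  have h2 : etaCreation b ((b / a) ^ (2 * (i : ℕ))) i = formalExp ℚ (posSeries fun n : ℕ+ =>
      MvPolynomial.C (creationCoeff (b ^ 4)⁻¹ (b / a) i i n) * MvPolynomial.X (i, n)) := by
    rw [etaCreation, formalExp_eq_rat]
    congr 2
    funext n
    rw [p, MvPolynomial.smul_eq_C_mul]
    congr 2
    rw [creationCoeff, if_neg (lt_irrefl i), if_pos rfl, Algebra.smul_def, ← pow_mul (b / a),
      inv_pow]
    simp only [map_inv₀, map_natCast]
    ring
  rw [Finset.prod_congr rfl h1, h2, mul_comm, ← Finset.prod_insert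
    (f := fun k => formalExp ℚ (posSeries fun n : ℕ+ =>
        MvPolynomial.C (creationCoeff (b ^ 4)⁻¹ (b / a) i k n) *
          (MvPolynomial.X (k, n) : SymN N K))) (by simp : i ∉ Finset.Iio i),
    ← formalExp_sum _ _ fun _ _ => constantCoeff_posSeries _, posSeries_sum, creation]
  congr 2
  funext n
  rw [Finset.sum_apply]
  refine Finset.sum_subset (Finset.subset_univ _) fun k _ hk => ?_
  rw [Finset.mem_insert, not_or, Finset.mem_Iio] at hk
  rw [creationCoeff, if_neg hk.2, if_neg hk.1, mul_zero, smul_zero, map_zero, zero_mul]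

theorem X0_eq_ringX0 {a b : K} (ha : a ≠ 0) (hb : b ≠ 0) (u : Fin N → K) (f : SymN N K) :
    X0 a b u f = ringX0 (a ^ 4) (b ^ 4)⁻¹ (b / a) (a / b) u f := by
  rw [X0, ringX0]
  refine Finset.sum_congr rfl fun i _ => ?_
  rw [lambdaZero, prod_phiMinus_mul_etaCreation ha hb, etaAnnihilation, constantTerm_eq_zeroMode]
  congr 2
  funext n
  rw [annihilationCoeff, ← pow_mul (b / a), ← inv_pow, inv_div]
  ring

end FieldX0

/-! ### Triangularity of X₀ and its diagonal entries. -/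

section Triangular

open PowerSeries

theorem exists_bound_remove {N : ℕ} {R : Type} [CommRing R] (i : Fin N) (q : R)
    (f : MvPolynomial (Fin N × ℕ+) R) : ∃ M, 0 < M ∧ ∀ j, M ≤ j → remove i q j f = 0 := by
  obtain ⟨M, h, h', -⟩ := exists_bound_lower i q f 0
  exact ⟨M, h, h'⟩

variable {N : ℕ} {R : Type} [CommRing R] [Algebra ℚ R]

theorem formalExp_rescale {S : Type} [CommRing S] [Algebra ℚ S] (c : S) (f : PowerSeries S) :
    formalExp ℚ (rescale c f) = rescale c (formalExp ℚ f) := by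
  ext n
  rw [coeff_rescale]
  simp only [formalExp, coeff_mk, ← map_pow, coeff_rescale]
  rw [Finset.mul_sum]
  exact Finset.sum_congr rfl fun k _ => (mul_smul_comm _ _ _).symm

/-- The part of `creation` which involves the families below `i`. -/
def creationBelow (τ s : R) (i : Fin N) : PowerSeries (MvPolynomial (Fin N × ℕ+) R) :=
  formalExp ℚ (posSeries fun n : ℕ+ =>
    ∑ k ∈ Finset.Iio i, MvPolynomial.C (creationCoeff τ s i k n) * MvPolynomial.X (k, n))

theorem creation_eq_mul (τ s : R) (i : Fin N) :
    creation τ s i = creationBelow τ s i *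
      rescale (MvPolynomial.C (s ^ (2 * (i : ℕ)))) (kernelSeries i τ) := by
  rw [kernelSeries, ← formalExp_rescale, creationBelow, ← formalExp_add
    (constantCoeff_posSeries _), creation]
  · congr 1
    ext1 n
    rcases Nat.eq_zero_or_pos n with rfl | hn
    · rw [map_add, coeff_rescale]
      simp only [coeff_zero_eq_constantCoeff_apply, constantCoeff_posSeries, mul_zero, add_zero]
    obtain ⟨n, rfl⟩ : ∃ n' : ℕ+, n = n' := ⟨⟨n, hn⟩, rfl⟩
    rw [map_add, coeff_rescale, coeff_posSeries, coeff_posSeries, coeff_posSeries]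
    rw [← Finset.sum_subset (Finset.subset_univ (insert i (Finset.Iio i))),
      Finset.sum_insert (by simp), add_comm]
    · congr 1
      rw [creationCoeff, if_neg (lt_irrefl i), if_pos rfl, mul_smul_comm, ← mul_assoc,
        ← map_pow, ← map_mul, MvPolynomial.C_mul', MvPolynomial.C_mul', smul_assoc, ← pow_mul]
      congr 2
      ring
    · intro k _ hk
      rw [Finset.mem_insert, not_or, Finset.mem_Iio] at hk
      rw [creationCoeff, if_neg hk.2, if_neg hk.1, mul_zero, smul_zero, map_zero, zero_mul]
  · rw [← coeff_zero_eq_constantCoeff_apply, coeff_rescale, coeff_zero_eq_constantCoeff_apply,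
      constantCoeff_posSeries, mul_zero]

/-- Separates the creation part of the lower families from the operator `vertex` of the family i.
The rescalings by s^{2i} and s'^{2i} cancel within `vertex`, up to the power l carried away by the
lower families. -/
theorem zeroMode_creation {q τ s s' : R} (hs : s * s' = 1) (i : Fin N)
    {f : MvPolynomial (Fin N × ℕ+) R} {M : ℕ} (hM : ∀ j, M ≤ j → remove i q j f = 0) :
    zeroMode i (creation τ s i) (annihilationCoeff q s' i) f = ∑ l ∈ Finset.range M,
      (s' ^ (2 * (i : ℕ))) ^ l • (coeff l (creationBelow τ s i) * vertex i q τ l f) := by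
  set c := s ^ (2 * (i : ℕ))
  set c' := s' ^ (2 * (i : ℕ))
  have hc : c * c' = 1 := by rw [← mul_pow, hs, one_pow]
  have hlow : ∀ n, lower i (annihilationCoeff q s' i) n f = c' ^ n • remove i q n f := by
    intro n
    rw [remove, ← lower_scale]
    congr 2
    funext m
    rw [annihilationCoeff, pow_mul]
    ring
  rw [zeroMode_eq i _ _ (M := M) (fun j hj => by rw [hlow, hM j hj, smul_zero])]
  have h1 : ∀ l, vertex i q τ (l : ℕ) f = _ := fun l => vertex_eq i q τ l hM
  simp only [h1, Finset.mul_sum, Finset.smul_sum]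
  rw [Finset.sum_comm]
  refine Finset.sum_congr rfl fun n hn => ?_
  rw [Finset.mem_range] at hn
  rw [hlow, creation_eq_mul, coeff_mul, Finset.Nat.sum_antidiagonal_eq_sum_range_succ_mk,
    Finset.sum_mul]
  refine Finset.sum_subset_zero_on_sdiff (Finset.range_mono (by omega : n.succ ≤ M))
    (fun l hl => ?_) (fun l hl => ?_)
  · simp only [Finset.mem_sdiff, Finset.mem_range] at hl
    rw [kernel_of_neg i τ (by omega), zero_mul, mul_zero, smul_zero]
  · rw [Finset.mem_range] at hl
    have hl' : l ≤ n := by omega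
    rw [coeff_rescale, ← kernel_natCast, Nat.cast_sub hl', ← map_pow, mul_left_comm,
      MvPolynomial.C_mul', smul_mul_smul_comm, mul_assoc]
    congr 1
    have : n = (n - l) + l := by omega
    conv_lhs => rw [this, pow_add, ← mul_assoc, Nat.add_sub_cancel, ← mul_pow, hc]
    rw [one_pow, one_mul]

theorem coeff_creationBelow_mem_fil {w : Fin N × ℕ → ℤ} {i : Fin N} {ω : ℤ}
    (h : ∀ k < i, ∀ m, w (k, m) ≤ ω) (τ s : R) (l : ℕ) :
    coeff l (creationBelow τ s i) ∈ fil R w (ω * l) := by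
  refine coeff_formalExp_mem_fil (fun n => Submodule.sum_mem _ fun k hk => ?_) l
  rw [MvPolynomial.C_mul']
  refine Submodule.smul_mem _ _ (X_mem_fil fun m => ?_)
  rw [mul_comm]
  exact mul_le_mul_of_nonneg_right (h k (Finset.mem_Iio.1 hk) m) (by positivity)

theorem zeroMode_mem_fil_of_const {w : Fin N × ℕ → ℤ} {i : Fin N} {ω : ℤ}
    (hi : ∀ m, w (i, m) = ω) (h : ∀ k < i, ∀ m, w (k, m) ≤ ω) {q τ s s' : R} (hs : s * s' = 1)
    {D : ℤ} {f : MvPolynomial (Fin N × ℕ+) R} (hf : f ∈ fil R w D) :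
    zeroMode i (creation τ s i) (annihilationCoeff q s' i) f ∈ fil R w D := by
  obtain ⟨M, -, hM⟩ := exists_bound_remove i q f
  rw [zeroMode_creation hs i hM]
  refine Submodule.sum_mem _ fun l _ => Submodule.smul_mem _ _ ?_
  refine fil_mono (le_of_eq ?_) (mul_mem_fil (coeff_creationBelow_mem_fil h τ s l)
    (vertex_mem_fil_of_const hi q τ l hf))
  ring

theorem zeroMode_mem_fil_prefixWeight {w₀ : Fin N → ℤ} {i : Fin N} (h : ∀ k < i, w₀ k ≤ 0) (r : ℕ)
    {q τ s s' : R} (hs : s * s' = 1) {D : ℤ} {f : MvPolynomial (Fin N × ℕ+) R}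
    (hf : f ∈ fil R (prefixWeight w₀ i r) D) :
    zeroMode i (creation τ s i) (annihilationCoeff q s' i) f ∈ fil R (prefixWeight w₀ i r) D := by
  obtain ⟨M, -, hM⟩ := exists_bound_remove i q f
  rw [zeroMode_creation hs i hM]
  refine Submodule.sum_mem _ fun l _ => Submodule.smul_mem _ _ ?_
  have h1 : coeff l (creationBelow τ s i) ∈ fil R (prefixWeight w₀ i r) (0 * l) :=
    coeff_creationBelow_mem_fil (fun k hk m => by
      rw [prefixWeight, if_neg hk.ne]; exact h k hk) τ s l
  refine fil_mono (le_of_eq ?_) (mul_mem_fil h1 (vertex_mem_fil w₀ i r q τ l D hf))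
  rw [max_eq_left (by omega)]
  ring

/-- The weight of the inequality with indices `j`, `r` in the definition of `≤ᴸ`. -/
def orderWeight (j : Fin N) (r : ℕ) : Fin N × ℕ → ℤ :=
  prefixWeight (fun l => if j < l then 1 else 0) j r

/-- The mode l ≥ 0 of the family i is accompanied by degree l in lower families. For i < j all
weights involved are zero, for i = j the lower families have weight zero, and for i > j degree moves
from weight one to weights at most one. -/
theorem ringX0_mem_fil_orderWeight (j : Fin N) (r : ℕ) {q τ s s' : R} (hs : s * s' = 1)
    (u : Fin N → R) {D : ℤ} {f : MvPolynomial (Fin N × ℕ+) R}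
    (hf : f ∈ fil R (orderWeight j r) D) :
    ringX0 q τ s s' u f ∈ fil R (orderWeight j r) D := by
  refine Submodule.sum_mem _ fun i _ => Submodule.smul_mem _ _ ?_
  rcases lt_trichotomy i j with h | rfl | h
  · refine zeroMode_mem_fil_of_const (ω := 0) (fun m => ?_) (fun k hk m => ?_) hs hf
    · rw [orderWeight, prefixWeight, if_neg h.ne, if_neg h.not_gt]
    · rw [orderWeight, prefixWeight, if_neg (hk.trans h).ne, if_neg (hk.trans h).not_gt]
  · exact zeroMode_mem_fil_prefixWeight (fun k hk => by rw [if_neg hk.not_gt]) r hs hf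
  · refine zeroMode_mem_fil_of_const (ω := 1) (fun m => ?_) (fun k hk m => ?_) hs hf
    · rw [orderWeight, prefixWeight, if_neg h.ne', if_pos h]
    · simp only [orderWeight, prefixWeight]
      split_ifs <;> simp

theorem ringX0_mem_fil_const (ω : ℤ) {q τ s s' : R} (hs : s * s' = 1)
    (u : Fin N → R) {D : ℤ} {f : MvPolynomial (Fin N × ℕ+) R}
    (hf : f ∈ fil R (fun _ => ω) D) : ringX0 q τ s s' u f ∈ fil R (fun _ => ω) D :=
  Submodule.sum_mem _ fun _ _ => Submodule.smul_mem _ _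
    (zeroMode_mem_fil_of_const (fun _ => rfl) (fun _ _ _ => le_rfl) hs hf)

theorem wt_const (ω : ℤ) (d : Fin N × ℕ →₀ ℕ) : wt (fun _ => ω) d = ω * d.degree := by
  induction d using Finsupp.induction_linear with
  | zero => simp
  | add f g hf hg => rw [map_add, hf, hg, map_add]; push_cast; ring
  | single x n => rw [wt_single, Finsupp.degree_single, mul_comm]

theorem family_add (d e : Fin N × ℕ →₀ ℕ) (i : Fin N) :
    family (d + e) i = family d i + family e i := by
  ext k; simp [family_apply]

theorem family_single_self (i : Fin N) (k n : ℕ) :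
    family (Finsupp.single (i, k) n) i = Finsupp.single k n := by
  ext m
  simp [family_apply, Finsupp.single_apply]

theorem family_single_of_ne {i j : Fin N} (h : i ≠ j) (k n : ℕ) :
    family (Finsupp.single (i, k) n) j = 0 := by
  ext m
  simp [family_apply, h]

theorem wt_prefixWeight (w₀ : Fin N → ℤ) (i : Fin N) (r : ℕ) (d : Fin N × ℕ →₀ ℕ) :
    wt (prefixWeight w₀ i r) d = ∑ k ∈ Finset.range r, (d (i, k) : ℤ) +
      ∑ l ∈ Finset.univ.erase i, w₀ l * (family d l).degree := by
  classical
  induction d using Finsupp.induction_linear with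
  | zero =>
    have : ∀ l, family (0 : Fin N × ℕ →₀ ℕ) l = 0 := fun l => by ext; rfl
    simp [this]
  | add f g hf hg =>
    rw [map_add, hf, hg]
    simp only [family_add, map_add, Finsupp.add_apply, Nat.cast_add, mul_add,
      Finset.sum_add_distrib]
    ring
  | single x n =>
    obtain ⟨j, k⟩ := x
    rw [wt_single]
    by_cases hj : j = i
    · subst hj
      rw [Finset.sum_eq_zero (s := Finset.univ.erase j), add_zero]
      · simp only [prefixWeight, if_true, Finsupp.single_apply, Prod.mk.injEq, true_and]
        by_cases hk : k < r <;> simp [hk]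
      · intro l hl
        rw [family_single_of_ne (Finset.ne_of_mem_erase hl).symm]
        simp
    · rw [Finset.sum_eq_zero (s := Finset.range r), zero_add, Finset.sum_eq_single j]
      · rw [family_single_self, Finsupp.degree_single, prefixWeight, if_neg hj, mul_comm]
      · intro l _ hl
        rw [family_single_of_ne hl.symm]; simp
      · intro h
        exact absurd (Finset.mem_erase.2 ⟨hj, Finset.mem_univ _⟩) h
      · intro m _
        rw [Finsupp.single_eq_of_ne]; · rfl
        intro h
        exact hj (congrArg Prod.fst h).symm

theorem wt_orderWeight (j : Fin N) (r : ℕ) (d : Fin N × ℕ →₀ ℕ) :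
    wt (orderWeight j r) d = ∑ k ∈ Finset.range r, (d (j, k) : ℤ) +
      ∑ l ∈ Finset.Ioi j, ((family d l).degree : ℤ) := by
  rw [orderWeight, wt_prefixWeight]
  congr 1
  simp only [ite_mul, one_mul, zero_mul]
  rw [← Finset.sum_filter]
  refine Finset.sum_congr ?_ fun _ _ => rfl
  ext l
  simp only [Finset.mem_filter, Finset.mem_erase, Finset.mem_univ, and_true, Finset.mem_Ioi]
  exact ⟨fun h => h.2, fun h => ⟨h.ne', h⟩⟩

theorem mono_mem_fil_orderWeight (lam : PtnTuple N) (j : Fin N) (r : ℕ) :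
    mono R lam ∈ fil R (orderWeight j r) (wt (orderWeight j r) (expOf lam)) := by
  classical
  intro d hd
  rw [cf_mono, if_neg]
  intro h
  rw [wt_orderWeight, wt_orderWeight] at hd
  have h1 := h.sum_range_le j r
  have h2 : ∀ l, (family d l).degree = (family (expOf lam) l).degree := fun l => by
    rw [h.degree_family, (rearranges_expOf lam).degree_family]
  simp only [h2] at hd
  have h3 : (∑ k ∈ Finset.range r, (d (j, k) : ℤ)) ≤
      ∑ k ∈ Finset.range r, (expOf lam (j, k) : ℤ) := by exact_mod_cast h1
  linarith

theorem mono_mem_fil_const (lam : PtnTuple N) (ω : ℤ) :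
    mono R lam ∈ fil R (fun _ => ω) (ω * ∑ i, (lam i).size) := by
  classical
  intro d hd
  rw [cf_mono, if_neg]
  intro h
  rw [wt_const, h.degree_eq] at hd
  push_cast at hd
  exact lt_irrefl _ hd

/-- The matrix of an operator in the basis of the `m_λ`. -/
def entry (T : MvPolynomial (Fin N × ℕ+) R → MvPolynomial (Fin N × ℕ+) R) (mu nu : PtnTuple N) :
    R := cf (expOf mu) (T (mono R nu))

/-- The constant weights 1 and -1 give equality of total degrees, and the weights `orderWeight j (r
+ 1)` give the inequalities. -/
theorem leL_of_entry_ringX0_ne_zero {q τ s s' : R} (hs : s * s' = 1) (u : Fin N → R)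
    {mu nu : PtnTuple N} (h : entry (ringX0 q τ s s' u) mu nu ≠ 0) : leL mu nu := by
  have hc : ∀ ω : ℤ, ω * ∑ i, ((mu i).size : ℤ) ≤ ω * ∑ i, ((nu i).size : ℤ) := by
    intro ω
    by_contra hc
    refine h (ringX0_mem_fil_const ω hs u (mono_mem_fil_const nu ω) _ ?_)
    rw [wt_const, (rearranges_expOf mu).degree_eq]
    push_cast
    linarith
  refine ⟨?_, fun j r => ?_⟩
  · have h1 := hc 1
    have h2 := hc (-1)
    have : ∑ i, ((mu i).size : ℤ) = ∑ i, ((nu i).size : ℤ) := by linarith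
    exact_mod_cast this
  · by_contra hlt
    refine h (ringX0_mem_fil_orderWeight j (r + 1) hs u (mono_mem_fil_orderWeight nu j (r + 1)) _ ?_)
    rw [wt_orderWeight, wt_orderWeight]
    simp only [(rearranges_expOf _).degree_family, expOf_apply]
    have := not_le.1 hlt
    zify at this
    linarith

/-- The eigenvalue of the one-family Macdonald operator. -/
def macEigenvalue (q τ : R) (l : Ptn) : R :=
  1 + (1 - τ) * l.1.sum fun k x => τ ^ k * (q ^ x - 1)

/-- Terms with l > 0 move degree out of the families from i on and cannot return to the leading
monomial. The term l = 0 is `cf_vertex_zero`. -/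
theorem cf_zeroMode_self {q τ s s' : R} (hs : s * s' = 1) (i : Fin N) (lam : PtnTuple N) :
    cf (expOf lam) (zeroMode i (creation τ s i) (annihilationCoeff q s' i) (mono R lam)) =
      macEigenvalue q τ (lam i) := by
  classical
  obtain ⟨M, hM0, hM⟩ := exists_bound_remove i q (mono R lam)
  rw [zeroMode_creation hs i hM, map_sum, Finset.sum_eq_single 0]
  · rw [pow_zero, one_smul, coeff_zero_eq_constantCoeff_apply, creationBelow,
      constantCoeff_formalExp, one_mul, Nat.cast_zero]
    rw [cf_vertex_zero i q τ (lam i).size]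
    · rw [cf_expOf_mono, if_pos rfl, mul_one, macEigenvalue,
        Finsupp.sum_of_support_subset (s := Finset.range (lam i).size)]
      · simp only [expOf_apply, mul_sub, mul_one, Finset.sum_sub_distrib]
        have := mul_neg_geom_sum τ (lam i).size
        rw [this]
        ring
      · intro k hk
        rw [Finset.mem_range]
        by_contra hc
        exact Finsupp.mem_support_iff.1 hk ((lam i).eq_zero_of_size_le (not_lt.1 hc))
      · intro k _; simp
    · intro k hk
      exact (lam i).eq_zero_of_size_le hk
    · intro e he r
      rw [cf_mono] at he
      have : Rearranges e lam := by
        by_contra hc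
        exact he (if_neg hc)
      exact this.sum_range_le i r
  · intro l _ hl
    rw [map_smul]
    -- This weight counts the degree in the families from i on. The creation part has weight zero
    -- and `vertex` with mode l lowers the weight by l.
    have hw : ∀ m, (fun x : Fin N × ℕ => if i ≤ x.1 then (1 : ℤ) else 0) (i, m) = 1 :=
      fun m => if_pos le_rfl
    have h1 : coeff l (creationBelow τ s i) ∈
        fil R (fun x : Fin N × ℕ => if i ≤ x.1 then (1 : ℤ) else 0) (0 * l) :=
      coeff_creationBelow_mem_fil (fun k hk m => (if_neg (not_le.2 hk)).le) τ s l
    have h3 : mono R lam ∈ fil R (fun x : Fin N × ℕ => if i ≤ x.1 then (1 : ℤ) else 0)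
        (wt (fun x : Fin N × ℕ => if i ≤ x.1 then (1 : ℤ) else 0) (expOf lam)) := by
      intro d hd
      rw [cf_mono, if_neg]
      intro h
      have hwt : ∀ e : Fin N × ℕ →₀ ℕ,
          wt (fun x : Fin N × ℕ => if i ≤ x.1 then (1 : ℤ) else 0) e =
          ∑ l, (if i ≤ l then (1 : ℤ) else 0) * (family e l).degree := by
        intro e
        induction e using Finsupp.induction_linear with
        | zero =>
          have : ∀ l, family (0 : Fin N × ℕ →₀ ℕ) l = 0 := fun l => by ext; rfl
          simp [this]
        | add f g hf hg =>
          rw [map_add, hf, hg]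
          simp only [family_add, map_add, Nat.cast_add, mul_add, Finset.sum_add_distrib]
        | single x n =>
          obtain ⟨j, k⟩ := x
          rw [wt_single, Finset.sum_eq_single j]
          · rw [family_single_self, Finsupp.degree_single, mul_comm]
          · intro l _ hl
            rw [family_single_of_ne hl.symm]; simp
          · simp
      simp only [hwt, h.degree_family, (rearranges_expOf lam).degree_family] at hd
      exact lt_irrefl _ hd
    have h2 := vertex_mem_fil_of_const hw q τ l h3
    rw [mul_mem_fil h1 h2 _ (by
      have : (0 : ℤ) < l := by exact_mod_cast Nat.pos_of_ne_zero hl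
      linarith), smul_zero]
  · intro h
    exact absurd (Finset.mem_range.2 hM0) h

theorem entry_ringX0_self {q τ s s' : R} (hs : s * s' = 1) (u : Fin N → R) (lam : PtnTuple N) :
    entry (ringX0 q τ s s' u) lam lam = ∑ i, u i * macEigenvalue q τ (lam i) := by
  rw [entry, ringX0, map_sum]
  refine Finset.sum_congr rfl fun i _ => ?_
  rw [map_smul, cf_zeroMode_self hs, smul_eq_mul]

theorem entry_ringX0_map {R' : Type} [CommRing R'] [Algebra ℚ R'] (φ : R →+* R') (q τ s s' : R)
    (u : Fin N → R) (mu nu : PtnTuple N) :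
    φ (entry (ringX0 q τ s s' u) mu nu) =
      entry (ringX0 (φ q) (φ τ) (φ s) (φ s') fun i => φ (u i)) mu nu := by
  rw [entry, ← cf_map, ringX0_map, map_mono, entry]

end Triangular

/-! ### Exponentials up to second order in a parameter. -/

section SecondOrder

theorem sum_ite_add_succ_eq {W : Type} [AddCommMonoid W] (F : ℕ → ℕ → W) {M n : ℕ} (hn : n < M) :
    ∑ b ∈ Finset.range M, ∑ c ∈ Finset.range M, (if b + c + 1 = n then F b c else 0) =
      ∑ k ∈ Finset.range n, F k (n - 1 - k) := by
  rw [← Finset.sum_subset (Finset.range_mono hn.le)]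
  · refine Finset.sum_congr rfl fun k hk => ?_
    rw [Finset.mem_range] at hk
    rw [Finset.sum_eq_single (n - 1 - k), if_pos (by omega)]
    · intro c _ hc
      rw [if_neg (by omega)]
    · intro hc
      exact absurd (Finset.mem_range.2 (by omega)) hc
  · intro b _ hb
    rw [Finset.mem_range, not_lt] at hb
    exact Finset.sum_eq_zero fun c _ => if_neg (by omega)

variable {R : Type} [CommRing R] [Algebra ℚ R] {W : Type} [AddCommGroup W] [Module R W]

/-- The coefficients of an exponential `exp (h ∑ T_k z^{k+1})` up to the second order in `h`. -/
theorem exists_exp_expansion {κ h : R} (hκ : 2 * κ = 1) (T : ℕ → Module.End R W)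
    (hT : ∀ j k w, T j (T k w) = T k (T j w)) (E : ℕ → W)
    (hE : ∀ n : ℕ, ((n : R) + 1) • E (n + 1) =
      ∑ k ∈ Finset.range (n + 1), (((k : R) + 1) * h) • T k (E (n - k)))
    {M n : ℕ} (hn : n < M) :
    ∃ g, E (n + 1) = h • T n (E 0) + (h ^ 2 * κ) • ∑ b ∈ Finset.range M, ∑ c ∈ Finset.range M,
      (if b + c + 1 = n then T b (T c (E 0)) else 0) + h ^ 3 • g := by
  obtain ⟨v, hv⟩ : ∃ v : ℕ → R, ∀ n : ℕ, ((n : R) + 1) * v n = 1 := by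
    refine ⟨fun n => algebraMap ℚ R ((n : ℚ) + 1)⁻¹, fun n => ?_⟩
    have : ((n : R) + 1) = algebraMap ℚ R ((n : ℚ) + 1) := by simp
    rw [this, ← map_mul, mul_inv_cancel₀ (by positivity), map_one]
  have hE' : ∀ n : ℕ, ((n : R) + 1) • E (n + 1) = ((n : R) + 1) • h • T n (E 0) +
      ∑ k ∈ Finset.range n, (((k : R) + 1) * h) • T k (E (n - 1 - k + 1)) := by
    intro n
    rw [hE, Finset.sum_range_succ, Nat.sub_self, add_comm, mul_smul]
    congr 1
    refine Finset.sum_congr rfl fun k hk => ?_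
    rw [Finset.mem_range] at hk
    rw [show n - k = n - 1 - k + 1 by omega]
  -- The precision improves in three rounds h, h², h³: each estimate is inserted into the recursion,
  -- which supplies one more factor h.
  have h1 : ∀ n, ∃ g, E (n + 1) = h • g := by
    intro n
    refine ⟨v n • ∑ k ∈ Finset.range (n + 1), ((k : R) + 1) • T k (E (n - k)), ?_⟩
    apply succ_smul_cancel (R := R) (n := n)
    rw [hE, smul_comm, smul_smul _ (v n), hv, one_smul, Finset.smul_sum]
    exact Finset.sum_congr rfl fun k _ => by rw [smul_smul, mul_comm]
  choose g₁ hg₁ using h1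
  have h2 : ∀ n, ∃ g, E (n + 1) = h • T n (E 0) + h ^ 2 • g := by
    intro n
    refine ⟨v n • ∑ k ∈ Finset.range n, ((k : R) + 1) • T k (g₁ (n - 1 - k)), ?_⟩
    apply succ_smul_cancel (R := R) (n := n)
    rw [hE', smul_add, smul_comm _ (h ^ 2), smul_smul _ (v n), hv, one_smul, Finset.smul_sum]
    congr 1
    refine Finset.sum_congr rfl fun k _ => ?_
    rw [hg₁, map_smul, smul_smul, smul_smul]
    congr 1
    ring
  choose g₂ hg₂ using h2
  refine ⟨v n • ∑ k ∈ Finset.range n, ((k : R) + 1) • T k (g₂ (n - 1 - k)), ?_⟩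
  apply succ_smul_cancel (R := R) (n := n)
  rw [sum_ite_add_succ_eq (fun b c => T b (T c (E 0))) hn]
  -- The two factors commute, so reflecting the sum replaces the weight k + 1 by n - k. The average
  -- of the two is (n + 1)/2.
  have hsym : ((n : R) + 1) • κ • ∑ k ∈ Finset.range n, T k (T (n - 1 - k) (E 0)) =
      ∑ k ∈ Finset.range n, ((k : R) + 1) • T k (T (n - 1 - k) (E 0)) := by
    set Q := ∑ k ∈ Finset.range n, ((k : R) + 1) • T k (T (n - 1 - k) (E 0)) with hQ
    have hQ' : Q = ∑ k ∈ Finset.range n, ((n : R) - k) • T k (T (n - 1 - k) (E 0)) := by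
      rw [hQ, ← Finset.sum_range_reflect]
      refine Finset.sum_congr rfl fun k hk => ?_
      rw [Finset.mem_range] at hk
      rw [show n - 1 - (n - 1 - k) = k by omega, hT]
      congr 1
      rw [Nat.cast_sub (by omega), Nat.cast_sub (by omega)]
      push_cast
      ring
    have h2Q : (2 : R) • Q =
        ((n : R) + 1) • ∑ k ∈ Finset.range n, T k (T (n - 1 - k) (E 0)) := by
      rw [two_smul]
      nth_rw 1 [hQ]
      rw [hQ', ← Finset.sum_add_distrib, Finset.smul_sum]
      refine Finset.sum_congr rfl fun k _ => ?_
      rw [← add_smul]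
      congr 1
      ring
    rw [smul_comm, ← h2Q, smul_smul, mul_comm, hκ, one_smul]
  rw [hE', smul_add, smul_add, smul_comm _ (h ^ 3), smul_smul _ (v n), hv, one_smul,
    mul_smul, smul_comm _ (h ^ 2), hsym, add_assoc]
  congr 1
  rw [Finset.smul_sum, Finset.smul_sum, ← Finset.sum_add_distrib]
  refine Finset.sum_congr rfl fun k _ => ?_
  rw [hg₂, map_add, map_smul, map_smul, smul_add, smul_smul, smul_smul, smul_smul, smul_smul]
  congr 2 <;> ring

end SecondOrder

/-! ### Expansion of a zero mode to third order. -/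

section ZeroModeExpansion

open PowerSeries

theorem pderiv_eq_zero_of_bound {N : ℕ} {R : Type} [CommRing R]
    {f : MvPolynomial (Fin N × ℕ+) R} {M : ℕ}
    (hv : ∀ v ∈ f.vars, 2 * (v.2 : ℕ) ≤ M) (i : Fin N) {a : ℕ} (ha : M < 2 * (a + 1)) :
    MvPolynomial.pderiv (i, a.succPNat) f = 0 := by
  refine MvPolynomial.pderiv_eq_zero_of_notMem_vars fun h => ?_
  have := hv _ h
  simp at this
  omega

/-- The factor 2 in the bound serves this case: the larger of the two indices is already out of
range. -/
theorem pderiv_pderiv_eq_zero_of_bound {N : ℕ} {R : Type} [CommRing R]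
    {f : MvPolynomial (Fin N × ℕ+) R} {M : ℕ}
    (hv : ∀ v ∈ f.vars, 2 * (v.2 : ℕ) ≤ M) (i : Fin N) {a b : ℕ} (ha : M ≤ a + b + 1) :
    MvPolynomial.pderiv (i, a.succPNat) (MvPolynomial.pderiv (i, b.succPNat) f) = 0 := by
  rcases le_total a b with h | h
  · rw [pderiv_eq_zero_of_bound hv i (by omega : M < 2 * (b + 1)), map_zero]
  · rw [pderiv_comm, pderiv_eq_zero_of_bound hv i (by omega : M < 2 * (a + 1)), map_zero]

variable {N : ℕ} {R : Type} [CommRing R] [Algebra ℚ R]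

theorem exists_lower_expansion {κ h : R} (hκ : 2 * κ = 1) (i : Fin N) (c : ℕ → R) (γ : ℕ+ → R)
    (hγ : ∀ a : ℕ, γ a.succPNat = h * c a) (f : MvPolynomial (Fin N × ℕ+) R) {M n : ℕ}
    (hn : n < M) :
    ∃ g, lower i γ (n + 1) f = h • c n • MvPolynomial.pderiv (i, n.succPNat) f +
      (h ^ 2 * κ) • ∑ b ∈ Finset.range M, ∑ b' ∈ Finset.range M,
        (if b + b' + 1 = n then (c b * c b') • MvPolynomial.pderiv (i, b.succPNat)
          (MvPolynomial.pderiv (i, b'.succPNat) f) else 0) + h ^ 3 • g := by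
  obtain ⟨g, hg⟩ := exists_exp_expansion hκ
    (fun k => c k • (MvPolynomial.pderiv (i, k.succPNat) :
      Derivation R (MvPolynomial (Fin N × ℕ+) R) (MvPolynomial (Fin N × ℕ+) R)).toLinearMap)
    (fun j k w => by
      simp only [LinearMap.smul_apply, Derivation.coeFn_coe, Derivation.map_smul]
      rw [smul_comm, pderiv_comm])
    (fun k => lower i γ k f) (fun m => by
      rw [succ_smul_lower]
      refine Finset.sum_congr rfl fun k _ => ?_
      rw [hγ, LinearMap.smul_apply, smul_smul, Derivation.coeFn_coe, pderiv_lower, mul_assoc]) hn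
  refine ⟨g, ?_⟩
  simp only [LinearMap.smul_apply, Derivation.coeFn_coe, Derivation.map_smul, lower_zero,
    smul_smul] at hg
  rw [hg, smul_smul]

theorem exists_coeff_expansion {κ h : R} (hκ : 2 * κ = 1)
    (σ : ℕ → MvPolynomial (Fin N × ℕ+) R) (c : ℕ+ → MvPolynomial (Fin N × ℕ+) R)
    (hc : ∀ a : ℕ, c a.succPNat = h • σ a) {M n : ℕ} (hn : n < M) :
    ∃ g, coeff (n + 1) (formalExp ℚ (posSeries c)) = h • σ n +
      (h ^ 2 * κ) • ∑ b ∈ Finset.range M, ∑ b' ∈ Finset.range M,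
        (if b + b' + 1 = n then σ b * σ b' else 0) + h ^ 3 • g := by
  obtain ⟨g, hg⟩ := exists_exp_expansion (h := h) hκ (fun k => LinearMap.mulLeft R (σ k))
    (fun j k w => by simp only [LinearMap.mulLeft_apply]; ring)
    (fun k => coeff k (formalExp ℚ (posSeries c))) (fun m => by
      have := coeff_succ_formalExp c m
      rw [MvPolynomial.smul_eq_C_mul, map_add, map_natCast, map_one, this]
      refine Finset.sum_congr rfl fun k _ => ?_
      rw [hc, LinearMap.mulLeft_apply, MvPolynomial.smul_eq_C_mul, MvPolynomial.smul_eq_C_mul,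
        map_mul, map_add, map_natCast, map_one]
      ring) hn
  refine ⟨g, ?_⟩
  simpa only [LinearMap.mulLeft_apply, coeff_zero_eq_constantCoeff_apply, constantCoeff_formalExp,
    mul_one] using hg

/-- The element `1/2`. -/
def half (R : Type) [CommRing R] [Algebra ℚ R] : R := algebraMap ℚ R 2⁻¹

theorem two_mul_half : 2 * half R = 1 := by
  rw [half, show (2 : R) = algebraMap ℚ R 2 from (map_ofNat _ 2).symm, ← map_mul]
  norm_num

theorem map_half {R' : Type} [CommRing R'] [Algebra ℚ R'] (φ : R →+* R') :
    φ (half R) = half R' := by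
  rw [half, half, ← RingHom.comp_apply, Subsingleton.elim (φ.comp (algebraMap ℚ R))
    (algebraMap ℚ R')]

/-- The operator `∑_{n ≤ M} n p^{(i)}_n ∂/∂p^{(i)}_n`. -/
def degreePart (M : ℕ) (i : Fin N) (f : MvPolynomial (Fin N × ℕ+) R) :
    MvPolynomial (Fin N × ℕ+) R :=
  ∑ a ∈ Finset.range M, MvPolynomial.C ((a : R) + 1) * (MvPolynomial.X (i, a.succPNat) *
    MvPolynomial.pderiv (i, a.succPNat) f)

/-- The operator `H_β`, without the terms which contain the `u'_i`, on the functions of the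
family `i`, with all sums truncated at `M`. -/
def cubicPart (M : ℕ) (β : R) (i : Fin N) (f : MvPolynomial (Fin N × ℕ+) R) :
    MvPolynomial (Fin N × ℕ+) R :=
  MvPolynomial.C (half R) * ∑ a ∈ Finset.range M, ∑ b ∈ Finset.range M,
      (MvPolynomial.C (β * ((a : R) + 1 + (b + 1))) * (MvPolynomial.X (i, a.succPNat) *
          MvPolynomial.X (i, b.succPNat) * MvPolynomial.pderiv (i, (a + b + 1).succPNat) f) +
        MvPolynomial.C (((a : R) + 1) * (b + 1)) * (MvPolynomial.X (i, (a + b + 1).succPNat) *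
          MvPolynomial.pderiv (i, a.succPNat) (MvPolynomial.pderiv (i, b.succPNat) f))) +
    (MvPolynomial.C (1 - β) * ∑ a ∈ Finset.range M, MvPolynomial.C (half R * ((a : R) + 1) ^ 2) *
        (MvPolynomial.X (i, a.succPNat) * MvPolynomial.pderiv (i, a.succPNat) f) +
      MvPolynomial.C (1 - β) * ∑ k ∈ Finset.Iio i, ∑ a ∈ Finset.range M,
        MvPolynomial.C (((a : R) + 1) ^ 2) * (MvPolynomial.X (k, a.succPNat) *
          MvPolynomial.pderiv (i, a.succPNat) f))

/-- `H_β` with all sums truncated at `M`. -/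
def ham (M : ℕ) (β : R) (u : Fin N → R) (f : MvPolynomial (Fin N × ℕ+) R) :
    MvPolynomial (Fin N × ℕ+) R :=
  ∑ i, (cubicPart M β i f + MvPolynomial.C (u i) * degreePart M i f)

theorem sum_sum_ite_add_succ_eq {W : Type} [AddCommMonoid W] {M : ℕ} (F : ℕ → ℕ → ℕ → W)
    (hF : ∀ b c, M ≤ b + c + 1 → F b c (b + c + 1) = 0) :
    ∑ a ∈ Finset.range M, ∑ b ∈ Finset.range M, ∑ c ∈ Finset.range M,
      (if b + c + 1 = a then F b c a else 0) =
      ∑ b ∈ Finset.range M, ∑ c ∈ Finset.range M, F b c (b + c + 1) := by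
  rw [Finset.sum_comm]
  refine Finset.sum_congr rfl fun b _ => ?_
  rw [Finset.sum_comm]
  refine Finset.sum_congr rfl fun c _ => ?_
  rw [Finset.sum_ite_eq]
  split_ifs with h
  · rfl
  · rw [hF b c (by simpa using h)]

/-- Both exponents are divisible by h, so the n-th term is (hσ + h²σσ/2)(hc∂ + h²cc∂∂/2) up to h⁴.
Order h² gives the degree operator. Order h³ gives the cubic terms pp∂ and p∂∂ at leading order in σ
and c, and the quadratic terms from the correction to σc, which is why `hαc` is required one order
further than `hα` and `hc`. -/
theorem exists_zeroMode_expansion {h β : R} (i : Fin N) {α : Fin N → ℕ → R} {c : ℕ → R}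
    {cA : ℕ+ → MvPolynomial (Fin N × ℕ+) R} {γ : ℕ+ → R}
    (hcA : ∀ a : ℕ, cA a.succPNat =
      h • ∑ k, MvPolynomial.C (α k a) * MvPolynomial.X (k, a.succPNat))
    (hγ : ∀ a : ℕ, γ a.succPNat = h * c a)
    (hα : ∀ k a, ∃ r, α k a = (if k = i then β else 0) + h * r)
    (hc : ∀ a : ℕ, ∃ r, c a = ((a : R) + 1) + h * r)
    (hαc : ∀ k (a : ℕ), ∃ r, α k a * c a = (if k = i then β * ((a : R) + 1) else 0) +
      h * (β * (1 - β) * ((if k = i then half R * ((a : R) + 1) ^ 2 else 0) +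
        (if k < i then ((a : R) + 1) ^ 2 else 0))) + h ^ 2 * r)
    {f : MvPolynomial (Fin N × ℕ+) R} {M : ℕ} (hlow : ∀ n, M < n → lower i γ n f = 0)
    (hv : ∀ v ∈ f.vars, 2 * (v.2 : ℕ) ≤ M) :
    ∃ g, zeroMode i (formalExp ℚ (posSeries cA)) γ f =
      f + MvPolynomial.C (h ^ 2 * β) * degreePart M i f +
        MvPolynomial.C (h ^ 3 * β) * cubicPart M β i f + MvPolynomial.C (h ^ 4) * g := by
  choose α' hα using hα
  choose c' hc using hc
  choose ρ hαc using hαc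
  set σ : ℕ → MvPolynomial (Fin N × ℕ+) R :=
    fun a => ∑ k, MvPolynomial.C (α k a) * MvPolynomial.X (k, a.succPNat) with hσ
  set D : ℕ → MvPolynomial (Fin N × ℕ+) R := fun a => MvPolynomial.pderiv (i, a.succPNat) f with hD
  set DD : ℕ → ℕ → MvPolynomial (Fin N × ℕ+) R := fun a b =>
    MvPolynomial.pderiv (i, a.succPNat) (MvPolynomial.pderiv (i, b.succPNat) f) with hDD
  set x : ℕ → MvPolynomial (Fin N × ℕ+) R := fun a => MvPolynomial.X (i, a.succPNat) with hx
  set y : ℕ → MvPolynomial (Fin N × ℕ+) R :=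
    fun a => ∑ k ∈ Finset.Iio i, MvPolynomial.X (k, a.succPNat) with hy
  have hx' : ∀ a, ∀ t : R, MvPolynomial.C t * x a =
      ∑ k, MvPolynomial.C (if k = i then t else 0) * MvPolynomial.X (k, a.succPNat) := by
    intro a t
    rw [Finset.sum_eq_single i]
    · rw [if_pos rfl]
    · intro k _ hk
      rw [if_neg hk, map_zero, zero_mul]
    · simp
  have hσ1 : ∀ a, ∃ r, σ a = MvPolynomial.C β * x a + MvPolynomial.C h * r := by
    intro a
    refine ⟨∑ k, MvPolynomial.C (α' k a) * MvPolynomial.X (k, a.succPNat), ?_⟩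
    rw [hx', Finset.mul_sum, ← Finset.sum_add_distrib]
    refine Finset.sum_congr rfl fun k _ => ?_
    rw [hα, map_add, map_mul]
    ring
  choose σ' hσ1 using hσ1
  have hσc : ∀ a, ∃ r, MvPolynomial.C (c a) * σ a =
      MvPolynomial.C (β * ((a : R) + 1)) * x a +
      MvPolynomial.C (h * (β * (1 - β))) * (MvPolynomial.C (half R * ((a : R) + 1) ^ 2) * x a +
        MvPolynomial.C (((a : R) + 1) ^ 2) * y a) + MvPolynomial.C (h ^ 2) * r := by
    intro a
    refine ⟨∑ k, MvPolynomial.C (ρ k a) * MvPolynomial.X (k, a.succPNat), ?_⟩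
    have hy' : ∀ t : R, MvPolynomial.C t * y a =
        ∑ k, MvPolynomial.C (if k < i then t else 0) * MvPolynomial.X (k, a.succPNat) := by
      intro t
      rw [hy, Finset.mul_sum]
      have : Finset.Iio i = Finset.univ.filter (· < i) := by ext; simp
      rw [this, Finset.sum_filter]
      refine Finset.sum_congr rfl fun k _ => ?_
      split_ifs <;> simp
    rw [hx', hx', hy', hσ, Finset.mul_sum, Finset.mul_sum, ← Finset.sum_add_distrib,
      Finset.mul_sum, ← Finset.sum_add_distrib, ← Finset.sum_add_distrib]
    refine Finset.sum_congr rfl fun k _ => ?_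
    have := congrArg (MvPolynomial.C (σ := Fin N × ℕ+)) (hαc k a)
    simp only [map_add, map_mul] at this ⊢
    linear_combination (MvPolynomial.X (k, a.succPNat)) * this
  choose ρ' hσc using hσc
  have hterm : ∀ a ∈ Finset.range M, ∃ g, coeff (a + 1) (formalExp ℚ (posSeries cA)) *
      lower i γ (a + 1) f = MvPolynomial.C (h ^ 2 * β) * (MvPolynomial.C ((a : R) + 1) *
          (x a * D a)) +
        MvPolynomial.C (h ^ 3 * β) * (MvPolynomial.C (1 - β) *
          ((MvPolynomial.C (half R * ((a : R) + 1) ^ 2) * x a +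
            MvPolynomial.C (((a : R) + 1) ^ 2) * y a) * D a) +
          MvPolynomial.C (half R) * (∑ b ∈ Finset.range M, ∑ b' ∈ Finset.range M,
            (if b + b' + 1 = a then MvPolynomial.C (β * ((b : R) + 1 + (b' + 1))) *
                (x b * x b' * D a) +
              MvPolynomial.C (((b : R) + 1) * (b' + 1)) * (x a * DD b b') else 0))) +
        MvPolynomial.C (h ^ 4) * g := by
    intro a ha
    rw [Finset.mem_range] at ha
    obtain ⟨g₁, hg₁⟩ := exists_coeff_expansion two_mul_half σ cA hcA ha
    obtain ⟨g₂, hg₂⟩ := exists_lower_expansion two_mul_half i c γ hγ f ha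
    -- To leading order σσc is β²(a + 1)xx, and a + 1 = (b + 1) + (b' + 1) yields the coefficient n
    -- + m of H_β.
    obtain ⟨r₁, hr₁⟩ : ∃ r, (∑ b ∈ Finset.range M, ∑ b' ∈ Finset.range M,
        (if b + b' + 1 = a then σ b * σ b' else 0)) * (MvPolynomial.C (c a) * D a) =
        MvPolynomial.C β * (∑ b ∈ Finset.range M, ∑ b' ∈ Finset.range M,
        (if b + b' + 1 = a then MvPolynomial.C (β * ((b : R) + 1 + (b' + 1))) *
                (x b * x b' * D a) else 0)) +
        MvPolynomial.C h * r := by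
      refine ⟨∑ b ∈ Finset.range M, ∑ b' ∈ Finset.range M, (if b + b' + 1 = a then
        (MvPolynomial.C β ^ 2 * (x b * x b' * MvPolynomial.C (c' a)) +
        (MvPolynomial.C β * (x b * σ' b') + MvPolynomial.C β * (x b' * σ' b) +
          MvPolynomial.C h * (σ' b * σ' b')) * MvPolynomial.C (c a)) * D a else 0), ?_⟩
      simp only [Finset.mul_sum, Finset.sum_mul, ← Finset.sum_add_distrib]
      refine Finset.sum_congr rfl fun b _ => Finset.sum_congr rfl fun b' _ => ?_
      split_ifs with hb
      · rw [hσ1, hσ1, hc, ← hb]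
        push_cast
        simp only [map_add, map_mul, map_one]
        ring
      · simp
    obtain ⟨r₂, hr₂⟩ : ∃ r, ∑ b ∈ Finset.range M, ∑ b' ∈ Finset.range M,
        (if b + b' + 1 = a then (c b * c b') • DD b b' else 0) =
        (∑ b ∈ Finset.range M, ∑ b' ∈ Finset.range M,
        (if b + b' + 1 = a then MvPolynomial.C (((b : R) + 1) * (b' + 1)) * DD b b' else 0)) +
        MvPolynomial.C h * r := by
      refine ⟨∑ b ∈ Finset.range M, ∑ b' ∈ Finset.range M, (if b + b' + 1 = a then
        MvPolynomial.C (((b : R) + 1) * c' b' + (b' + 1) * c' b + h * (c' b * c' b')) *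
          DD b b' else 0), ?_⟩
      simp only [Finset.mul_sum, ← Finset.sum_add_distrib]
      refine Finset.sum_congr rfl fun b _ => Finset.sum_congr rfl fun b' _ => ?_
      split_ifs with hb
      · rw [hc, hc, MvPolynomial.smul_eq_C_mul]
        simp only [map_add, map_mul, map_one]
        ring
      · simp
    have hsplit : ∑ b ∈ Finset.range M, ∑ b' ∈ Finset.range M,
            (if b + b' + 1 = a then MvPolynomial.C (β * ((b : R) + 1 + (b' + 1))) *
                (x b * x b' * D a) +
              MvPolynomial.C (((b : R) + 1) * (b' + 1)) * (x a * DD b b') else 0) =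
        (∑ b ∈ Finset.range M, ∑ b' ∈ Finset.range M,
          (if b + b' + 1 = a then MvPolynomial.C (β * ((b : R) + 1 + (b' + 1))) *
                (x b * x b' * D a) else 0)) +
        x a * ∑ b ∈ Finset.range M, ∑ b' ∈ Finset.range M,
          (if b + b' + 1 = a then MvPolynomial.C (((b : R) + 1) * (b' + 1)) * DD b b' else 0) := by
      simp only [Finset.mul_sum, ← Finset.sum_add_distrib]
      refine Finset.sum_congr rfl fun b _ => Finset.sum_congr rfl fun b' _ => ?_
      split_ifs with hb
      · ring
      · simp
    rw [hg₁, hg₂, hsplit, hr₂]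
    simp only [MvPolynomial.smul_eq_C_mul]
    generalize (∑ b ∈ Finset.range M, ∑ b' ∈ Finset.range M,
        (if b + b' + 1 = a then σ b * σ b' else 0)) = S₂ at *
    generalize (∑ b ∈ Finset.range M, ∑ b' ∈ Finset.range M,
        (if b + b' + 1 = a then MvPolynomial.C (β * ((b : R) + 1 + (b' + 1))) *
                (x b * x b' * D a) else 0)) = Y₂ at *
    generalize (∑ b ∈ Finset.range M, ∑ b' ∈ Finset.range M,
        (if b + b' + 1 = a then MvPolynomial.C (((b : R) + 1) * (b' + 1)) * DD b b' else 0)) =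
        D₂ at *
    have e1 := hσc a
    have e2 := hσ1 a
    -- The witness collects every product of order at least four.
    refine ⟨ρ' a * D a + MvPolynomial.C (half R) * (r₁ + σ a * r₂ + σ' a * D₂) +
      (σ a * g₂ + MvPolynomial.C (half R) ^ 2 * S₂ * (D₂ + MvPolynomial.C h * r₂) +
        g₁ * MvPolynomial.C (c a) * D a) +
      MvPolynomial.C h * (MvPolynomial.C (half R) * S₂ * g₂ +
        g₁ * MvPolynomial.C (half R) * (D₂ + MvPolynomial.C h * r₂)) +
      MvPolynomial.C h ^ 2 * (g₁ * g₂), ?_⟩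
    simp only [map_add, map_mul, map_pow, map_one, map_sub] at e1 e2 hr₁ ⊢
    linear_combination (MvPolynomial.C h ^ 2 * D a) * e1 +
      (MvPolynomial.C h ^ 3 * MvPolynomial.C (half R)) * hr₁ +
      (MvPolynomial.C h ^ 3 * MvPolynomial.C (half R) * D₂) * e2
  choose! G hG using hterm
  refine ⟨∑ a ∈ Finset.range M, G a, ?_⟩
  rw [zeroMode_eq i _ _ (M := M + 1) (fun j hj => hlow j (by omega)), Finset.sum_range_succ',
    Finset.sum_congr rfl hG, lower_zero, coeff_zero_eq_constantCoeff_apply,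
    constantCoeff_formalExp, one_mul]
  simp only [Finset.sum_add_distrib, ← Finset.mul_sum]
  rw [sum_sum_ite_add_succ_eq (fun b b' a => MvPolynomial.C (β * ((b : R) + 1 + (b' + 1))) *
                (x b * x b' * D a) +
              MvPolynomial.C (((b : R) + 1) * (b' + 1)) * (x a * DD b b'))]
  · have e : (∑ k ∈ Finset.Iio i, ∑ a ∈ Finset.range M,
        MvPolynomial.C (((a : R) + 1) ^ 2) * (MvPolynomial.X (k, a.succPNat) *
          MvPolynomial.pderiv (i, a.succPNat) f)) =
        ∑ a ∈ Finset.range M, MvPolynomial.C (((a : R) + 1) ^ 2) * y a * D a := by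
      rw [Finset.sum_comm]
      refine Finset.sum_congr rfl fun a _ => ?_
      rw [hy, Finset.mul_sum, Finset.sum_mul]
      exact Finset.sum_congr rfl fun k _ => (mul_assoc _ _ _).symm
    rw [cubicPart, degreePart, e]
    simp only [add_mul, Finset.sum_add_distrib, mul_assoc]
    ring
  · intro b b' hb
    rw [hD, hDD]
    dsimp only
    rw [pderiv_eq_zero_of_bound hv i (by omega), pderiv_pderiv_eq_zero_of_bound hv i hb]
    simp

end ZeroModeExpansion

/-! ### Expansion of X₀ for exponential parameters. -/

section RingExpansion

variable {N : ℕ} {R : Type} [CommRing R] [Algebra ℚ R]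

/-- `e` agrees with `exp (h x)` up to the third order in `h`. -/
def IsExp (h x e : R) : Prop := ∃ r, e = 1 + h * x + h ^ 2 * (half R * x ^ 2) + h ^ 3 * r

theorem IsExp.one (h : R) : IsExp h 0 1 := ⟨0, by ring⟩

theorem IsExp.mul {h x y e f : R} (he : IsExp h x e) (hf : IsExp h y f) :
    IsExp h (x + y) (e * f) := by
  obtain ⟨r, rfl⟩ := he
  obtain ⟨r', rfl⟩ := hf
  refine ⟨r' + r + half R * x * y ^ 2 + half R * x ^ 2 * y +
    h * (x * r' + half R ^ 2 * x ^ 2 * y ^ 2 + r * y) +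
    h ^ 2 * (half R * x ^ 2 * r' + r * half R * y ^ 2) + h ^ 3 * (r * r'), ?_⟩
  linear_combination (-(h ^ 2 * x * y)) * two_mul_half (R := R)

theorem IsExp.pow {h x e : R} (he : IsExp h x e) (n : ℕ) : IsExp h (n * x) (e ^ n) := by
  induction n with
  | zero => simpa using IsExp.one h
  | succ n ih =>
    rw [pow_succ]
    convert ih.mul he using 1
    push_cast
    ring

theorem IsExp.second {h x e : R} (he : IsExp h x e) : ∃ r, e = 1 + h * x + h ^ 2 * r := by
  obtain ⟨r, rfl⟩ := he
  exact ⟨half R * x ^ 2 + h * r, by ring⟩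

theorem IsExp.first {h x e : R} (he : IsExp h x e) : ∃ r, e = 1 + h * r := by
  obtain ⟨r, rfl⟩ := he.second
  exact ⟨x + h * r, by ring⟩

/-- The common factor (1 - τⁿ)/n is hβ - h²β²n/2 + O(h³). The factor y depending on the family is
kept apart: for k = i it must later cancel exactly against a power of s', and for k < i it is (1 -
s^{4n})s^{2kn} = h(1 - β)n + O(h²), because s⁴ plays the role of t/q. -/
theorem IsExp.exists_creationCoeff {h β x τ s : R} (hτ : IsExp h (-β) τ) (hs : IsExp h x s)
    (hx : 4 * x = β - 1) (i k : Fin N) (a : ℕ) :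
    ∃ r w y, creationCoeff τ s i k a.succPNat =
        h * ((β - h * (half R * β ^ 2 * ((a : R) + 1)) + h ^ 2 * r) * y) ∧
      (k = i → y = s ^ (2 * (i : ℕ) * (a + 1))) ∧
      (k < i → y = h * ((1 - β) * ((a : R) + 1)) + h ^ 2 * w) ∧ (i < k → y = 0) := by
  obtain ⟨v, hv⟩ : ∃ v : R, v = algebraMap ℚ R ((a : ℚ) + 1)⁻¹ := ⟨_, rfl⟩
  have hv1 : v * ((a : R) + 1) = 1 := by
    have : ((a : R) + 1) = algebraMap ℚ R ((a : ℚ) + 1) := by simp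
    rw [hv, this, ← map_mul, inv_mul_cancel₀ (by positivity), map_one]
  obtain ⟨r, hr⟩ := hτ.pow (a + 1)
  have hcr : ∀ z : R, ((((a.succPNat : ℕ) : ℚ))⁻¹ • ((1 - τ ^ (a.succPNat : ℕ)) * z) : R) =
      h * ((β - h * (half R * β ^ 2 * ((a : R) + 1)) + h ^ 2 * (-(v * r))) * z) := by
    intro z
    rw [Nat.succPNat_coe, Nat.succ_eq_add_one, hr, Algebra.smul_def, Nat.cast_succ, ← hv]
    push_cast
    linear_combination (h * z * (β - h * (half R * β ^ 2 * ((a : R) + 1)))) * hv1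
  rcases lt_trichotomy k i with hk | hk | hk
  · obtain ⟨r₁, hr₁⟩ := (hs.pow (4 * (a + 1))).second
    obtain ⟨r₂, hr₂⟩ := (hs.pow (2 * (k : ℕ) * (a + 1))).first
    refine ⟨-(v * r), (1 - β) * (a + 1) * r₂ - r₁ - h * r₁ * r₂,
      (1 - s ^ (4 * (a + 1))) * s ^ (2 * (k : ℕ) * (a + 1)), ?_, fun h => absurd h hk.ne, fun _ => ?_,
      fun h => absurd h hk.not_gt⟩
    · rw [creationCoeff, if_pos hk, hcr, Nat.succPNat_coe, Nat.succ_eq_add_one]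
    · rw [hr₁, hr₂]
      push_cast
      linear_combination (-((a + 1) * h + h ^ 2 * (a + 1) * r₂)) * hx
  · refine ⟨-(v * r), 0, s ^ (2 * (i : ℕ) * (a + 1)), ?_, fun _ => rfl, fun h => absurd hk h.ne,
      fun h => absurd hk h.ne'⟩
    rw [creationCoeff, if_neg (by simp [hk]), if_pos hk, hcr, Nat.succPNat_coe,
      Nat.succ_eq_add_one]
  · refine ⟨0, 0, 0, ?_, fun h => absurd h hk.ne', fun h => absurd h hk.not_gt, fun _ => rfl⟩
    rw [creationCoeff, if_neg hk.not_gt, if_neg hk.ne', mul_zero, smul_zero, mul_zero, mul_zero]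

theorem exists_zeroMode_creation_expansion {h β x q τ s s' : R} (hq : IsExp h 1 q)
    (hτ : IsExp h (-β) τ) (hs : IsExp h x s) (hx : 4 * x = β - 1) (hs' : IsExp h (-x) s')
    (hss : s * s' = 1) (i : Fin N) {f : MvPolynomial (Fin N × ℕ+) R} {M : ℕ}
    (hlow : ∀ n, M < n → lower i (annihilationCoeff q s' i) n f = 0)
    (hv : ∀ v ∈ f.vars, 2 * (v.2 : ℕ) ≤ M) :
    ∃ g, zeroMode i (creation τ s i) (annihilationCoeff q s' i) f =
      f + MvPolynomial.C (h ^ 2 * β) * degreePart M i f +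
        MvPolynomial.C (h ^ 3 * β) * cubicPart M β i f + MvPolynomial.C (h ^ 4) * g := by
  have h1 := fun k a => hτ.exists_creationCoeff hs hx i k a
  choose r w y hcoef hi hlt hgt using h1
  have h2 : ∀ a : ℕ, ∃ ρ, q ^ (a + 1) - 1 =
      h * (((a : R) + 1) + h * (half R * ((a : R) + 1) ^ 2) + h ^ 2 * ρ) := by
    intro a
    obtain ⟨ρ, hρ⟩ := hq.pow (a + 1)
    refine ⟨ρ, ?_⟩
    rw [hρ]
    push_cast
    ring
  choose ρ hρ using h2
  have hsp : ∀ a : ℕ, ∃ r, s' ^ (2 * (i : ℕ) * (a + 1)) = 1 + h * r := fun a =>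
    (hs'.pow _).first
  have hsn : ∀ a : ℕ, ∃ r, s ^ (2 * (i : ℕ) * (a + 1)) = 1 + h * r := fun a =>
    (hs.pow _).first
  refine exists_zeroMode_expansion i
    (α := fun k a => (β - h * (half R * β ^ 2 * ((a : R) + 1)) + h ^ 2 * r k a) * y k a)
    (c := fun a => (((a : R) + 1) + h * (half R * ((a : R) + 1) ^ 2) + h ^ 2 * ρ a) *
      s' ^ (2 * (i : ℕ) * (a + 1))) ?_ ?_ ?_ ?_ ?_ hlow hv
  · intro a
    rw [Finset.smul_sum]
    refine Finset.sum_congr rfl fun k _ => ?_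
    rw [hcoef, map_mul, mul_assoc, MvPolynomial.C_mul']
  · intro a
    rw [annihilationCoeff, Nat.succPNat_coe, Nat.succ_eq_add_one, hρ, mul_assoc]
  · intro k a
    rcases lt_trichotomy k i with hk | hk | hk
    · refine ⟨(β - h * (half R * β ^ 2 * ((a : R) + 1)) + h ^ 2 * r k a) *
        ((1 - β) * ((a : R) + 1) + h * w k a), ?_⟩
      rw [if_neg hk.ne, hlt k a hk]
      ring
    · obtain ⟨t, ht⟩ := hsn a
      refine ⟨β * t + (-(half R * β ^ 2 * ((a : R) + 1)) + h * r k a) * (1 + h * t), ?_⟩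
      rw [if_pos hk, hi k a hk, ht]
      ring
    · refine ⟨0, ?_⟩
      rw [if_neg hk.ne', hgt k a hk]
      ring
  · intro a
    obtain ⟨t, ht⟩ := hsp a
    refine ⟨((a : R) + 1) * t + (half R * ((a : R) + 1) ^ 2 + h * ρ a) * (1 + h * t), ?_⟩
    rw [ht]
    ring
  · intro k a
    rcases lt_trichotomy k i with hk | hk | hk
    · obtain ⟨t, ht⟩ := hsp a
      refine ⟨β * w k a * ((a : R) + 1) + (-(half R * β ^ 2 * ((a : R) + 1)) + h * r k a) *
          ((1 - β) * ((a : R) + 1) + h * w k a) * ((a : R) + 1) +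
        (β - h * (half R * β ^ 2 * ((a : R) + 1)) + h ^ 2 * r k a) *
          ((1 - β) * ((a : R) + 1) + h * w k a) *
          (((a : R) + 1) * t + (half R * ((a : R) + 1) ^ 2 + h * ρ a) * (1 + h * t)), ?_⟩
      rw [if_neg hk.ne, if_neg hk.ne, if_pos hk, hlt k a hk, ht]
      ring
    -- In the family i the powers of s and s' cancel, so σc comes from (β - hβ²n/2)(n + hn²/2),
    -- whose term of order h is β(1 - β)n²/2.
    · have hone : s ^ (2 * (i : ℕ) * (a + 1)) * s' ^ (2 * (i : ℕ) * (a + 1)) = 1 := by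
        rw [← mul_pow, hss, one_pow]
      refine ⟨β * ρ a + r k a * ((a : R) + 1) - half R * β ^ 2 * ((a : R) + 1) *
          (half R * ((a : R) + 1) ^ 2) + h * (r k a * (half R * ((a : R) + 1) ^ 2) -
            half R * β ^ 2 * ((a : R) + 1) * ρ a) + h ^ 2 * (r k a * ρ a), ?_⟩
      rw [if_pos hk, if_pos hk, if_neg (by simp [hk]), hi k a hk]
      linear_combination ((β - h * (half R * β ^ 2 * ((a : R) + 1)) + h ^ 2 * r k a) *
        (((a : R) + 1) + h * (half R * ((a : R) + 1) ^ 2) + h ^ 2 * ρ a)) * hone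
    · refine ⟨0, ?_⟩
      rw [if_neg hk.ne', if_neg hk.ne', if_neg hk.not_gt, hgt k a hk]
      ring

/-- Two derivations agree on f once they agree on the variables occurring in f. -/
theorem euler_eq_sum_degreePart {N : ℕ} {R : Type} [CommRing R]
    {f : MvPolynomial (Fin N × ℕ+) R} {M : ℕ}
    (hv : ∀ v ∈ f.vars, 2 * (v.2 : ℕ) ≤ M) : euler N R f = ∑ i, degreePart M i f := by
  set D : Derivation R (MvPolynomial (Fin N × ℕ+) R) (MvPolynomial (Fin N × ℕ+) R) :=
    ∑ i, ∑ a ∈ Finset.range M, (MvPolynomial.C ((a : R) + 1) * MvPolynomial.X (i, a.succPNat)) •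
      MvPolynomial.pderiv (i, a.succPNat) with hD
  have hDf : ∀ g, D g = ∑ i, ∑ a ∈ Finset.range M,
      MvPolynomial.C ((a : R) + 1) * (MvPolynomial.X (i, a.succPNat) *
        MvPolynomial.pderiv (i, a.succPNat) g) := by
    intro g
    have happ : ∀ {ι : Type} (t : Finset ι) (F : ι → Derivation R (MvPolynomial (Fin N × ℕ+) R)
        (MvPolynomial (Fin N × ℕ+) R)), (∑ j ∈ t, F j) g = ∑ j ∈ t, F j g := by
      classical
      intro ι t F
      induction t using Finset.induction_on with
      | empty => simp
      | insert a t ha ih =>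
        rw [Finset.sum_insert ha, Derivation.add_apply, ih, Finset.sum_insert ha]
    simp only [hD, happ, Derivation.smul_apply, smul_eq_mul, mul_assoc]
  change euler N R f = ∑ i, ∑ a ∈ Finset.range M, _
  rw [← hDf]
  refine MvPolynomial.derivation_eq_of_forall_mem_vars fun v hvf => ?_
  obtain ⟨j, n⟩ := v
  have hn := hv _ hvf
  rw [hDf, euler, MvPolynomial.mkDerivation_X, Finset.sum_eq_single j,
    Finset.sum_eq_single n.natPred]
  · rw [PNat.succPNat_natPred, MvPolynomial.pderiv_X_self, mul_one, MvPolynomial.C_mul']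
    congr 1
    rw [← Nat.cast_succ]
    congr 1
    exact (PNat.natPred_add_one n).symm
  · intro a _ ha
    rw [MvPolynomial.pderiv_X_of_ne, mul_zero, mul_zero]
    intro h
    refine ha ?_
    rw [(Prod.mk.inj h).2, Nat.natPred_succPNat]
  · intro h
    refine absurd (Finset.mem_range.2 ?_) h
    have := PNat.natPred_add_one n
    simp only at hn
    omega
  · intro i _ hi
    refine Finset.sum_eq_zero fun a _ => ?_
    rw [MvPolynomial.pderiv_X_of_ne, mul_zero, mul_zero]
    exact fun h => hi (Prod.mk.inj h).1.symm
  · simp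

/-- Multiplying the zero modes by u_i = 1 + hu'_i + O(h²) leaves the Euler operator at order h² and
puts u'_i times the degree of the family i at order h³, where it completes H_β. -/
theorem exists_ringX0_expansion {h β x q τ s s' : R} {u u' : Fin N → R} (hq : IsExp h 1 q)
    (hτ : IsExp h (-β) τ) (hs : IsExp h x s) (hx : 4 * x = β - 1) (hs' : IsExp h (-x) s')
    (hss : s * s' = 1) (hu : ∀ i, IsExp h (u' i) (u i))
    {f : MvPolynomial (Fin N × ℕ+) R} {M : ℕ}
    (hlow : ∀ i n, M < n → lower i (annihilationCoeff q s' i) n f = 0)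
    (hv : ∀ v ∈ f.vars, 2 * (v.2 : ℕ) ≤ M) :
    ∃ g, ringX0 q τ s s' u f = MvPolynomial.C (∑ i, u i) * f +
      MvPolynomial.C (h ^ 2 * β) * euler N R f +
        MvPolynomial.C (h ^ 3 * β) * ham M β u' f + MvPolynomial.C (h ^ 4) * g := by
  choose g hg using fun i => exists_zeroMode_creation_expansion hq hτ hs hx hs' hss i (hlow i) hv
  choose r hr using fun i => (hu i).second
  refine ⟨∑ i, (MvPolynomial.C (u i) * g i + MvPolynomial.C (β * r i) * degreePart M i f +
    MvPolynomial.C (β * (u' i + h * r i)) * cubicPart M β i f), ?_⟩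
  rw [ringX0, ham, euler_eq_sum_degreePart hv, map_sum, Finset.sum_mul, Finset.mul_sum,
    Finset.mul_sum, Finset.mul_sum, ← Finset.sum_add_distrib, ← Finset.sum_add_distrib,
    ← Finset.sum_add_distrib]
  refine Finset.sum_congr rfl fun i _ => ?_
  rw [hg, MvPolynomial.smul_eq_C_mul]
  have := congrArg (MvPolynomial.C (σ := Fin N × ℕ+)) (hr i)
  simp only [map_add, map_mul, map_pow, map_one] at this ⊢
  linear_combination (MvPolynomial.C h ^ 2 * MvPolynomial.C β * degreePart M i f +
    MvPolynomial.C h ^ 3 * MvPolynomial.C β * cubicPart M β i f) * this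

end RingExpansion

/-! ### Linearity and base change of the truncated H_β. -/

section Hamiltonian

variable {N : ℕ} {R : Type} [CommRing R] [Algebra ℚ R]

theorem ham_map {R' : Type} [CommRing R'] [Algebra ℚ R'] (φ : R →+* R') (M : ℕ) (β : R)
    (u : Fin N → R) (f : MvPolynomial (Fin N × ℕ+) R) :
    MvPolynomial.map φ (ham M β u f) =
      ham M (φ β) (fun i => φ (u i)) (MvPolynomial.map φ f) := by
  simp only [ham, cubicPart, degreePart, map_sum, map_add, map_mul, MvPolynomial.map_C,
    MvPolynomial.map_X, MvPolynomial.pderiv_map, map_half, map_natCast, map_one, map_sub, map_pow]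

theorem ham_add (M : ℕ) (β : R) (u : Fin N → R) (f g : MvPolynomial (Fin N × ℕ+) R) :
    ham M β u (f + g) = ham M β u f + ham M β u g := by
  simp only [ham, cubicPart, degreePart, map_add, mul_add, Finset.sum_add_distrib]
  ring

theorem ham_smul (M : ℕ) (β : R) (u : Fin N → R) (c : R) (f : MvPolynomial (Fin N × ℕ+) R) :
    ham M β u (c • f) = c • ham M β u f := by
  simp only [ham, cubicPart, degreePart, Derivation.map_smul, mul_smul_comm, ← Finset.smul_sum,
    ← smul_add]

theorem ham_sum (M : ℕ) (β : R) (u : Fin N → R) {ι : Type} (t : Finset ι) (c : ι → R)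
    (F : ι → MvPolynomial (Fin N × ℕ+) R) :
    ham M β u (∑ j ∈ t, c j • F j) = ∑ j ∈ t, c j • ham M β u (F j) := by
  classical
  induction t using Finset.induction_on with
  | empty => simpa using ham_smul M β u 0 0
  | insert a t ha ih => rw [Finset.sum_insert ha, Finset.sum_insert ha, ham_add, ham_smul, ih]

theorem entry_ham_map {R' : Type} [CommRing R'] [Algebra ℚ R'] (φ : R →+* R') (M : ℕ) (β : R)
    (u : Fin N → R) (mu nu : PtnTuple N) :
    φ (entry (ham M β u) mu nu) = entry (ham M (φ β) fun i => φ (u i)) mu nu := by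
  rw [entry, ← cf_map, ham_map, map_mono, entry]

end Hamiltonian

/-! ### Comparison with the infinite sums defining H_β. -/

section FieldHamiltonian

theorem finsum_pnat_eq {W : Type} [AddCommMonoid W] {M : ℕ} {F : ℕ+ → W}
    (hF : ∀ a : ℕ, M ≤ a → F a.succPNat = 0) :
    ∑ᶠ n, F n = ∑ a ∈ Finset.range M, F a.succPNat := by
  rw [finsum_eq_finsetSum_of_support_subset _
    (s := (Finset.range M).map ⟨Nat.succPNat, Nat.succPNat_injective⟩), Finset.sum_map]
  · rfl
  · intro n hn
    rw [Finset.mem_coe, Finset.mem_map]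
    refine ⟨n.natPred, ?_, PNat.succPNat_natPred n⟩
    rw [Finset.mem_range]
    by_contra hc
    refine hn ?_
    rw [← PNat.succPNat_natPred n]
    exact hF _ (not_lt.1 hc)

theorem finsum_pnat_prod_eq {W : Type} [AddCommMonoid W] {M : ℕ} {F : ℕ+ × ℕ+ → W}
    (hF : ∀ a b : ℕ, M ≤ a ∨ M ≤ b → F (a.succPNat, b.succPNat) = 0) :
    ∑ᶠ n, F n = ∑ a ∈ Finset.range M, ∑ b ∈ Finset.range M, F (a.succPNat, b.succPNat) := by
  rw [finsum_eq_finsetSum_of_support_subset _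
    (s := (Finset.range M).map ⟨Nat.succPNat, Nat.succPNat_injective⟩ ×ˢ
      (Finset.range M).map ⟨Nat.succPNat, Nat.succPNat_injective⟩), Finset.sum_product,
    Finset.sum_map]
  · refine Finset.sum_congr rfl fun a _ => ?_
    rw [Finset.sum_map]
    rfl
  · rintro ⟨n, m⟩ hn
    rw [Finset.mem_coe, Finset.mem_product, Finset.mem_map, Finset.mem_map]
    have key : ¬ (M ≤ n.natPred ∨ M ≤ m.natPred) := by
      intro hc
      refine hn ?_
      have := hF _ _ hc
      rwa [PNat.succPNat_natPred, PNat.succPNat_natPred] at this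
    rw [not_or, not_le, not_le] at key
    exact ⟨⟨n.natPred, Finset.mem_range.2 key.1, PNat.succPNat_natPred n⟩,
      ⟨m.natPred, Finset.mem_range.2 key.2, PNat.succPNat_natPred m⟩⟩

variable {N : ℕ} {K : Type} [Field K] [CharZero K]

theorem half_eq : half K = 1 / 2 := by
  rw [half, one_div, map_inv₀, map_ofNat]

/-- All derivatives beyond the bound vanish on f, so each infinite sum is its truncation. Indices
are shifted by one: n = a + 1, and n + m corresponds to a + b + 1. -/
theorem jackHamiltonian_eq_ham (β : K) (u : Fin N → K) {f : SymN N K} {M : ℕ}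
    (hv : ∀ v ∈ f.vars, 2 * (v.2 : ℕ) ≤ M) : jackHamiltonian β u f = ham M β u f := by
  have hdp : ∀ i (n : ℕ+) (g : SymN N K), dp i n g = MvPolynomial.pderiv (i, n) g :=
    fun _ _ _ => rfl
  have hsucc : ∀ a b : ℕ, a.succPNat + b.succPNat = (a + b + 1).succPNat := by
    intro a b
    apply PNat.eq
    simp [PNat.add_coe]
    omega
  rw [jackHamiltonian, ham, ← Finset.sum_add_distrib]
  refine Finset.sum_congr rfl fun i _ => ?_
  rw [jackDiag, finsum_pnat_prod_eq (M := M), finsum_pnat_eq (M := M), cubicPart, degreePart]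
  · have hoff : ∀ j, jackOffDiag β i j f = MvPolynomial.C (1 - β) * ∑ a ∈ Finset.range M,
        MvPolynomial.C (((a : K) + 1) ^ 2) * (MvPolynomial.X (j, a.succPNat) *
          MvPolynomial.pderiv (i, a.succPNat) f) := by
      intro j
      rw [jackOffDiag, finsum_pnat_eq (M := M), MvPolynomial.smul_eq_C_mul]
      · congr 1
        refine Finset.sum_congr rfl fun a _ => ?_
        rw [MvPolynomial.smul_eq_C_mul, p, hdp, Nat.succPNat_coe, Nat.cast_succ]
      · intro a ha
        rw [hdp, pderiv_eq_zero_of_bound hv i (by omega), mul_zero, smul_zero]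
    simp only [hoff, hdp, p, MvPolynomial.smul_eq_C_mul, Nat.succPNat_coe, Nat.cast_succ, hsucc,
      half_eq, ← Finset.mul_sum]
    rw [Finset.mul_sum (Finset.range M) _ (MvPolynomial.C (u i)), Finset.mul_sum (Finset.range M)
      (fun a : ℕ => MvPolynomial.C (1 / 2 * ((a : K) + 1) ^ 2) * _)]
    have : ∀ (A B C D E : SymN N K), C = D + E → A + C + B = A + (D + B) + E := by
      intro A B C D E h
      rw [h]; ring
    apply this
    rw [← Finset.sum_add_distrib]
    refine Finset.sum_congr rfl fun a _ => ?_
    rw [← mul_assoc (MvPolynomial.C (1 - β)), ← mul_assoc (MvPolynomial.C (u i)), ← add_mul, ← map_mul, ← map_mul,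
      ← map_add]
    congr 2
    ring
  · intro a ha
    rw [hdp, pderiv_eq_zero_of_bound hv i (by omega), mul_zero, smul_zero]
  · intro a b hab
    dsimp only
    rw [hdp, hdp, hdp, hsucc, pderiv_eq_zero_of_bound hv i (by omega),
      pderiv_pderiv_eq_zero_of_bound hv i (by omega)]
    simp

end FieldHamiltonian

/-! ### Truncation bounds uniform in the ring. -/

section Bound

variable {N : ℕ}

/-- All operators in question may be truncated at `M` on `m_ν`. -/
def IsBound (M : ℕ) (nu : PtnTuple N) : Prop :=
  ∀ (R : Type) [CommRing R] [Algebra ℚ R], (∀ v ∈ (mono R nu).vars, 2 * (v.2 : ℕ) ≤ M) ∧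
    ∀ (γ : ℕ+ → R) (i : Fin N) (n : ℕ), M < n → lower i γ n (mono R nu) = 0

/-- `m_ν` is defined over ℚ, so its variables are bounded uniformly. For the shifts, γ is first
taken to consist of indeterminates; every other γ is a specialization. -/
theorem exists_isBound_of_le (nu : PtnTuple N) : ∃ M₀, ∀ M, M₀ ≤ M → IsBound M nu := by
  classical
  set c : ℕ+ → MvPolynomial ℕ+ ℚ := MvPolynomial.X with hc
  refine ⟨(∑ v ∈ (mono ℚ nu).vars, 2 * (v.2 : ℕ)) +
    ∑ i, (shift i c (mono (MvPolynomial ℕ+ ℚ) nu)).natDegree, fun M hM R _ _ => ⟨?_, ?_⟩⟩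
  · intro v hv
    rw [← map_mono (algebraMap ℚ R)] at hv
    have := Finset.single_le_sum (f := fun v : Fin N × ℕ+ => 2 * (v.2 : ℕ))
      (fun _ _ => Nat.zero_le _) (MvPolynomial.vars_map _ _ hv)
    omega
  · intro γ i n hn
    have h1 : lower i c n (mono (MvPolynomial ℕ+ ℚ) nu) = 0 := by
      refine lower_eq_zero_of_natDegree_lt i c _ ?_
      have := Finset.single_le_sum
        (f := fun i => (shift i c (mono (MvPolynomial ℕ+ ℚ) nu)).natDegree)
        (fun _ _ => Nat.zero_le _) (Finset.mem_univ i)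
      omega
    have h2 := lower_map (MvPolynomial.aeval γ : MvPolynomial ℕ+ ℚ →ₐ[ℚ] R).toRingHom i c n
      (mono (MvPolynomial ℕ+ ℚ) nu)
    rw [h1, map_zero, map_mono] at h2
    rw [h2]
    congr 2
    funext m
    simp [hc]

theorem exists_isBound {ι : Type} [Finite ι] (nu : ι → PtnTuple N) :
    ∃ M, ∀ j, IsBound M (nu j) := by
  cases nonempty_fintype ι
  choose M hM using fun j => exists_isBound_of_le (nu j)
  refine ⟨∑ j, M j, fun j => hM j _ ?_⟩
  exact Finset.single_le_sum (f := M) (fun _ _ => Nat.zero_le _) (Finset.mem_univ j)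

end Bound

/-! ### Expansion of matrix entries and of eigenvalues. -/

section EntryExpansion

variable {N : ℕ} {R : Type} [CommRing R] [Algebra ℚ R]

open Classical in
-- The Euler operator acts on `m_ν` as its degree, so up to order h² only multiples of the identity
-- matrix occur.
theorem exists_entry_expansion {h β x q τ s s' : R} {u u' : Fin N → R} (hq : IsExp h 1 q)
    (hτ : IsExp h (-β) τ) (hs : IsExp h x s) (hx : 4 * x = β - 1) (hs' : IsExp h (-x) s')
    (hss : s * s' = 1) (hu : ∀ i, IsExp h (u' i) (u i)) {M : ℕ} {nu : PtnTuple N}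
    (hM : IsBound M nu) (mu : PtnTuple N) :
    ∃ g, entry (ringX0 q τ s s' u) mu nu =
      (∑ i, u i + h ^ 2 * (β * ((∑ i, (nu i).size : ℕ) : R))) * (if mu = nu then 1 else 0) +
        h ^ 3 * (β * entry (ham M β u') mu nu) + h ^ 4 * g := by
  obtain ⟨hv, hlow⟩ := hM R
  obtain ⟨g, hg⟩ := exists_ringX0_expansion hq hτ hs hx hs' hss hu (fun i n hn => hlow _ i n hn) hv
  refine ⟨cf (expOf mu) g, ?_⟩
  rw [entry, hg]
  simp only [MvPolynomial.C_mul', map_add, map_smul, smul_eq_mul]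
  rw [cf_euler, cf_expOf_mono, (rearranges_expOf mu).degree_eq, entry]
  split_ifs with h
  · rw [h]
    push_cast
    ring
  · ring

/-- `e'_λ` over a commutative `ℚ`-algebra. -/
def jackValue (β : R) (u : Fin N → R) (lam : PtnTuple N) : R :=
  ∑ i, (lam i).1.sum fun k x => (x : R) * (u i + half R * ((x : R) - (2 * (k : R) + 1) * β))

theorem jackValue_map {R' : Type} [CommRing R'] [Algebra ℚ R'] (φ : R →+* R') (β : R)
    (u : Fin N → R) (lam : PtnTuple N) :
    φ (jackValue β u lam) = jackValue (φ β) (fun i => φ (u i)) lam := by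
  simp only [jackValue, map_sum, Finsupp.sum, map_mul, map_add, map_sub, map_natCast, map_one,
    map_half, map_ofNat]

theorem jackValue_eq {K : Type} [Field K] [CharZero K] (β : K) (u : Fin N → K)
    (lam : PtnTuple N) : jackValue β u lam = jackEigenvalue β u lam := by
  simp only [jackValue, jackEigenvalue, half_eq]
  refine Finset.sum_congr rfl fun i _ => Finset.sum_congr rfl fun k _ => ?_
  ring

/-- Independently of the operator expansion, the known diagonal entries of X₀ are expanded.
Comparing the two identifies the diagonal of H_β. -/
theorem exists_macEigenvalue_expansion {h β q τ : R} {u u' : Fin N → R} (hq : IsExp h 1 q)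
    (hτ : IsExp h (-β) τ) (hu : ∀ i, IsExp h (u' i) (u i)) (lam : PtnTuple N) :
    ∃ g, ∑ i, u i * macEigenvalue q τ (lam i) =
      ∑ i, u i + h ^ 2 * (β * ((∑ i, (lam i).size : ℕ) : R)) +
        h ^ 3 * (β * jackValue β u' lam) + h ^ 4 * g := by
  have key : ∀ i (k x : ℕ), ∃ r, u i * ((1 - τ) * (τ ^ k * (q ^ x - 1))) = h ^ 2 * (β * x) +
      h ^ 3 * (β * ((x : R) * (u' i + half R * ((x : R) - (2 * (k : R) + 1) * β)))) +
        h ^ 4 * r := by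
    intro i k x
    obtain ⟨a, ha⟩ := (hu i).second
    obtain ⟨b, hb⟩ := hτ
    obtain ⟨c, hc⟩ := (IsExp.pow ⟨b, hb⟩ k).second
    obtain ⟨d, hd⟩ := hq.pow x
    have e1 : u i = 1 + h * (u' i + h * a) := by rw [ha]; ring
    have e2 : 1 - τ = h * (β + h * (-(half R * β ^ 2)  - h * b)) := by rw [hb]; ring
    have e3 : τ ^ k = 1 + h * (-(k * β) + h * c) := by rw [hc]; ring
    have e4 : q ^ x - 1 = h * (x + h * (half R * x ^ 2 + h * d)) := by rw [hd]; ring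
    have two := two_mul_half (R := R)
    rw [e1, e2, e3, e4]
    generalize hA : u' i + h * a = A
    generalize hB : -(half R * β ^ 2) - h * b = B
    generalize hC : -((k : R) * β) + h * c = C
    generalize hD : half R * (x : R) ^ 2 + h * d = D
    refine ⟨a * β * x - b * x + c * β * x + d * β +
      A * B * x + A * C * β * x + A * D * β + B * C * x + B * D + C * D * β +
      h * (A * B * C * x + A * B * D + A * C * D * β + B * C * D) + h ^ 2 * (A * B * C * D), ?_⟩
    rw [← hA, ← hB, ← hC, ← hD]
    linear_combination (h ^ 3 * (k * β ^ 2 * x)) * two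
  choose r hr using key
  refine ⟨∑ i, (lam i).1.sum fun k x => r i k x, ?_⟩
  rw [Nat.cast_sum, jackValue, Finset.mul_sum, Finset.mul_sum, Finset.mul_sum, Finset.mul_sum,
    Finset.mul_sum, ← Finset.sum_add_distrib, ← Finset.sum_add_distrib, ← Finset.sum_add_distrib]
  refine Finset.sum_congr rfl fun i _ => ?_
  rw [macEigenvalue, mul_add, mul_one, Ptn.size]
  simp only [Finsupp.sum, Nat.cast_sum, Finset.mul_sum, hr, Finset.sum_add_distrib]
  ring

end EntryExpansion

/-! ### Expansions as functions of ħ near zero. -/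

section Bounded

open Asymptotics

/-- Functions which are bounded near `0`. -/
def boundedNear : Subalgebra ℂ (ℂ → ℂ) where
  carrier := {f | f =O[𝓝 0] fun _ => (1 : ℝ)}
  mul_mem' {f g} hf hg := by
    have : (fun x => f x * g x) =O[𝓝 0] fun _ => (1 : ℝ) := by
      simpa only [mul_one] using IsBigO.mul hf hg
    exact this
  add_mem' {f g} hf hg := IsBigO.add hf hg
  algebraMap_mem' c := isBigO_const_const c one_ne_zero _

theorem mem_boundedNear {f : ℂ → ℂ} : f ∈ boundedNear ↔ f =O[𝓝 0] fun _ => (1 : ℝ) := Iff.rfl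

/-- Evaluation at `z`. -/
def evalAt (z : ℂ) : boundedNear →+* ℂ :=
  (Pi.evalRingHom (fun _ : ℂ => ℂ) z).comp boundedNear.val.toRingHom

theorem evalAt_apply (z : ℂ) (f : boundedNear) : evalAt z f = f.1 z := rfl

/-- The function `z ↦ z`. -/
def idNear : boundedNear :=
  ⟨fun z => z, mem_boundedNear.2 (Tendsto.isBigO_one ℝ (continuousAt_id (x := (0 : ℂ))))⟩

/-- The function `z ↦ exp (c z)`. -/
def expNear (c : ℂ) : boundedNear :=
  ⟨fun z => Complex.exp (c * z), mem_boundedNear.2 (Tendsto.isBigO_one ℝ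
    (ContinuousAt.tendsto (f := fun z : ℂ => Complex.exp (c * z)) (by fun_prop)))⟩

/-- Taylor's formula with the remainder divided by z³ provides a bounded function, so the formal
expansions hold in `boundedNear` with h the identity function. -/
theorem isExp_expNear (c : ℂ) : IsExp idNear (algebraMap ℂ boundedNear c) (expNear c) := by
  have hb : (fun z : ℂ => (Complex.exp (c * z) - ∑ m ∈ Finset.range 3, (c * z) ^ m / m.factorial) *
      (z ^ 3)⁻¹) =O[𝓝 0] fun _ => (1 : ℝ) := by
    have h1 : Tendsto (fun z : ℂ => c * z) (𝓝 0) (𝓝 0) := by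
      have : Continuous fun z : ℂ => c * z := by fun_prop
      simpa using this.tendsto 0
    have h2 := (Complex.exp_sub_sum_range_isBigO_pow 3).comp_tendsto h1
    refine (h2.mul (isBigO_refl (fun z : ℂ => (z ^ 3)⁻¹) (𝓝 0))).trans ?_
    refine IsBigO.of_bound (‖c‖ ^ 3) (Eventually.of_forall fun z => ?_)
    -- At z = 0 the inverse is zero by convention, so the remainder vanishes there.
    rcases eq_or_ne z 0 with rfl | hz
    · simp
    · simp only [Function.comp_apply, norm_mul, norm_pow, norm_inv, mul_pow, norm_one, mul_one]
      rw [mul_assoc, mul_inv_cancel₀ (by positivity), mul_one]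
  refine ⟨⟨_, hb⟩, ?_⟩
  apply Subtype.ext
  funext z
  have hhalf : (half boundedNear).1 z = 1 / 2 := by
    rw [← evalAt_apply, map_half, half_eq]
  change Complex.exp (c * z) = 1 + z * c + z ^ 2 * ((half boundedNear).1 z * c ^ 2) + z ^ 3 * (_ * _)
  rw [hhalf]
  rcases eq_or_ne z 0 with rfl | hz
  · simp
  · simp only [Finset.sum_range_succ, Finset.range_zero, Finset.sum_empty]
    field_simp
    simp [Nat.factorial]
    ring

/-- The matrix of `X₀` at `q = e^z`, `t = e^{βz}`, `u_i = e^{u'_i z}`. -/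
def macMatrix {N : ℕ} (β : ℂ) (u' : Fin N → ℂ) (z : ℂ) (mu nu : PtnTuple N) : ℂ :=
  entry (ringX0 (Complex.exp (1 * z)) (Complex.exp (-β * z)) (Complex.exp ((β - 1) / 4 * z))
    (Complex.exp (-((β - 1) / 4) * z)) fun i => Complex.exp (u' i * z)) mu nu

theorem expNear_mul_expNear_neg (c : ℂ) : expNear c * expNear (-c) = 1 := by
  apply Subtype.ext
  funext z
  change Complex.exp (c * z) * Complex.exp (-c * z) = 1
  rw [← Complex.exp_add, neg_mul, add_neg_cancel, Complex.exp_zero]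

variable {N : ℕ}

theorem macMatrix_eq_evalAt (β : ℂ) (u' : Fin N → ℂ) (z : ℂ) (mu nu : PtnTuple N) :
    macMatrix β u' z mu nu = evalAt z (entry (ringX0 (expNear 1) (expNear (-β))
      (expNear ((β - 1) / 4)) (expNear (-((β - 1) / 4))) fun i => expNear (u' i)) mu nu) := by
  rw [entry_ringX0_map]
  rfl

open Classical in
-- The expansion over rings is applied in `boundedNear`, where its remainder is by construction
-- bounded near zero, and then evaluated at z.
theorem exists_macMatrix_expansion (β : ℂ) (u' : Fin N → ℂ) {M : ℕ} {nu : PtnTuple N}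
    (hM : IsBound M nu) (mu : PtnTuple N) :
    ∃ r : ℂ → ℂ, r =O[𝓝 0] (fun _ => (1 : ℝ)) ∧ ∀ z, macMatrix β u' z mu nu =
      (∑ i, Complex.exp (u' i * z) + z ^ 2 * (β * ((∑ i, (nu i).size : ℕ) : ℂ))) *
        (if mu = nu then 1 else 0) + z ^ 3 * (β * entry (ham M β u') mu nu) + z ^ 4 * r z := by
  obtain ⟨g, hg⟩ := exists_entry_expansion (h := idNear) (β := algebraMap ℂ _ β)
    (x := algebraMap ℂ _ ((β - 1) / 4)) (u' := fun i => algebraMap ℂ _ (u' i))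
    (by simpa using isExp_expNear 1) (by simpa using isExp_expNear (-β))
    (isExp_expNear ((β - 1) / 4))
    (by
      rw [show (4 : boundedNear) = algebraMap ℂ boundedNear 4 from (map_ofNat _ 4).symm, ← map_mul,
        ← map_one (algebraMap ℂ boundedNear), ← map_sub]
      congr 1
      ring)
    (by simpa only [map_neg] using isExp_expNear (-((β - 1) / 4))) (expNear_mul_expNear_neg _)
    (fun i => isExp_expNear (u' i)) hM mu
  refine ⟨g.1, g.2, fun z => ?_⟩
  rw [macMatrix_eq_evalAt, hg]
  simp only [map_add, map_mul, map_pow, map_sum, map_natCast, entry_ham_map]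
  rw [apply_ite (evalAt z), map_one, map_zero]
  rfl

theorem exists_macMatrix_self_expansion (β : ℂ) (u' : Fin N → ℂ) (lam : PtnTuple N) :
    ∃ r : ℂ → ℂ, r =O[𝓝 0] (fun _ => (1 : ℝ)) ∧ ∀ z, macMatrix β u' z lam lam =
      ∑ i, Complex.exp (u' i * z) + z ^ 2 * (β * ((∑ i, (lam i).size : ℕ) : ℂ)) +
        z ^ 3 * (β * jackEigenvalue β u' lam) + z ^ 4 * r z := by
  obtain ⟨g, hg⟩ := exists_macEigenvalue_expansion (h := idNear) (β := algebraMap ℂ _ β)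
    (u' := fun i => algebraMap ℂ _ (u' i))
    (by simpa using isExp_expNear 1) (by simpa using isExp_expNear (-β))
    (fun i => isExp_expNear (u' i)) lam
  refine ⟨g.1, g.2, fun z => ?_⟩
  rw [macMatrix_eq_evalAt, entry_ringX0_self (expNear_mul_expNear_neg _), hg]
  simp only [map_add, map_mul, map_pow, map_sum, map_natCast, jackValue_map]
  rw [jackValue_eq]
  rfl

theorem tendsto_div_pow_of_expansion {F r : ℂ → ℂ} {c : ℂ} (hr : r =O[𝓝 0] fun _ => (1 : ℝ))
    (hF : ∀ z, F z = z ^ 3 * c + z ^ 4 * r z) :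
    Tendsto (fun z => F z / z ^ 3) (𝓝[≠] 0) (𝓝 c) := by
  have h1 : Tendsto (fun z => c + z * r z) (𝓝[≠] 0) (𝓝 c) := by
    have h2 : Tendsto (fun z => z * r z) (𝓝 0) (𝓝 0) := by
      exact (tendsto_id (α := ℂ)).zero_mul_isBoundedUnder_le ((isBigO_one_iff ℝ).1 hr)
    simpa using (h2.mono_left nhdsWithin_le_nhds).const_add c
  refine h1.congr' ?_
  filter_upwards [self_mem_nhdsWithin] with z hz
  rw [hF]
  field_simp [show z ≠ 0 from hz]

end Bounded

/-! ### The order `≤ᴸ` on tuples of a given size. -/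

section Order

variable {N : ℕ}

theorem leL_refl (lam : PtnTuple N) : leL lam lam := ⟨rfl, fun _ _ => le_rfl⟩

theorem leL.trans {lam mu nu : PtnTuple N} (h : leL lam mu) (h' : leL mu nu) : leL lam nu :=
  ⟨h.1.trans h'.1, fun j r => (h.2 j r).trans (h'.2 j r)⟩

theorem Ptn.eq_of_sum_range_eq {l m : Ptn}
    (h : ∀ r, ∑ k ∈ Finset.range (r + 1), l.1 k = ∑ k ∈ Finset.range (r + 1), m.1 k) : l = m := by
  apply Subtype.ext
  ext k
  rcases k with _ | k
  · simpa using h 0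
  · have h1 := h (k + 1)
    rw [Finset.sum_range_succ, Finset.sum_range_succ _ (k + 1), h k] at h1
    exact Nat.add_left_cancel h1

/-- Descending induction from the last family: once the families above j agree, the inequalities for
j compare partial sums of the family j alone. -/
theorem leL.antisymm {lam mu : PtnTuple N} (h : leL lam mu) (h' : leL mu lam) : lam = mu := by
  have heq := fun j r => le_antisymm (h.2 j r) (h'.2 j r)
  have key : ∀ m : ℕ, ∀ j : Fin N, N - (j : ℕ) = m → lam j = mu j := by
    intro m
    induction m using Nat.strong_induction_on with
    | _ m ih =>
      intro j hj
      have hsum : ∑ l ∈ Finset.Ioi j, (lam l).size = ∑ l ∈ Finset.Ioi j, (mu l).size := by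
        refine Finset.sum_congr rfl fun l hl => ?_
        rw [Finset.mem_Ioi] at hl
        rw [ih (N - l) (by omega) l rfl]
      refine Ptn.eq_of_sum_range_eq fun r => ?_
      have := heq j r
      rw [hsum] at this
      exact Nat.add_left_cancel this
  funext j
  exact key _ j rfl

/-- The order is placed on a separate structure, since a subtype of `PtnTuple` would inherit the
componentwise order. -/
instance (s : ℕ) : PartialOrder (TupleOfSize N s) where
  le mu lam := leL mu.1 lam.1
  le_refl lam := leL_refl lam.1
  le_trans _ _ _ h h' := h.trans h'
  le_antisymm _ _ h h' := TupleOfSize.ext (h.antisymm h')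

theorem TupleOfSize.le_iff {s : ℕ} {mu lam : TupleOfSize N s} : mu ≤ lam ↔ leL mu.1 lam.1 := Iff.rfl

theorem TupleOfSize.lt_iff {s : ℕ} {mu lam : TupleOfSize N s} : mu < lam ↔ ltL mu.1 lam.1 := by
  rw [lt_iff_le_and_ne, ltL, TupleOfSize.le_iff, ne_eq, ne_eq]
  exact and_congr_right fun _ => not_congr TupleOfSize.ext_iff

end Order

/-! ### The values e'_λ separate comparable tuples. -/

section Separation

variable {N : ℕ}

/-- Summation by parts: it trades ∑ kλ_k, which appears in the eigenvalue, for the sum of all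
partial sums, which the order controls. -/
theorem sum_mul_add_sum_range (f : ℕ → ℕ) (L : ℕ) :
    ∑ k ∈ Finset.range L, k * f k + ∑ r ∈ Finset.range L, ∑ k ∈ Finset.range (r + 1), f k =
      L * ∑ k ∈ Finset.range L, f k := by
  induction L with
  | zero => simp
  | succ L ih =>
    rw [Finset.sum_range_succ, Finset.sum_range_succ _ L, add_add_add_comm, ih,
      Finset.sum_range_succ _ L]
    ring

theorem Ptn.sum_eq_sum_range {W : Type} [AddCommMonoid W] (l : Ptn) {L : ℕ} (hL : l.size ≤ L)
    (F : ℕ → ℕ → W) (hF : ∀ k, F k 0 = 0) : l.1.sum F = ∑ k ∈ Finset.range L, F k (l.1 k) := by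
  refine Finsupp.sum_of_support_subset _ (fun k hk => ?_) _ fun k _ => hF k
  rw [Finset.mem_range]
  by_contra hc
  exact Finsupp.mem_support_iff.1 hk (l.eq_zero_of_size_le (hL.trans (not_lt.1 hc)))

/-- The eigenvalues `e'_λ` separate comparable tuples. -/
theorem eq_of_jackEigenvalue_eq {mu lam : PtnTuple N} (hle : leL mu lam)
    (h : ∀ (β : ℚ) (u : Fin N → ℚ), jackEigenvalue β u mu = jackEigenvalue β u lam) :
    mu = lam := by
  obtain ⟨L, hL⟩ : ∃ L, ∀ i, (mu i).size ≤ L ∧ (lam i).size ≤ L := by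
    refine ⟨∑ i, (mu i).size, fun i => ⟨?_, ?_⟩⟩
    · exact Finset.single_le_sum (f := fun i => (mu i).size) (fun _ _ => Nat.zero_le _)
        (Finset.mem_univ i)
    · rw [hle.1]
      exact Finset.single_le_sum (f := fun i => (lam i).size) (fun _ _ => Nat.zero_le _)
        (Finset.mem_univ i)
  have hform : ∀ (nu : PtnTuple N), (∀ i, (nu i).size ≤ L) → ∀ (β : ℚ) (u : Fin N → ℚ),
      jackEigenvalue β u nu = ∑ i, u i * ((nu i).size : ℚ) +
        (∑ i, ∑ k ∈ Finset.range L, ((nu i).1 k : ℚ) ^ 2) / 2 -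
        β * (((∑ i, ∑ k ∈ Finset.range L, k * (nu i).1 k : ℕ) : ℚ) +
          ((∑ i, (nu i).size : ℕ) : ℚ) / 2) := by
    intro nu hnu β u
    push_cast
    rw [jackEigenvalue, Finset.sum_div, Finset.sum_div, ← Finset.sum_add_distrib,
      ← Finset.sum_add_distrib, Finset.mul_sum, ← Finset.sum_sub_distrib]
    refine Finset.sum_congr rfl fun i _ => ?_
    rw [Ptn.sum_eq_sum_range _ (hnu i) _ (by simp), Ptn.size_eq_sum_range_of_le _ (hnu i)]
    push_cast
    rw [Finset.mul_sum, Finset.sum_div, Finset.sum_div, ← Finset.sum_add_distrib,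
      ← Finset.sum_add_distrib, Finset.mul_sum, ← Finset.sum_sub_distrib]
    refine Finset.sum_congr rfl fun k _ => ?_
    ring
  have hmu := hform mu fun i => (hL i).1
  have hlam := hform lam fun i => (hL i).2
  have h0 := h 0 0
  -- The coefficient of u_i in the eigenvalue is the size of the i-th partition.
  have hsize : ∀ i, (mu i).size = (lam i).size := by
    intro i
    have h1 := h 0 (Pi.single i 1)
    rw [hmu, hlam] at h0 h1
    simp only [Pi.zero_apply, zero_mul, Finset.sum_const_zero, sub_zero, zero_add] at h0 h1
    rw [h0] at h1
    have h2 := add_right_cancel h1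
    simp only [Pi.single_apply, ite_mul, one_mul, zero_mul, Finset.sum_ite_eq', Finset.mem_univ,
      if_true] at h2
    exact_mod_cast h2
  -- The coefficient of β gives ∑ kλ_k, as the total sizes agree.
  have hn : ∑ i, ∑ k ∈ Finset.range L, k * (mu i).1 k =
      ∑ i, ∑ k ∈ Finset.range L, k * (lam i).1 k := by
    have h1 := h 1 0
    rw [hmu, hlam] at h0 h1
    simp only [Pi.zero_apply, zero_mul, Finset.sum_const_zero, sub_zero, zero_add, one_mul] at h0 h1
    rw [h0, hle.1] at h1
    have h2 : ((∑ i, ∑ k ∈ Finset.range L, k * (mu i).1 k : ℕ) : ℚ) =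
      ((∑ i, ∑ k ∈ Finset.range L, k * (lam i).1 k : ℕ) : ℚ) := by linarith
    exact_mod_cast h2
  have hpart : ∀ i r, ∑ k ∈ Finset.range (r + 1), (mu i).1 k ≤
      ∑ k ∈ Finset.range (r + 1), (lam i).1 k := by
    intro i r
    have := hle.2 i r
    simp only [hsize] at this
    exact Nat.le_of_add_le_add_left this
  -- The partial sums are now comparable term by term and have equal totals, hence are equal.
  have hP : ∑ i, ∑ r ∈ Finset.range L, ∑ k ∈ Finset.range (r + 1), (mu i).1 k =
      ∑ i, ∑ r ∈ Finset.range L, ∑ k ∈ Finset.range (r + 1), (lam i).1 k := by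
    have e : ∀ nu : PtnTuple N, (∀ i, (nu i).size ≤ L) →
        ∑ i, ∑ k ∈ Finset.range L, k * (nu i).1 k +
        ∑ i, ∑ r ∈ Finset.range L, ∑ k ∈ Finset.range (r + 1), (nu i).1 k =
          ∑ i, L * (nu i).size := by
      intro nu hnu
      rw [← Finset.sum_add_distrib]
      refine Finset.sum_congr rfl fun i _ => ?_
      rw [sum_mul_add_sum_range, Ptn.size_eq_sum_range_of_le _ (hnu i)]
    have e1 := e mu fun i => (hL i).1
    have e2 := e lam fun i => (hL i).2
    simp only [hsize] at e1
    omega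
  have h1 := (Finset.sum_eq_sum_iff_of_le fun i _ => Finset.sum_le_sum fun r _ => hpart i r).1 hP
  funext i
  have h2 := (Finset.sum_eq_sum_iff_of_le fun r _ => hpart i r).1 (h1 i (Finset.mem_univ i))
  refine Ptn.eq_of_sum_range_eq fun r => ?_
  rcases lt_or_ge r L with hr | hr
  · exact h2 r (Finset.mem_range.2 hr)
  · rw [← Ptn.size_eq_sum_range_of_le _ ((hL i).1.trans (by omega : L ≤ r + 1)),
      ← Ptn.size_eq_sum_range_of_le _ ((hL i).2.trans (by omega : L ≤ r + 1)), hsize]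

end Separation

/-! ### Triangularity and diagonal of H_β as limits. -/

section HamEntries

variable {N : ℕ}

open Classical in
-- The corresponding entry of X₀ vanishes for all z, hence so does its limit after division by z³,
-- which is β times the entry of H_β.
theorem entry_ham_eq_zero_of_complex {β : ℂ} (hβ : β ≠ 0) (u' : Fin N → ℂ) {M : ℕ}
    {mu nu : PtnTuple N} (hM : IsBound M nu) (h : ¬ leL mu nu) :
    entry (ham M β u') mu nu = 0 := by
  obtain ⟨r, hr, hz⟩ := exists_macMatrix_expansion β u' hM mu
  have hne : mu ≠ nu := fun e => h (e ▸ leL_refl mu)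
  have h0 : ∀ z, macMatrix β u' z mu nu = 0 := by
    intro z
    by_contra hc
    refine h (leL_of_entry_ringX0_ne_zero ?_ _ hc)
    rw [← Complex.exp_add, neg_mul, add_neg_cancel, Complex.exp_zero]
  have h1 := tendsto_div_pow_of_expansion (F := fun _ => 0) hr fun z => by
    have := hz z
    rwa [h0, if_neg hne, mul_zero, zero_add] at this
  simp only [zero_div] at h1
  have h2 := tendsto_nhds_unique h1 tendsto_const_nhds
  exact (mul_eq_zero.1 h2).resolve_left hβ

/-- The diagonal entry of X₀ has two expansions, one through H_β and one through the explicit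
eigenvalue. Their coefficients at z³ agree and β is cancelled. -/
theorem entry_ham_self_of_complex {β : ℂ} (hβ : β ≠ 0) (u' : Fin N → ℂ) {M : ℕ}
    {lam : PtnTuple N} (hM : IsBound M lam) :
    entry (ham M β u') lam lam = jackEigenvalue β u' lam := by
  obtain ⟨r, hr, hz⟩ := exists_macMatrix_expansion β u' hM lam
  obtain ⟨r', hr', hz'⟩ := exists_macMatrix_self_expansion β u' lam
  simp only [if_true, mul_one] at hz
  set F : ℂ → ℂ := fun z => macMatrix β u' z lam lam - (∑ i, Complex.exp (u' i * z) +
    z ^ 2 * (β * ((∑ i, (lam i).size : ℕ) : ℂ))) with hF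
  have h1 := tendsto_div_pow_of_expansion (F := F) (c := β * entry (ham M β u') lam lam) hr
    fun z => by rw [hF]; linear_combination hz z
  have h2 := tendsto_div_pow_of_expansion (F := F) (c := β * jackEigenvalue β u' lam) hr'
    fun z => by rw [hF]; linear_combination hz' z
  exact mul_left_cancel₀ hβ (tendsto_nhds_unique h1 h2)

/-- The point `(β, u'_1, …, u'_N)` over any ring. -/
def jackAssign {R : Type} (β : R) (u : Fin N → R) : JackVar N → R
  | .beta => β
  | .u i => u i

theorem jackPoint_eq (β : ℂ) (u' : Fin N → ℂ) : jackPoint β u' = jackAssign β u' := by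
  funext s; cases s <;> rfl

theorem jackAssign_eq {R : Type} (w : JackVar N → R) :
    jackAssign (w .beta) (fun i => w (.u i)) = w := by
  funext s; cases s <;> rfl

theorem exists_rat_eval_ne {P Q : MvPolynomial (JackVar N) ℚ} (h : P ≠ Q) :
    ∃ (β : ℚ) (u : Fin N → ℚ), β ≠ 0 ∧
      MvPolynomial.aeval (jackAssign β u) P ≠ MvPolynomial.aeval (jackAssign β u) Q := by
  by_contra! hc
  refine h (sub_eq_zero.1 ?_)
  -- Multiplying by the variable β removes the condition β ≠ 0, so that vanishing at all rational
  -- points may be used.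
  have h1 : (MvPolynomial.X .beta : MvPolynomial (JackVar N) ℚ) * (P - Q) = 0 := by
    refine MvPolynomial.funext fun w => ?_
    rw [map_mul, map_sub, MvPolynomial.eval_X, map_zero]
    rcases eq_or_ne (w .beta) 0 with h0 | h0
    · rw [h0, zero_mul]
    · have := hc (w .beta) (fun i => w (.u i)) h0
      rw [jackAssign_eq, MvPolynomial.aeval_eq_eval] at this
      rw [this, sub_self, mul_zero]
  exact (mul_eq_zero.1 h1).resolve_left (MvPolynomial.X_ne_zero _)

theorem eq_of_complex_eval_eq {P Q : MvPolynomial (JackVar N) ℚ}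
    (h : ∀ (β : ℂ) (u : Fin N → ℂ), β ≠ 0 →
      MvPolynomial.aeval (jackAssign β u) P = MvPolynomial.aeval (jackAssign β u) Q) : P = Q := by
  by_contra hne
  obtain ⟨β, u, hβ, hPQ⟩ := exists_rat_eval_ne hne
  have h1 := h (β : ℂ) (fun i => (u i : ℂ)) (by exact_mod_cast hβ)
  have h2 : jackAssign (β : ℂ) (fun i => (u i : ℂ)) = fun s => algebraMap ℚ ℂ (jackAssign β u s) := by
    funext s; cases s <;> rfl
  rw [h2] at h1
  have h3 := fun P : MvPolynomial (JackVar N) ℚ =>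
    MvPolynomial.aeval_algebraMap_apply ℂ (jackAssign β u) P
  simp only [Function.comp_def] at h3
  rw [h3, h3] at h1
  exact hPQ ((algebraMap ℚ ℂ).injective h1)

variable {R : Type} [CommRing R] [Algebra ℚ R]

theorem aeval_entry_ham (M : ℕ) (β : R) (u : Fin N → R) (mu nu : PtnTuple N) :
    MvPolynomial.aeval (jackAssign β u) (entry (ham M (MvPolynomial.X .beta)
      fun i => (MvPolynomial.X (.u i) : MvPolynomial (JackVar N) ℚ)) mu nu) =
      entry (ham M β u) mu nu := by
  have := entry_ham_map (MvPolynomial.aeval (jackAssign β u) :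
    MvPolynomial (JackVar N) ℚ →ₐ[ℚ] R).toRingHom M (MvPolynomial.X .beta)
    (fun i => MvPolynomial.X (.u i)) mu nu
  simp only [AlgHom.toRingHom_eq_coe, RingHom.coe_coe, MvPolynomial.aeval_X] at this
  exact this

theorem aeval_jackValue (β : R) (u : Fin N → R) (lam : PtnTuple N) :
    MvPolynomial.aeval (jackAssign β u) (jackValue (MvPolynomial.X .beta)
      (fun i => (MvPolynomial.X (.u i) : MvPolynomial (JackVar N) ℚ)) lam) =
      jackValue β u lam := by
  have := jackValue_map (MvPolynomial.aeval (jackAssign β u) :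
    MvPolynomial (JackVar N) ℚ →ₐ[ℚ] R).toRingHom (MvPolynomial.X .beta)
    (fun i => MvPolynomial.X (.u i)) lam
  simp only [AlgHom.toRingHom_eq_coe, RingHom.coe_coe, MvPolynomial.aeval_X] at this
  exact this

/-- Entries are specializations of universal polynomials over ℚ. Those vanish at complex points with
β ≠ 0, hence identically. -/
theorem leL_of_entry_ham_ne_zero (β : R) (u : Fin N → R) {M : ℕ} {mu nu : PtnTuple N}
    (hM : IsBound M nu) (h : entry (ham M β u) mu nu ≠ 0) : leL mu nu := by
  by_contra hc
  refine h ?_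
  have h0 : entry (ham M (MvPolynomial.X .beta)
      fun i => (MvPolynomial.X (.u i) : MvPolynomial (JackVar N) ℚ)) mu nu = 0 := by
    refine eq_of_complex_eval_eq fun β' u' hβ => ?_
    rw [aeval_entry_ham, entry_ham_eq_zero_of_complex hβ u' hM hc, map_zero]
  rw [← aeval_entry_ham, h0, map_zero]

theorem entry_ham_self (β : R) (u : Fin N → R) {M : ℕ} {lam : PtnTuple N} (hM : IsBound M lam) :
    entry (ham M β u) lam lam = jackValue β u lam := by
  rw [← aeval_entry_ham, ← aeval_jackValue]
  congr 1
  refine eq_of_complex_eval_eq fun β' u' hβ => ?_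
  rw [aeval_entry_ham, aeval_jackValue, entry_ham_self_of_complex hβ u' hM, jackValue_eq]

theorem jackValue_X_ne {mu lam : PtnTuple N} (h : ltL mu lam) :
    jackValue (MvPolynomial.X .beta)
      (fun i => (MvPolynomial.X (.u i) : MvPolynomial (JackVar N) ℚ)) mu ≠
    jackValue (MvPolynomial.X .beta) (fun i => MvPolynomial.X (.u i)) lam := by
  intro heq
  refine h.2 (eq_of_jackEigenvalue_eq h.1 fun β u => ?_)
  rw [← jackValue_eq, ← jackValue_eq, ← aeval_jackValue, heq, aeval_jackValue]

end HamEntries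

/-! ### Values of rational functions and of matrix entries. -/

section Specialization

variable {σ : Type}

/-- `r` is a quotient of polynomials whose denominator does not vanish at `v`, and its value at
`v` is `c`. -/
def HasValue (v : σ → ℂ) (r : RatFun σ) (c : ℂ) : Prop :=
  ∃ f g : MvPolynomial σ ℚ, MvPolynomial.aeval v g ≠ 0 ∧
    r * algebraMap (MvPolynomial σ ℚ) (RatFun σ) g = algebraMap (MvPolynomial σ ℚ) (RatFun σ) f ∧
    c * MvPolynomial.aeval v g = MvPolynomial.aeval v f

theorem hasValue_algebraMap (v : σ → ℂ) (f : MvPolynomial σ ℚ) :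
    HasValue v (algebraMap _ _ f) (MvPolynomial.aeval v f) :=
  ⟨f, 1, by simp, by simp, by simp⟩

theorem hasValue_var (v : σ → ℂ) (s : σ) : HasValue v (RatFun.var s) (v s) := by
  have := hasValue_algebraMap v (MvPolynomial.X s)
  rwa [MvPolynomial.aeval_X] at this

theorem HasValue.mul {v : σ → ℂ} {r r' : RatFun σ} {c c' : ℂ} (h : HasValue v r c)
    (h' : HasValue v r' c') : HasValue v (r * r') (c * c') := by
  obtain ⟨f, g, hg, h1, h2⟩ := h
  obtain ⟨f', g', hg', h1', h2'⟩ := h'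
  refine ⟨f * f', g * g', ?_, ?_, ?_⟩
  · rw [map_mul]; exact mul_ne_zero hg hg'
  · rw [map_mul, map_mul, ← h1, ← h1']; ring
  · rw [map_mul, map_mul, ← h2, ← h2']; ring

theorem HasValue.add {v : σ → ℂ} {r r' : RatFun σ} {c c' : ℂ} (h : HasValue v r c)
    (h' : HasValue v r' c') : HasValue v (r + r') (c + c') := by
  obtain ⟨f, g, hg, h1, h2⟩ := h
  obtain ⟨f', g', hg', h1', h2'⟩ := h'
  refine ⟨f * g' + f' * g, g * g', ?_, ?_, ?_⟩
  · rw [map_mul]; exact mul_ne_zero hg hg'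
  · rw [map_mul, map_add, map_mul, map_mul, ← h1, ← h1']; ring
  · rw [map_mul, map_add, map_mul, map_mul, ← h2, ← h2']; ring

theorem HasValue.inv {v : σ → ℂ} {r : RatFun σ} {c : ℂ} (h : HasValue v r c) (hc : c ≠ 0) :
    HasValue v r⁻¹ c⁻¹ := by
  obtain ⟨f, g, hg, h1, h2⟩ := h
  have hf : MvPolynomial.aeval v f ≠ 0 := by rw [← h2]; exact mul_ne_zero hc hg
  have hr : r ≠ 0 := by
    rintro rfl
    rw [zero_mul] at h1
    have : f = 0 := by
      apply IsFractionRing.injective (MvPolynomial σ ℚ) (RatFun σ)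
      rw [← h1, map_zero]
    exact hf (by rw [this, map_zero])
  refine ⟨g, f, hf, ?_, ?_⟩
  · rw [← h1, inv_mul_cancel_left₀ hr]
  · rw [← h2, inv_mul_cancel_left₀ hc]

theorem HasValue.ne_zero {v : σ → ℂ} {r : RatFun σ} {c : ℂ} (h : HasValue v r c) (hc : c ≠ 0) :
    r ≠ 0 := by
  obtain ⟨f, g, hg, h1, h2⟩ := h
  rintro rfl
  rw [zero_mul] at h1
  have : f = 0 := by
    apply IsFractionRing.injective (MvPolynomial σ ℚ) (RatFun σ)
    rw [← h1, map_zero]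
  rw [this, map_zero] at h2
  exact mul_ne_zero hc hg h2

/-- The reduced denominator divides every other denominator. It thus suffices to exhibit one
representation with nonvanishing denominator, not necessarily reduced. -/
theorem HasValue.num_den {v : σ → ℂ} {r : RatFun σ} {c : ℂ} (h : HasValue v r c) :
    r.RegularAt v ∧ r.value v = c := by
  obtain ⟨f, g, hg, h1, h2⟩ := h
  set n := IsFractionRing.num (MvPolynomial σ ℚ) r with hn
  set d : MvPolynomial σ ℚ := (IsFractionRing.den (MvPolynomial σ ℚ) r : MvPolynomial σ ℚ) with hd
  have hd0 : algebraMap (MvPolynomial σ ℚ) (RatFun σ) d ≠ 0 :=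
    IsFractionRing.to_map_ne_zero_of_mem_nonZeroDivisors (IsFractionRing.den _ r).2
  have hr : r * algebraMap _ _ d = algebraMap (MvPolynomial σ ℚ) (RatFun σ) n := by
    conv_lhs => rw [← IsFractionRing.mk'_num_den (MvPolynomial σ ℚ) r]
    exact IsLocalization.mk'_spec _ _ _
  have key : n * g = f * d := by
    apply IsFractionRing.injective (MvPolynomial σ ℚ) (RatFun σ)
    rw [map_mul, map_mul, ← hr, ← h1]
    ring
  have hdvd : d ∣ g := by
    have h3 : IsRelPrime d n := (IsFractionRing.num_den_reduced (MvPolynomial σ ℚ) r).symm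
    exact h3.dvd_of_dvd_mul_left ⟨f, by rw [key, mul_comm]⟩
  have hd1 : MvPolynomial.aeval v d ≠ 0 := by
    obtain ⟨e, he⟩ := hdvd
    rw [he, map_mul] at hg
    exact left_ne_zero_of_mul hg
  refine ⟨hd1, ?_⟩
  change MvPolynomial.aeval v n / MvPolynomial.aeval v d = c
  have := congrArg (MvPolynomial.aeval v) key
  rw [map_mul, map_mul, ← h2] at this
  rw [div_eq_iff hd1]
  apply mul_right_cancel₀ hg
  rw [this]
  ring

instance : CharZero (RatFun σ) :=
  charZero_of_injective_algebraMap (IsFractionRing.injective (MvPolynomial σ ℚ) (RatFun σ))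

/-- The ring of pairs of a rational function regular at `v` and its value at `v`. -/
def valuePairs (v : σ → ℂ) : Subalgebra ℚ (RatFun σ × ℂ) where
  carrier := {x | HasValue v x.1 x.2}
  mul_mem' h h' := HasValue.mul h h'
  add_mem' h h' := HasValue.add h h'
  algebraMap_mem' c := by
    have h := hasValue_algebraMap v (algebraMap ℚ (MvPolynomial σ ℚ) c)
    rw [AlgHom.commutes] at h
    have h2 : algebraMap (MvPolynomial σ ℚ) (RatFun σ) (algebraMap ℚ _ c) =
      algebraMap ℚ (RatFun σ) c := by
      rw [← RingHom.comp_apply, Subsingleton.elim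
        ((algebraMap (MvPolynomial σ ℚ) (RatFun σ)).comp (algebraMap ℚ _)) (algebraMap ℚ (RatFun σ))]
    rw [h2] at h
    exact h

variable {N : ℕ}

/-- The entry is computed once in the ring `valuePairs v`. Its two projections are the entry over
rational functions and the entry over ℂ. -/
theorem hasValue_entry_ringX0 {v : σ → ℂ} {q τ s s' : RatFun σ} {u : Fin N → RatFun σ}
    {q₀ τ₀ s₀ s₀' : ℂ} {u₀ : Fin N → ℂ} (hq : HasValue v q q₀) (hτ : HasValue v τ τ₀)
    (hs : HasValue v s s₀) (hs' : HasValue v s' s₀') (hu : ∀ i, HasValue v (u i) (u₀ i))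
    (mu nu : PtnTuple N) :
    HasValue v (entry (ringX0 q τ s s' u) mu nu) (entry (ringX0 q₀ τ₀ s₀ s₀' u₀) mu nu) := by
  set E : valuePairs v := entry (ringX0 (⟨(q, q₀), hq⟩ : valuePairs v) ⟨(τ, τ₀), hτ⟩ ⟨(s, s₀), hs⟩
    ⟨(s', s₀'), hs'⟩ fun i => ⟨(u i, u₀ i), hu i⟩) mu nu with hE
  have h1 := entry_ringX0_map ((RingHom.fst (RatFun σ) ℂ).comp (valuePairs v).val.toRingHom)
    (⟨(q, q₀), hq⟩ : valuePairs v) ⟨(τ, τ₀), hτ⟩ ⟨(s, s₀), hs⟩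
    ⟨(s', s₀'), hs'⟩ (fun i => ⟨(u i, u₀ i), hu i⟩) mu nu
  have h2 := entry_ringX0_map ((RingHom.snd (RatFun σ) ℂ).comp (valuePairs v).val.toRingHom)
    (⟨(q, q₀), hq⟩ : valuePairs v) ⟨(τ, τ₀), hτ⟩ ⟨(s, s₀), hs⟩
    ⟨(s', s₀'), hs'⟩ (fun i => ⟨(u i, u₀ i), hu i⟩) mu nu
  have h3 : HasValue v E.1.1 E.1.2 := E.2
  have e1 : E.1.1 = entry (ringX0 q τ s s' u) mu nu := h1
  have e2 : E.1.2 = entry (ringX0 q₀ τ₀ s₀ s₀' u₀) mu nu := h2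
  rwa [e1, e2] at h3

theorem hasValue_entry_ham (M : ℕ) (β : ℂ) (u' : Fin N → ℂ) (mu nu : PtnTuple N) :
    HasValue (jackPoint β u') (entry (ham M (RatFun.var .beta)
      fun i => (RatFun.var (.u i) : RatFun (JackVar N))) mu nu) (entry (ham M β u') mu nu) := by
  have h := hasValue_algebraMap (jackPoint β u') (entry (ham M (MvPolynomial.X .beta)
      fun i => (MvPolynomial.X (.u i) : MvPolynomial (JackVar N) ℚ)) mu nu)
  rw [jackPoint_eq, aeval_entry_ham, entry_ham_map, ← jackPoint_eq] at h
  exact h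

/-- The matrix of `X₀` over `ℚ(q^{1/4}, t^{1/4}, u_1, …, u_N)`. -/
def genericMatrix (mu nu : PtnTuple N) : RatFun (MacVar N) :=
  entry (X0 (RatFun.var .qRoot) (RatFun.var .tRoot) fun i => RatFun.var (.u i)) mu nu

theorem RatFun.var_ne_zero (s : σ) : (RatFun.var s : RatFun σ) ≠ 0 :=
  (hasValue_var (fun _ => 1) s).ne_zero one_ne_zero

theorem genericMatrix_eq (mu nu : PtnTuple N) : genericMatrix mu nu =
    entry (ringX0 ((RatFun.var .qRoot : RatFun (MacVar N)) ^ 4) ((RatFun.var .tRoot) ^ 4)⁻¹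
      (RatFun.var .tRoot / RatFun.var .qRoot) (RatFun.var .qRoot / RatFun.var .tRoot)
      fun i => RatFun.var (.u i)) mu nu := by
  rw [genericMatrix, entry, X0_eq_ringX0 (RatFun.var_ne_zero _) (RatFun.var_ne_zero _), entry]

theorem leL_of_genericMatrix_ne_zero {mu nu : PtnTuple N} (h : genericMatrix mu nu ≠ 0) :
    leL mu nu := by
  rw [genericMatrix_eq] at h
  refine leL_of_entry_ringX0_ne_zero ?_ _ h
  rw [div_mul_div_cancel₀ (RatFun.var_ne_zero _), div_self (RatFun.var_ne_zero _)]

theorem HasValue.pow {v : σ → ℂ} {r : RatFun σ} {c : ℂ} (h : HasValue v r c) (n : ℕ) :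
    HasValue v (r ^ n) (c ^ n) := by
  induction n with
  | zero => simpa using hasValue_algebraMap v 1
  | succ n ih => rw [pow_succ, pow_succ]; exact ih.mul h

theorem HasValue.sub {v : σ → ℂ} {r r' : RatFun σ} {c c' : ℂ} (h : HasValue v r c)
    (h' : HasValue v r' c') : HasValue v (r - r') (c - c') := by
  have h1 := (hasValue_algebraMap v (-1)).mul h'
  rw [map_neg, map_neg, map_one, map_one, neg_one_mul, neg_one_mul] at h1
  simpa only [sub_eq_add_neg] using h.add h1

theorem HasValue.sum {v : σ → ℂ} {ι : Type} (t : Finset ι) {r : ι → RatFun σ} {c : ι → ℂ}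
    (h : ∀ j ∈ t, HasValue v (r j) (c j)) : HasValue v (∑ j ∈ t, r j) (∑ j ∈ t, c j) := by
  classical
  induction t using Finset.induction_on with
  | empty => simpa using hasValue_algebraMap v 0
  | insert a t ha ih =>
    rw [Finset.sum_insert ha, Finset.sum_insert ha]
    exact (h a (Finset.mem_insert_self a t)).add
      (ih fun j hj => h j (Finset.mem_insert_of_mem hj))

/-- At `macPoint` the parameters q, 1/t and (t/q)^{±1/4} take the exponential values used in
`macMatrix`, all of them nonzero. -/
theorem hasValue_genericMatrix (β : ℂ) (u' : Fin N → ℂ) (z : ℂ) (mu nu : PtnTuple N) :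
    HasValue (macPoint β u' z) (genericMatrix mu nu) (macMatrix β u' z mu nu) := by
  have ha : HasValue (macPoint β u' z) (RatFun.var .qRoot) (Complex.exp (z / 4)) :=
    hasValue_var (macPoint β u' z) .qRoot
  have hb : HasValue (macPoint β u' z) (RatFun.var .tRoot) (Complex.exp (β * z / 4)) :=
    hasValue_var (macPoint β u' z) .tRoot
  rw [genericMatrix_eq, macMatrix]
  refine hasValue_entry_ringX0 ?_ ?_ ?_ ?_ (fun i => hasValue_var (macPoint β u' z) (.u i)) mu nu
  · convert ha.pow 4 using 1
    rw [← Complex.exp_nat_mul]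
    congr 1; push_cast; ring
  · convert (hb.pow 4).inv (pow_ne_zero _ (Complex.exp_ne_zero _)) using 1
    rw [← Complex.exp_nat_mul, ← Complex.exp_neg]
    congr 1; push_cast; ring
  · rw [div_eq_mul_inv]
    convert hb.mul (ha.inv (Complex.exp_ne_zero _)) using 1
    rw [← Complex.exp_neg, ← Complex.exp_add]
    congr 1; ring
  · rw [div_eq_mul_inv]
    convert ha.mul (hb.inv (Complex.exp_ne_zero _)) using 1
    rw [← Complex.exp_neg, ← Complex.exp_add]
    congr 1; ring

end Specialization

/-! ### Eigenvectors of triangular matrices over a finite poset. -/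

section TriangularMatrix

variable {ι K : Type} [Fintype ι] [PartialOrder ι] [Field K] {A : ι → ι → K}

open Classical in
theorem sum_triangular (hA : ∀ μ ν, A μ ν ≠ 0 → μ ≤ ν) (d : ι → K) (μ : ι) :
    ∑ ν, A μ ν * d ν =
      A μ μ * d μ + ∑ ν ∈ Finset.univ.filter (μ < ·), A μ ν * d ν := by
  rw [← Finset.sum_erase_add _ _ (Finset.mem_univ μ), add_comm]
  congr 1
  refine (Finset.sum_subset (fun ν hν => ?_) fun ν hν hν' => ?_).symm
  · exact Finset.mem_erase.2 ⟨(Finset.mem_filter.1 hν).2.ne', Finset.mem_univ ν⟩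
  · by_contra hc
    refine hν' (Finset.mem_filter.2 ⟨Finset.mem_univ ν, lt_of_le_of_ne (hA μ ν ?_) ?_⟩)
    · exact left_ne_zero_of_mul hc
    · exact (Finset.ne_of_mem_erase hν).symm

theorem triangular_eigenvalue_eq (hA : ∀ μ ν, A μ ν ≠ 0 → μ ≤ ν) {l : ι} {d : ι → K} {e : K}
    (hl : d l = 1) (hd : ∀ μ, d μ ≠ 0 → μ ≤ l) (h : ∑ ν, A l ν * d ν = e * d l) : e = A l l := by
  classical
  rw [sum_triangular hA, hl, mul_one, mul_one, Finset.sum_eq_zero, add_zero] at h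
  · exact h.symm
  · intro ν hν
    by_contra hc
    exact ((Finset.mem_filter.1 hν).2.trans_le (hd ν (right_ne_zero_of_mul hc))).false

open Classical in
theorem triangular_row (hA : ∀ μ ν, A μ ν ≠ 0 → μ ≤ ν) {d : ι → K} {e : K} {μ : ι}
    (h : ∑ ν, A μ ν * d ν = e * d μ) (he : A μ μ ≠ e) :
    d μ = (e - A μ μ)⁻¹ * ∑ ν ∈ Finset.univ.filter (μ < ·), A μ ν * d ν := by
  rw [sum_triangular hA] at h
  rw [eq_inv_mul_iff_mul_eq₀ (sub_ne_zero.2 he.symm), sub_mul, ← h]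
  ring

theorem triangular_eigenvector_unique (hA : ∀ μ ν, A μ ν ≠ 0 → μ ≤ ν) {l : ι}
    (he : ∀ μ, μ < l → A μ μ ≠ A l l) {d d' : ι → K} (hl : d l = 1)
    (hd : ∀ μ, d μ ≠ 0 → μ ≤ l) (h : ∀ μ, ∑ ν, A μ ν * d ν = A l l * d μ) (hl' : d' l = 1)
    (hd' : ∀ μ, d' μ ≠ 0 → μ ≤ l) (h' : ∀ μ, ∑ ν, A μ ν * d' ν = A l l * d' μ) : d = d' := by
  classical
  funext μ
  induction μ using WellFoundedGT.induction with
  | ind μ ih =>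
    by_cases hμ : μ ≤ l
    · rcases hμ.eq_or_lt with rfl | hlt
      · rw [hl, hl']
      · rw [triangular_row hA (h μ) (he μ hlt), triangular_row hA (h' μ) (he μ hlt)]
        congr 1
        refine Finset.sum_congr rfl fun ν hν => ?_
        rw [ih ν (Finset.mem_filter.1 hν).2]
    · rw [not_imp_comm.1 (hd μ) hμ, not_imp_comm.1 (hd' μ) hμ]

/-- Row μ of the eigenvalue equation expresses d_μ through the d_ν with ν > μ. Starting from 1 at l,
this is a recursion along the well-founded relation >. -/
theorem exists_triangular_eigenvector (hA : ∀ μ ν, A μ ν ≠ 0 → μ ≤ ν) {l : ι}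
    (he : ∀ μ, μ < l → A μ μ ≠ A l l) : ∃ d : ι → K, d l = 1 ∧ (∀ μ, d μ ≠ 0 → μ ≤ l) ∧
      ∀ μ, ∑ ν, A μ ν * d ν = A l l * d μ := by
  classical
  obtain ⟨d, hd⟩ : ∃ d : ι → K, ∀ μ, d μ = if μ = l then 1 else if μ < l then
      (A l l - A μ μ)⁻¹ * ∑ ν, if μ < ν then A μ ν * d ν else 0 else 0 := by
    refine ⟨(wellFounded_gt (α := ι)).fix fun μ F => if μ = l then 1 else if μ < l then
      (A l l - A μ μ)⁻¹ * ∑ ν, if h : μ < ν then A μ ν * F ν h else 0 else 0, fun μ => ?_⟩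
    rw [WellFounded.fix_eq]
    simp only [dite_eq_ite]
  have hl : d l = 1 := by rw [hd, if_pos rfl]
  have hs : ∀ μ, d μ ≠ 0 → μ ≤ l := by
    intro μ hμ
    by_contra hc
    refine hμ ?_
    rw [hd, if_neg fun h => hc h.le, if_neg fun h => hc h.le]
  refine ⟨d, hl, hs, fun μ => ?_⟩
  by_cases hμ : μ ≤ l
  · rcases hμ.eq_or_lt with rfl | hlt
    · rw [sum_triangular hA, Finset.sum_eq_zero, add_zero]
      intro ν hν
      by_contra hc
      exact ((Finset.mem_filter.1 hν).2.trans_le (hs ν (right_ne_zero_of_mul hc))).false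
    · have h1 := hd μ
      rw [if_neg hlt.ne, if_pos hlt, ← Finset.sum_filter,
        eq_inv_mul_iff_mul_eq₀ (sub_ne_zero.2 (he μ hlt).symm)] at h1
      rw [sum_triangular hA, ← h1]
      ring
  · rw [not_imp_comm.1 (hs μ) hμ, mul_zero]
    refine Finset.sum_eq_zero fun ν _ => ?_
    by_contra hc
    exact hμ ((hA μ ν (left_ne_zero_of_mul hc)).trans (hs ν (right_ne_zero_of_mul hc)))

end TriangularMatrix

/-! ### From eigenvectors to eigenfunctions. -/

section Eigenfunctions

variable {N : ℕ} {K : Type} [Field K] [CharZero K]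

instance (s : ℕ) : Fintype (TupleOfSize N s) := Fintype.ofFinite _

open Classical in
theorem toVariables_sum_mono {s : ℕ} (l : TupleOfSize N s) {d : PtnTuple N →₀ K}
    (hd : ∀ mu ∈ d.support, ltL mu l.1) :
    toVariables (∑ ν : TupleOfSize N s, ((if ν = l then 1 else 0) + d ν.1) • mono K ν.1) =
      monomialSymTuple l.1 + d.sum fun mu c => c • monomialSymTuple mu := by
  simp only [add_smul, Finset.sum_add_distrib, ite_smul, one_smul, zero_smul, Finset.sum_ite_eq',
    Finset.mem_univ, if_true]
  rw [map_add, toVariables_mono, map_sum]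
  simp only [map_smul, toVariables_mono]
  congr 1
  rw [Finsupp.sum_of_support_subset d (s := Finset.univ.map
    ⟨TupleOfSize.val (N := N) (s := s), fun _ _ h => TupleOfSize.ext h⟩), Finset.sum_map]
  · rfl
  · intro mu hmu
    rw [Finset.mem_map]
    exact ⟨⟨mu, (hd mu hmu).1.1.trans l.2⟩, Finset.mem_univ _, rfl⟩
  · intro mu _
    rw [zero_smul]

open Classical in
theorem cf_sum_mono {s : ℕ} (δ : TupleOfSize N s → K) (mu : PtnTuple N) :
    cf (expOf mu) (∑ ν, δ ν • mono K ν.1) = ∑ ν, if mu = ν.1 then δ ν else 0 := by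
  rw [map_sum]
  refine Finset.sum_congr rfl fun ν _ => ?_
  rw [map_smul, cf_expOf_mono, smul_eq_mul, mul_ite, mul_one, mul_zero]

theorem cf_sum_mono_self {s : ℕ} (δ : TupleOfSize N s → K) (mu : TupleOfSize N s) :
    cf (expOf mu.1) (∑ ν, δ ν • mono K ν.1) = δ mu := by
  classical
  rw [cf_sum_mono, Finset.sum_eq_single mu, if_pos rfl]
  · intro ν _ hν
    exact if_neg fun h => hν (TupleOfSize.ext h.symm)
  · simp

variable {T : SymN N K → SymN N K} {s : ℕ} {l : TupleOfSize N s}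

/-- The coefficients of an eigenfunction. -/
theorem eigenfunction_coeff
    (hT : ∀ c : TupleOfSize N s → K,
      T (∑ ν, c ν • mono K ν.1) = ∑ ν, c ν • T (mono K ν.1))
    (hA : ∀ mu (ν : TupleOfSize N s), entry T mu ν.1 ≠ 0 → leL mu ν.1)
    {P : SymN N K} {d : PtnTuple N →₀ K} (hP : IsUnitriangular l.1 P d)
    (hE : ∃ e : K, T P = e • P) :
    ∃ δ : TupleOfSize N s → K, P = ∑ ν, δ ν • mono K ν.1 ∧ δ l = 1 ∧ (∀ ν, δ ν ≠ 0 → ν ≤ l) ∧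
      (∀ ν, ν < l → δ ν = d ν.1) ∧
      (∀ mu : TupleOfSize N s,
        ∑ ν : TupleOfSize N s, entry T mu.1 ν.1 * δ ν = entry T l.1 l.1 * δ mu) ∧
      T P = entry T l.1 l.1 • P := by
  classical
  obtain ⟨e, he⟩ := hE
  obtain ⟨hd, hP⟩ := hP
  set δ : TupleOfSize N s → K := fun ν => (if ν = l then 1 else 0) + d ν.1 with hδ
  have hPδ : P = ∑ ν, δ ν • mono K ν.1 := by
    apply toVariables_injective
    rw [hP, toVariables_sum_mono l hd]
  have hdl : d l.1 = 0 := by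
    by_contra hc
    exact (hd l.1 (Finsupp.mem_support_iff.2 hc)).2 rfl
  have hl : δ l = 1 := by rw [hδ]; simp [hdl]
  have hs : ∀ ν, δ ν ≠ 0 → ν ≤ l := by
    intro ν hν
    rcases eq_or_ne ν l with rfl | hne
    · exact le_rfl
    · rw [hδ] at hν
      simp only [if_neg hne, zero_add] at hν
      exact TupleOfSize.le_iff.2 (hd _ (Finsupp.mem_support_iff.2 hν)).1
  have hrow : ∀ mu : TupleOfSize N s,
      ∑ ν : TupleOfSize N s, entry T mu.1 ν.1 * δ ν = e * δ mu := by
    intro mu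
    have h1 := congrArg (cf (expOf mu.1)) he
    rw [map_smul, hPδ, cf_sum_mono_self, hT, map_sum, smul_eq_mul] at h1
    rw [← h1]
    refine Finset.sum_congr rfl fun ν _ => ?_
    rw [map_smul, smul_eq_mul, mul_comm, entry]
  have hev : e = entry T l.1 l.1 := triangular_eigenvalue_eq
    (A := fun mu ν : TupleOfSize N s => entry T mu.1 ν.1) (fun mu ν h => hA mu.1 ν h) hl hs (hrow l)
  refine ⟨δ, hPδ, hl, hs, fun ν hν => ?_, fun mu => ?_, ?_⟩
  · rw [hδ]; simp [hν.ne]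
  · rw [← hev, hrow]
  · rw [← hev, he]

/-- A unitriangular eigenfunction lies in the span of the `m_ν` of one total size, so the problem is
the finite triangular one. -/
theorem existsUnique_eigenfunction
    (hT : ∀ c : TupleOfSize N s → K,
      T (∑ ν, c ν • mono K ν.1) = ∑ ν, c ν • T (mono K ν.1))
    (hA : ∀ mu (ν : TupleOfSize N s), entry T mu ν.1 ≠ 0 → leL mu ν.1)
    (he : ∀ mu, ltL mu l.1 → entry T mu mu ≠ entry T l.1 l.1) :
    ∃! P, ∃ d, IsUnitriangular l.1 P d ∧ ∃ e : K, T P = e • P := by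
  classical
  have hA' : ∀ mu ν : TupleOfSize N s, entry T mu.1 ν.1 ≠ 0 → mu ≤ ν := fun mu ν h => hA mu.1 ν h
  have he' : ∀ mu : TupleOfSize N s, mu < l → entry T mu.1 mu.1 ≠ entry T l.1 l.1 :=
    fun mu h => he mu.1 (TupleOfSize.lt_iff.1 h)
  obtain ⟨δ, hl, hs, hrow⟩ := exists_triangular_eigenvector
    (A := fun mu ν : TupleOfSize N s => entry T mu.1 ν.1) hA' he'
  refine ⟨∑ ν, δ ν • mono K ν.1, ?_, ?_⟩
  · set d : PtnTuple N →₀ K := ∑ ν : TupleOfSize N s,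
      Finsupp.single ν.1 (δ ν - if ν = l then 1 else 0) with hd
    have hdν : ∀ ν : TupleOfSize N s, d ν.1 = δ ν - if ν = l then 1 else 0 := by
      intro ν
      rw [hd, Finsupp.finsetSum_apply, Finset.sum_eq_single ν, Finsupp.single_eq_same]
      · intro μ _ hμ
        exact Finsupp.single_eq_of_ne fun h => hμ (TupleOfSize.ext h.symm)
      · simp
    have hdsupp : ∀ mu ∈ d.support, ltL mu l.1 := by
      intro mu hmu
      have hmem : ∃ ν : TupleOfSize N s, mu = ν.1 := by
        by_contra! hc
        refine Finsupp.mem_support_iff.1 hmu ?_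
        rw [hd, Finsupp.finsetSum_apply]
        exact Finset.sum_eq_zero fun ν _ => Finsupp.single_eq_of_ne (hc ν)
      obtain ⟨ν, rfl⟩ := hmem
      have h1 := Finsupp.mem_support_iff.1 hmu
      rw [hdν] at h1
      rw [← TupleOfSize.lt_iff]
      have hne : ν ≠ l := by
        rintro rfl
        rw [hl, if_pos rfl, sub_self] at h1
        exact h1 rfl
      rw [if_neg hne, sub_zero] at h1
      exact lt_of_le_of_ne (hs ν h1) hne
    refine ⟨d, ⟨hdsupp, ?_⟩, entry T l.1 l.1, ?_⟩
    · rw [← toVariables_sum_mono l hdsupp]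
      congr 1
      refine Finset.sum_congr rfl fun ν _ => ?_
      rw [hdν, add_sub_cancel]
    · refine eq_of_cf_expOf_eq fun mu => ?_
      rw [hT, map_sum, map_smul]
      have h1 : ∀ ν : TupleOfSize N s, cf (expOf mu) (δ ν • T (mono K ν.1)) =
          entry T mu ν.1 * δ ν := by
        intro ν
        rw [map_smul, smul_eq_mul, mul_comm, entry]
      simp only [h1]
      -- For `mu` of another size both sides vanish, since T preserves the total size.
      by_cases hmu : ∑ i, (mu i).size = s
      · rw [cf_sum_mono_self δ ⟨mu, hmu⟩, smul_eq_mul]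
        exact hrow ⟨mu, hmu⟩
      · rw [cf_sum_mono, Finset.sum_eq_zero, Finset.sum_eq_zero, smul_zero]
        · intro ν _
          rw [if_neg]
          rintro rfl
          exact hmu ν.2
        · intro ν _
          by_contra hc
          exact hmu ((hA mu ν (left_ne_zero_of_mul hc)).1.trans ν.2)
  · rintro P ⟨d, hP, hE⟩
    obtain ⟨δ', hP', hl', hs', -, hrow', -⟩ := eigenfunction_coeff hT hA hP hE
    rw [hP', triangular_eigenvector_unique
      (A := fun mu ν : TupleOfSize N s => entry T mu.1 ν.1) hA' he' hl hs hrow hl' hs' hrow']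

end Eigenfunctions

/-! ### Linearity of the operators on spans of the `m_ν`. -/

section Linearity

variable {N : ℕ}

theorem vars_sum_smul_subset {K : Type} [Field K] [CharZero K] {ι : Type} {M : ℕ} (t : Finset ι)
    (c : ι → K) {nu : ι → PtnTuple N} (hM : ∀ j, IsBound M (nu j)) :
    ∀ v ∈ (∑ j ∈ t, c j • mono K (nu j)).vars, 2 * (v.2 : ℕ) ≤ M := by
  classical
  intro v hv
  obtain ⟨j, -, hj⟩ := Finset.mem_biUnion.1 (MvPolynomial.vars_sum_subset t _ hv)
  refine (hM j K).1 v ?_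
  rw [MvPolynomial.smul_eq_C_mul] at hj
  rcases eq_or_ne (c j) 0 with h | h
  · simp [h] at hj
  · rwa [MvPolynomial.vars_C_mul _ h] at hj

/-- The number of terms in `zeroMode` depends on the function, so linearity is read off after
truncating everything at a common bound. -/
theorem ringX0_sum {R : Type} [CommRing R] [Algebra ℚ R] {ι : Type} {M : ℕ} (t : Finset ι)
    (c : ι → R) {nu : ι → PtnTuple N} (hM : ∀ j, IsBound M (nu j)) (q τ s s' : R) (u : Fin N → R) :
    ringX0 q τ s s' u (∑ j ∈ t, c j • mono R (nu j)) =
      ∑ j ∈ t, c j • ringX0 q τ s s' u (mono R (nu j)) := by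
  have hlow : ∀ (γ : ℕ+ → R) i j n, M + 1 ≤ n → lower i γ n (mono R (nu j)) = 0 :=
    fun γ i j n hn => (hM j R).2 γ i n hn
  have hlow' : ∀ (γ : ℕ+ → R) i n, M + 1 ≤ n → lower i γ n (∑ j ∈ t, c j • mono R (nu j)) = 0 := by
    intro γ i n hn
    rw [map_sum]
    exact Finset.sum_eq_zero fun j _ => by rw [map_smul, hlow γ i j n hn, smul_zero]
  simp only [ringX0, Finset.smul_sum]
  rw [Finset.sum_comm]
  refine Finset.sum_congr rfl fun i _ => ?_
  rw [zeroMode_eq i _ _ (hlow' _ i)]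
  simp only [zeroMode_eq i _ _ (hlow _ i _), map_sum, map_smul, Finset.mul_sum, Finset.smul_sum,
    mul_smul_comm]
  rw [Finset.sum_comm]
  exact Finset.sum_congr rfl fun j _ => Finset.sum_congr rfl fun n _ => smul_comm _ _ _

end Linearity

/-! ### Generic eigenvectors and their limits. -/

section Generic

variable {N s : ℕ}

theorem genericX0_sum (c : TupleOfSize N s → RatFun (MacVar N)) :
    X0 (RatFun.var MacVar.qRoot) (RatFun.var MacVar.tRoot) (fun i => RatFun.var (MacVar.u i))
      (∑ ν, c ν • mono _ ν.1) =
      ∑ ν, c ν • X0 (RatFun.var MacVar.qRoot) (RatFun.var MacVar.tRoot) (fun i => RatFun.var (MacVar.u i))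
        (mono _ ν.1) := by
  obtain ⟨M, hM⟩ := exists_isBound (fun ν : TupleOfSize N s => ν.1)
  simp only [X0_eq_ringX0 (RatFun.var_ne_zero _) (RatFun.var_ne_zero _)]
  exact ringX0_sum _ c hM _ _ _ _ _

variable {K : Type} [Field K] [CharZero K] {M : ℕ}

theorem entry_jackHamiltonian {nu : PtnTuple N} (hM : IsBound M nu) (β : K) (u : Fin N → K)
    (mu : PtnTuple N) : entry (jackHamiltonian β u) mu nu = entry (ham M β u) mu nu := by
  rw [entry, jackHamiltonian_eq_ham β u (hM K).1, entry]

theorem jackHamiltonian_sum (hM : ∀ ν : TupleOfSize N s, IsBound M ν.1) (β : K) (u : Fin N → K)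
    (c : TupleOfSize N s → K) :
    jackHamiltonian β u (∑ ν, c ν • mono _ ν.1) =
      ∑ ν, c ν • jackHamiltonian β u (mono _ ν.1) := by
  rw [jackHamiltonian_eq_ham β u (vars_sum_smul_subset _ c hM), ham_sum]
  refine Finset.sum_congr rfl fun ν _ => ?_
  rw [jackHamiltonian_eq_ham β u (hM ν K).1]

theorem jackEigenvalue_var_ne {mu lam : PtnTuple N} (h : ltL mu lam) :
    jackEigenvalue (RatFun.var .beta) (fun i => (RatFun.var (.u i) : RatFun (JackVar N))) mu ≠
      jackEigenvalue (RatFun.var .beta) (fun i => RatFun.var (.u i)) lam := by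
  intro heq
  refine jackValue_X_ne h ?_
  apply IsFractionRing.injective (MvPolynomial (JackVar N) ℚ) (RatFun (JackVar N))
  rw [jackValue_map, jackValue_map, jackValue_eq, jackValue_eq]
  exact heq

theorem tendsto_macMatrix_sub (β : ℂ) (u' : Fin N → ℂ) (lam mu : TupleOfSize N s) :
    Tendsto (fun z => (macMatrix β u' z lam.1 lam.1 - macMatrix β u' z mu.1 mu.1) / z ^ 3) (𝓝[≠] 0)
      (𝓝 (β * (jackEigenvalue β u' lam.1 - jackEigenvalue β u' mu.1))) := by
  obtain ⟨r, hr, hz⟩ := exists_macMatrix_self_expansion β u' lam.1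
  obtain ⟨r', hr', hz'⟩ := exists_macMatrix_self_expansion β u' mu.1
  refine tendsto_div_pow_of_expansion (hr.sub hr') fun z => ?_
  rw [hz, hz', lam.2, mu.2]
  ring

theorem tendsto_macMatrix (β : ℂ) (u' : Fin N → ℂ) {mu nu : PtnTuple N} (hne : mu ≠ nu)
    (hM : IsBound M nu) :
    Tendsto (fun z => macMatrix β u' z mu nu / z ^ 3) (𝓝[≠] 0)
      (𝓝 (β * entry (ham M β u') mu nu)) := by
  obtain ⟨r, hr, hz⟩ := exists_macMatrix_expansion β u' hM mu
  refine tendsto_div_pow_of_expansion hr fun z => ?_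
  rw [hz, if_neg hne, mul_zero, zero_add]

theorem eventually_macMatrix_ne {β : ℂ} (hβ : β ≠ 0) (u' : Fin N → ℂ) {lam mu : TupleOfSize N s}
    (h : jackEigenvalue β u' mu.1 ≠ jackEigenvalue β u' lam.1) :
    ∀ᶠ z in 𝓝[≠] (0 : ℂ), macMatrix β u' z lam.1 lam.1 - macMatrix β u' z mu.1 mu.1 ≠ 0 := by
  filter_upwards [(tendsto_macMatrix_sub β u' lam mu).eventually_ne
    (mul_ne_zero hβ (sub_ne_zero.2 h.symm))] with z hz h0
  rw [h0, zero_div] at hz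
  exact hz rfl

/-- At a suitable rational point e'_μ and e'_λ differ and β ≠ 0. Then the two diagonal entries
differ at order z³, hence at some nearby point, hence as rational functions. -/
theorem genericMatrix_self_ne {mu lam : PtnTuple N} (h : ltL mu lam) :
    genericMatrix mu mu ≠ genericMatrix lam lam := by
  obtain ⟨β, u, hβ, hne⟩ := exists_rat_eval_ne (jackValue_X_ne h)
  rw [aeval_jackValue, aeval_jackValue] at hne
  have hne' : jackEigenvalue (β : ℂ) (fun i => (u i : ℂ)) mu ≠
      jackEigenvalue (β : ℂ) (fun i => (u i : ℂ)) lam := by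
    rw [← jackValue_eq, ← jackValue_eq]
    intro heq
    refine hne ((algebraMap ℚ ℂ).injective ?_)
    rw [jackValue_map, jackValue_map]
    exact heq
  obtain ⟨z, hz⟩ := (eventually_macMatrix_ne (s := ∑ i, (lam i).size) (lam := ⟨lam, rfl⟩)
    (mu := ⟨mu, h.1.1⟩) (by exact_mod_cast hβ) _ hne').exists
  have hv := (hasValue_genericMatrix (β : ℂ) (fun i => (u i : ℂ)) z lam lam).sub
    (hasValue_genericMatrix (β : ℂ) (fun i => (u i : ℂ)) z mu mu)
  exact (sub_ne_zero.1 (hv.ne_zero hz)).symm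

/-- The eigenvectors of the matrix of `X₀` specialize to those of the matrix of `H_β`. -/
theorem exists_tendsto_coeff (hM : ∀ ν : TupleOfSize N s, IsBound M ν.1) {l : TupleOfSize N s}
    {δ : TupleOfSize N s → RatFun (MacVar N)} (hl : δ l = 1) (hs : ∀ ν, δ ν ≠ 0 → ν ≤ l)
    (hrow : ∀ mu : TupleOfSize N s, ∑ ν : TupleOfSize N s, genericMatrix mu.1 ν.1 * δ ν =
      genericMatrix l.1 l.1 * δ mu)
    {δ' : TupleOfSize N s → RatFun (JackVar N)} (hl' : δ' l = 1) (hs' : ∀ ν, δ' ν ≠ 0 → ν ≤ l)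
    (hrow' : ∀ mu : TupleOfSize N s, ∑ ν : TupleOfSize N s,
      entry (ham M (RatFun.var .beta) fun i => RatFun.var (.u i)) mu.1 ν.1 * δ' ν =
      entry (ham M (RatFun.var .beta) fun i => RatFun.var (.u i)) l.1 l.1 * δ' mu)
    {β : ℂ} {u' : Fin N → ℂ} (hβ : β ≠ 0)
    (hgen : ∀ mu, ltL mu l.1 → jackEigenvalue β u' mu ≠ jackEigenvalue β u' l.1)
    (mu : TupleOfSize N s) :
    ∃ (c : ℂ → ℂ) (c' : ℂ), (∀ᶠ z in 𝓝[≠] (0 : ℂ), HasValue (macPoint β u' z) (δ mu) (c z)) ∧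
      HasValue (jackPoint β u') (δ' mu) c' ∧ Tendsto c (𝓝[≠] 0) (𝓝 c') := by
  classical
  induction mu using WellFoundedGT.induction with
  | ind mu ih =>
    by_cases hle : mu ≤ l
    swap
    · refine ⟨fun _ => 0, 0, Eventually.of_forall fun z => ?_, ?_, tendsto_const_nhds⟩
      · rw [not_imp_comm.1 (hs mu) hle]
        simpa using hasValue_algebraMap (macPoint β u' z) 0
      · rw [not_imp_comm.1 (hs' mu) hle]
        simpa using hasValue_algebraMap (jackPoint β u') 0
    rcases hle.eq_or_lt with rfl | hlt
    · refine ⟨fun _ => 1, 1, Eventually.of_forall fun z => ?_, ?_, tendsto_const_nhds⟩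
      · rw [hl]
        simpa using hasValue_algebraMap (macPoint β u' z) 1
      · rw [hl']
        simpa using hasValue_algebraMap (jackPoint β u') 1
    choose! c c' hc hc' hcc using ih
    have hltL := TupleOfSize.lt_iff.1 hlt
    set E := entry (ham M (RatFun.var .beta) fun i => (RatFun.var (.u i) : RatFun (JackVar N)))
      with hE
    set H := entry (ham M β u') with hH
    have hEself : ∀ ν : TupleOfSize N s, E ν.1 ν.1 =
        jackEigenvalue (RatFun.var .beta) (fun i => RatFun.var (.u i)) ν.1 := fun ν => by
      rw [hE, entry_ham_self _ _ (hM ν), jackValue_eq]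
    have hHself : ∀ ν : TupleOfSize N s, H ν.1 ν.1 = jackEigenvalue β u' ν.1 := fun ν => by
      rw [hH, entry_ham_self _ _ (hM ν), jackValue_eq]
    have hδ := triangular_row (A := fun mu ν : TupleOfSize N s => genericMatrix mu.1 ν.1)
      (fun _ _ h => leL_of_genericMatrix_ne_zero h) (hrow mu) (genericMatrix_self_ne hltL)
    have hδ' := triangular_row (A := fun mu ν : TupleOfSize N s => E mu.1 ν.1)
      (fun _ ν h => leL_of_entry_ham_ne_zero _ _ (hM ν) h) (hrow' mu)
      (by rw [hEself, hEself]; exact jackEigenvalue_var_ne hltL)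
    have hgen' := hgen mu.1 hltL
    have hne' : H l.1 l.1 - H mu.1 mu.1 ≠ 0 := by
      rw [hHself, hHself]
      exact sub_ne_zero.2 hgen'.symm
    set S : Finset (TupleOfSize N s) := Finset.univ.filter (mu < ·) with hS
    have hmem : ∀ ν ∈ S, mu < ν := fun ν hν => (Finset.mem_filter.1 hν).2
    -- The candidate values are given by the row recursions over ℂ, for X₀ at the parameter z and
    -- for H_β.
    refine ⟨fun z => (macMatrix β u' z l.1 l.1 - macMatrix β u' z mu.1 mu.1)⁻¹ *
        ∑ ν ∈ S, macMatrix β u' z mu.1 ν.1 * c ν z,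
      (H l.1 l.1 - H mu.1 mu.1)⁻¹ * ∑ ν ∈ S, H mu.1 ν.1 * c' ν, ?_, ?_, ?_⟩
    · have hall : ∀ᶠ z in 𝓝[≠] (0 : ℂ), ∀ ν ∈ S, HasValue (macPoint β u' z) (δ ν) (c ν z) :=
        (Filter.eventually_all_finset S).2 fun ν hν => hc ν (hmem ν hν)
      filter_upwards [hall, eventually_macMatrix_ne hβ u' hgen'] with z hz hz0
      rw [hδ]
      refine HasValue.mul (HasValue.inv ?_ hz0) (HasValue.sum S fun ν hν => ?_)
      · exact (hasValue_genericMatrix β u' z l.1 l.1).sub (hasValue_genericMatrix β u' z mu.1 mu.1)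
      · exact (hasValue_genericMatrix β u' z mu.1 ν.1).mul (hz ν hν)
    · rw [hδ']
      refine HasValue.mul (HasValue.inv ?_ hne') (HasValue.sum S fun ν hν => ?_)
      · exact (hasValue_entry_ham M β u' l.1 l.1).sub (hasValue_entry_ham M β u' mu.1 mu.1)
      · exact (hasValue_entry_ham M β u' mu.1 ν.1).mul (hc' ν (hmem ν hν))
    -- Both the denominator and the off-diagonal entries are divided by z³; the factor β common to
    -- the two limits cancels.
    · have h1 := (tendsto_macMatrix_sub β u' l mu).inv₀
        (mul_ne_zero hβ (sub_ne_zero.2 hgen'.symm))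
      have h2 : Tendsto (fun z => ∑ ν ∈ S, macMatrix β u' z mu.1 ν.1 / z ^ 3 * c ν z) (𝓝[≠] 0)
          (𝓝 (∑ ν ∈ S, β * H mu.1 ν.1 * c' ν)) := by
        refine tendsto_finsetSum S fun ν hν => ?_
        refine (tendsto_macMatrix β u' (fun h => ?_) (hM ν)).mul (hcc ν (hmem ν hν))
        exact (hmem ν hν).ne (TupleOfSize.ext h)
      have h3 := h1.mul h2
      have hlim : (β * (jackEigenvalue β u' l.1 - jackEigenvalue β u' mu.1))⁻¹ *
          ∑ ν ∈ S, β * H mu.1 ν.1 * c' ν =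
          (H l.1 l.1 - H mu.1 mu.1)⁻¹ * ∑ ν ∈ S, H mu.1 ν.1 * c' ν := by
        simp only [mul_assoc]
        rw [← Finset.mul_sum, hHself, hHself, mul_inv, mul_mul_mul_comm, inv_mul_cancel₀ hβ, one_mul]
      rw [hlim] at h3
      refine h3.congr' ?_
      filter_upwards [self_mem_nhdsWithin] with z hz
      have hz3 : z ^ 3 ≠ 0 := pow_ne_zero _ hz
      have : ∑ ν ∈ S, macMatrix β u' z mu.1 ν.1 / z ^ 3 * c ν z =
          (z ^ 3)⁻¹ * ∑ ν ∈ S, macMatrix β u' z mu.1 ν.1 * c ν z := by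
        rw [Finset.mul_sum]
        exact Finset.sum_congr rfl fun ν _ => by ring
      rw [this, inv_div, ← mul_assoc, div_mul_eq_mul_div, mul_inv_cancel₀ hz3, one_div]

end Generic

end GenMacdonald

end

open GenMacdonald in
theorem mainTheorem2 (N : ℕ) (lam : GenMacdonald.PtnTuple N) :
    (∃! P, ∃ d, GenMacdonald.GenericMacdonald lam P d) ∧
    (∃! J, ∃ d', GenMacdonald.GenericJack lam J d') ∧
    ∀ P d J d', GenMacdonald.GenericMacdonald lam P d → GenMacdonald.GenericJack lam J d' →
      GenMacdonald.jackHamiltonian (GenMacdonald.RatFun.var GenMacdonald.JackVar.beta)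
          (fun i => GenMacdonald.RatFun.var (GenMacdonald.JackVar.u i)) J =
        GenMacdonald.jackEigenvalue (GenMacdonald.RatFun.var GenMacdonald.JackVar.beta)
          (fun i => GenMacdonald.RatFun.var (GenMacdonald.JackVar.u i)) lam • J ∧
      ∀ (β : ℂ) (u' : Fin N → ℂ), β ≠ 0 →
        (∀ mu, GenMacdonald.ltL mu lam →
          GenMacdonald.jackEigenvalue β u' mu ≠ GenMacdonald.jackEigenvalue β u' lam) →
        ∀ mu, GenMacdonald.ltL mu lam →
          (∀ᶠ h in 𝓝[≠] (0 : ℂ), (d mu).RegularAt (GenMacdonald.macPoint β u' h)) ∧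
          (d' mu).RegularAt (GenMacdonald.jackPoint β u') ∧
          Tendsto (fun h : ℂ => (d mu).value (GenMacdonald.macPoint β u' h)) (𝓝[≠] 0)
            (𝓝 ((d' mu).value (GenMacdonald.jackPoint β u'))) := by
  obtain ⟨s, hs⟩ : ∃ s, ∑ i, (lam i).size = s := ⟨_, rfl⟩
  set l : TupleOfSize N s := ⟨lam, hs⟩ with hl
  -- There are finitely many tuples of size s, so one truncation bound serves them all.
  obtain ⟨M, hM⟩ := exists_isBound (fun ν : TupleOfSize N s => ν.1)
  have hX := genericX0_sum (N := N) (s := s)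
  have hXA : ∀ (mu : PtnTuple N) (ν : TupleOfSize N s), entry (X0 (RatFun.var MacVar.qRoot)
      (RatFun.var MacVar.tRoot) fun i => RatFun.var (MacVar.u i)) mu ν.1 ≠ 0 → leL mu ν.1 :=
    fun mu ν h => leL_of_genericMatrix_ne_zero h
  have hH := jackHamiltonian_sum hM (RatFun.var JackVar.beta) fun i => RatFun.var (JackVar.u i)
  have hHA : ∀ (mu : PtnTuple N) (ν : TupleOfSize N s), entry (jackHamiltonian
      (RatFun.var JackVar.beta) fun i => RatFun.var (JackVar.u i)) mu ν.1 ≠ 0 → leL mu ν.1 := by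
    intro mu ν h
    rw [entry_jackHamiltonian (hM ν)] at h
    exact leL_of_entry_ham_ne_zero _ _ (hM ν) h
  have hself : ∀ mu : TupleOfSize N s, entry (jackHamiltonian (RatFun.var JackVar.beta)
      fun i => RatFun.var (JackVar.u i)) mu.1 mu.1 = jackEigenvalue (RatFun.var JackVar.beta)
        (fun i => RatFun.var (JackVar.u i)) mu.1 := by
    intro mu
    rw [entry_jackHamiltonian (hM mu), entry_ham_self _ _ (hM mu), jackValue_eq]
  refine ⟨existsUnique_eigenfunction (l := l) hX hXA fun mu h => genericMatrix_self_ne h,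
    existsUnique_eigenfunction (l := l) hH hHA fun mu h => ?_, ?_⟩
  · rw [hself ⟨mu, h.1.1.trans hs⟩, hself l]
    exact jackEigenvalue_var_ne h
  intro P d J d' hP hJ
  obtain ⟨δ, -, hδl, hδs, hδd, hδrow, -⟩ := eigenfunction_coeff (l := l) hX hXA hP.1 hP.2
  obtain ⟨δ', -, hδl', hδs', hδd', hδrow', hJe⟩ := eigenfunction_coeff (l := l) hH hHA hJ.1 hJ.2
  refine ⟨by rw [hJe, hself], fun β u' hβ hgen mu hmu => ?_⟩
  set m : TupleOfSize N s := ⟨mu, hmu.1.1.trans hs⟩ with hm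
  have hml : m < l := TupleOfSize.lt_iff.2 hmu
  simp only [entry_jackHamiltonian (hM _)] at hδrow'
  obtain ⟨c, c', hc, hc', hcc⟩ := exists_tendsto_coeff hM hδl hδs hδrow hδl' hδs' hδrow' hβ hgen m
  rw [hδd m hml] at hc
  rw [hδd' m hml] at hc'
  refine ⟨hc.mono fun z hz => hz.num_den.1, hc'.num_den.1, ?_⟩
  rw [show (d' mu).value (jackPoint β u') = c' from hc'.num_den.2]
  exact hcc.congr' (hc.mono fun z hz => hz.num_den.2.symm)
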